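/- Write $|x|=|x_1|+\dots+|x_d|$ for $x\in\mathbb R^d$ or $x\in\mathbb Z^d$ and $\widehat f(\xi)=\int_{\mathbb R^d} e^{-i x\cdot\xi}f(x)\,dx$. Let $\mathscr S_m(\mathbb R^d)$ be the Gelfand–Shilov space of all $f\in C^\infty(\mathbb R^d;\mathbb C)$ such that, for every $\lambda>0$, $$p_\lambda(f)=\sup_{x}e^{\lambda|x|}|f(x)|<\infty,\qquad q_\lambda(f)=\sup_{\xi}e^{\lambda|\xi|}|\widehat f(\xi)|<\infty,$$ with the locally convex topology generated by the seminorms $p_\lambda,q_\lambda$ $(\lambda>0)$, and let $\mathscr S_m'$ be its dual, the space of continuous linear functionals on $\mathscr S_m$. For $s\in\mathbb R$ and $1\le p,q\le\infty$ let $E^s_{p,q}=E^s_{p,q}(\mathbb R^d)$ be the space of all $f\in\mathscr S_m'$ for which there are $f_k\in L^p(\mathbb R^d)$, $k\in\mathbb Z^d$, with $$\operatorname{supp}\widehat{f_k}\subset k+[-3/2,3/2]^d,\qquad f=\sum_{k\in\mathbb Z^d}f_k\ \text{ in }\mathscr S_m',\qquad \big\|\{2^{s|k|}f_k\}_k\big\|_{\ell^q(L^p)}<\infty,$$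 where $f_k\in L^p$ acts on $\varphi\in\mathscr S_m$ by $\int f_k\varphi\,dx$. Put $$\|f\|_{E^s_{p,q}}=\inf\big\|\{2^{s|k|}f_k\}_k\big\|_{\ell^q(L^p)},$$ the infimum being taken over all such decompositions of $f$. Let $\frac1p+\frac1{p'}=1=\frac1q+\frac1{q'}$. (Duality) Let $s\in\mathbb R$ and $1\le p,q<\infty$. Then $(E^s_{p,q})^*=E^{-s}_{p',q'}$ with equivalent norms. That is, $\mathscr S_m\subset E^s_{p,q}$ (a function $\varphi\in\mathscr S_m$ being identified with the functional $\psi\mapsto\int\varphi\psi\,dx$), and assigning to $L\in(E^s_{p,q})^*$ its restriction to $\mathscr S_m$ is a linear homeomorphism of $(E^s_{p,q})^*$ onto $E^{-s}_{p',q'}$. (Completeness) Let $s\in\mathbb R$ and $1\le p,q\le\infty$. Then $\|\cdot\|_{E^s_{p,q}}$ is a complete norm on $E^s_{p,q}$, i.e. $E^s_{p,q}$ is a Banach space. -/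

import Mathlib

open MeasureTheory Filter Topology FourierTransform SchwartzMap
open scoped ENNReal

noncomputable section

namespace ExpModulation

/-- The space `ℝ^d` with its Lebesgue measure. -/
abbrev Rd (d : ℕ) : Type := EuclideanSpace ℝ (Fin d)

/-- `|x| = |x_1| + ... + |x_d|` on `ℝ^d`. -/
def absOne {d : ℕ} (x : Rd d) : ℝ := ∑ i, |x i|

/-- `|k| = |k_1| + ... + |k_d|` on `ℤ^d`. -/
def absOneInt {d : ℕ} (k : Fin d → ℤ) : ℝ := ∑ i, |(k i : ℝ)|

/-- The Fourier transform in the angular-frequency convention,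
`ξ ↦ ∫ f(x) exp(-i x·ξ) dx` (Mathlib's transform uses `exp(-2π i x·ξ)`). -/
def angFourier {d : ℕ} (f : Rd d → ℂ) (ξ : Rd d) : ℂ := 𝓕 f ((2 * Real.pi)⁻¹ • ξ)

/-! ### The Gelfand-Shilov space of Beurling type and its dual -/

/-- `f` is smooth and, for every `l > 0`, both `exp(l|x|) |f(x)|` and `exp(l|ξ|) |f̂(ξ)|`
are bounded. -/
structure IsGelfandShilov {d : ℕ} (f : Rd d → ℂ) : Prop where
  smooth : ContDiff ℝ (⊤ : ℕ∞) f
  decay : ∀ l : ℝ, 0 < l → ∃ C : ℝ, ∀ x, Real.exp (l * absOne x) * ‖f x‖ ≤ C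
  decayFourier : ∀ l : ℝ, 0 < l →
    ∃ C : ℝ, ∀ ξ, Real.exp (l * absOne ξ) * ‖angFourier f ξ‖ ≤ C

lemma norm_le_absOne {d : ℕ} (x : Rd d) : ‖x‖ ≤ absOne x := by
  have h0 : 0 ≤ absOne x := Finset.sum_nonneg fun i _ => abs_nonneg _
  rw [EuclideanSpace.norm_eq]
  refine Real.sqrt_le_iff.2 ⟨h0, ?_⟩
  have := Finset.sum_sq_le_sq_sum_of_nonneg (s := Finset.univ) (f := fun i => |x i|)
    (fun i _ => abs_nonneg _)
  simpa [absOne] using this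

lemma IsGelfandShilov.norm_le {d : ℕ} {f : Rd d → ℂ} (hf : IsGelfandShilov f) :
    ∃ C : ℝ, 0 ≤ C ∧ ∀ x, ‖f x‖ ≤ C * (1 + ‖x‖) ^ (-((d : ℝ) + 1)) := by
  obtain ⟨C, hC⟩ := hf.decay (d + 1) (by positivity)
  have hC0 : 0 ≤ C := le_trans (by positivity) (hC 0)
  refine ⟨C, hC0, fun x => ?_⟩
  have hpos : 0 < (1 + ‖x‖) ^ ((d : ℝ) + 1) := by positivity
  have h1 : (1 + ‖x‖) ^ ((d : ℝ) + 1) ≤ Real.exp ((d + 1) * absOne x) := by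
    have h2 : 1 + ‖x‖ ≤ Real.exp (absOne x) := by
      have := Real.add_one_le_exp (absOne x)
      have := norm_le_absOne x
      linarith
    calc (1 + ‖x‖) ^ ((d : ℝ) + 1) ≤ (Real.exp (absOne x)) ^ ((d : ℝ) + 1) :=
          Real.rpow_le_rpow (by positivity) h2 (by positivity)
      _ = _ := by rw [← Real.exp_mul, mul_comm]
  rw [Real.rpow_neg (by positivity), ← div_eq_mul_inv, le_div_iff₀ hpos, mul_comm]
  exact (mul_le_mul_of_nonneg_right h1 (norm_nonneg _)).trans (hC x)

lemma IsGelfandShilov.memLp {d : ℕ} {f : Rd d → ℂ} (hf : IsGelfandShilov f) {r : ℝ≥0∞}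
    (hr : 1 ≤ r) : MemLp f r volume := by
  obtain ⟨C, hC0, hC⟩ := hf.norm_le
  have hm : AEStronglyMeasurable f volume := hf.smooth.continuous.aestronglyMeasurable
  by_cases hrt : r = ∞
  · subst hrt
    refine memLp_top_of_bound hm C (Eventually.of_forall fun x => (hC x).trans ?_)
    refine mul_le_of_le_one_right hC0 ?_
    exact Real.rpow_le_one_of_one_le_of_nonpos (by linarith [norm_nonneg x])
      (by linarith [(Nat.cast_nonneg d : (0 : ℝ) ≤ d)])
  have hr0 : r ≠ 0 := (zero_lt_one.trans_le hr).ne'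
  have hr1 : 1 ≤ r.toReal := by
    simpa using (ENNReal.toReal_le_toReal ENNReal.one_ne_top hrt).2 hr
  rw [← integrable_norm_rpow_iff hm hr0 hrt]
  have hint : Integrable
      (fun x : Rd d => C ^ r.toReal * (1 + ‖x‖) ^ (-(((d : ℝ) + 1) * r.toReal))) volume := by
    refine (integrable_one_add_norm ?_).const_mul _
    rw [finrank_euclideanSpace_fin]
    nlinarith [(Nat.cast_nonneg d : (0 : ℝ) ≤ d)]
  refine hint.mono (hm.norm.aemeasurable.pow_const _).aestronglyMeasurable (Eventually.of_forall fun x => ?_)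
  have h := Real.rpow_le_rpow (norm_nonneg _) (hC x) (zero_le_one.trans hr1)
  rw [Real.mul_rpow hC0 (by positivity), ← Real.rpow_mul (by positivity), neg_mul] at h
  rw [Real.norm_of_nonneg (by positivity), Real.norm_of_nonneg (by positivity)]
  exact h

lemma IsGelfandShilov.integrable {d : ℕ} {f : Rd d → ℂ} (hf : IsGelfandShilov f) :
    Integrable f volume := memLp_one_iff_integrable.1 (hf.memLp le_rfl)

lemma angFourier_add {d : ℕ} {f g : Rd d → ℂ} (hf : Integrable f volume)
    (hg : Integrable g volume) (ξ : Rd d) :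
    angFourier (f + g) ξ = angFourier f ξ + angFourier g ξ := by
  have := congrFun (VectorFourier.fourierIntegral_add Real.continuous_fourierChar
    (L := innerₗ (Rd d)) continuous_inner hf hg) ((2 * Real.pi)⁻¹ • ξ)
  exact this

lemma angFourier_smul {d : ℕ} (c : ℂ) (f : Rd d → ℂ) (ξ : Rd d) :
    angFourier (c • f) ξ = c * angFourier f ξ :=
  congrFun (VectorFourier.fourierIntegral_const_smul Real.fourierChar volume
    (innerₗ (Rd d)) f c) ((2 * Real.pi)⁻¹ • ξ)

/-- The functions of Gelfand-Shilov type, as a vector space. -/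
def gelfandShilovSubmodule (d : ℕ) : Submodule ℂ (Rd d → ℂ) where
  carrier := {f | IsGelfandShilov f}
  zero_mem' := by
    refine ⟨contDiff_const, fun l _ => ⟨0, by simp⟩, fun l _ => ⟨0, fun ξ => ?_⟩⟩
    have := angFourier_smul (0 : ℂ) (0 : Rd d → ℂ) ξ
    rw [zero_smul, zero_mul] at this
    simp [this]
  add_mem' := by
    intro f g hf hg
    refine ⟨hf.smooth.add hg.smooth, fun l hl => ?_, fun l hl => ?_⟩
    · obtain ⟨C, hC⟩ := hf.decay l hl
      obtain ⟨D, hD⟩ := hg.decay l hl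
      refine ⟨C + D, fun x => ?_⟩
      calc _ ≤ Real.exp (l * absOne x) * (‖f x‖ + ‖g x‖) := by
            gcongr; exact norm_add_le _ _
        _ ≤ C + D := by rw [mul_add]; exact add_le_add (hC x) (hD x)
    · obtain ⟨C, hC⟩ := hf.decayFourier l hl
      obtain ⟨D, hD⟩ := hg.decayFourier l hl
      refine ⟨C + D, fun x => ?_⟩
      rw [angFourier_add hf.integrable hg.integrable]
      calc _ ≤ Real.exp (l * absOne x) * (‖angFourier f x‖ + ‖angFourier g x‖) := by
            gcongr; exact norm_add_le _ _
        _ ≤ C + D := by rw [mul_add]; exact add_le_add (hC x) (hD x)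
  smul_mem' := by
    intro c f hf
    refine ⟨contDiff_const.smul hf.smooth, fun l hl => ?_, fun l hl => ?_⟩
    · obtain ⟨C, hC⟩ := hf.decay l hl
      refine ⟨‖c‖ * C, fun x => ?_⟩
      rw [Pi.smul_apply, norm_smul, mul_left_comm]
      exact mul_le_mul_of_nonneg_left (hC x) (norm_nonneg _)
    · obtain ⟨C, hC⟩ := hf.decayFourier l hl
      refine ⟨‖c‖ * C, fun x => ?_⟩
      rw [angFourier_smul, norm_mul, mul_left_comm]
      exact mul_le_mul_of_nonneg_left (hC x) (norm_nonneg _)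

/-- The Gelfand-Shilov space `𝒮_1 = 𝒮_m` of Beurling type on `ℝ^d`. It is a type of its own,
so that it does not carry the topology of pointwise convergence. -/
def GelfandShilov (d : ℕ) : Type := gelfandShilovSubmodule d

namespace GelfandShilov

variable {d : ℕ}

instance : AddCommGroup (GelfandShilov d) :=
  inferInstanceAs (AddCommGroup (gelfandShilovSubmodule d))

instance : Module ℂ (GelfandShilov d) :=
  inferInstanceAs (Module ℂ (gelfandShilovSubmodule d))

instance : CoeFun (GelfandShilov d) (fun _ => Rd d → ℂ) := ⟨fun φ => φ.1⟩

lemma isGelfandShilov (φ : GelfandShilov d) : IsGelfandShilov φ := φ.2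

@[simp] lemma coe_add (φ ψ : GelfandShilov d) : (φ + ψ : GelfandShilov d).1 = φ.1 + ψ.1 := rfl

@[simp] lemma coe_smul (c : ℂ) (φ : GelfandShilov d) : (c • φ : GelfandShilov d).1 = c • φ.1 :=
  rfl

/-- A weighted sup seminorm, from a linear family of evaluations with bounded weighted values. -/
def supSeminorm (T : GelfandShilov d → Rd d → ℂ) (w : Rd d → ℝ) (hw : ∀ x, 0 ≤ w x)
    (hadd : ∀ φ ψ x, T (φ + ψ) x = T φ x + T ψ x) (hsmul : ∀ (c : ℂ) φ x, T (c • φ) x = c * T φ x)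
    (hbdd : ∀ φ, ∃ C : ℝ, ∀ x, w x * ‖T φ x‖ ≤ C) : Seminorm ℂ (GelfandShilov d) :=
  Seminorm.of (fun φ => ⨆ x, w x * ‖T φ x‖)
    (fun φ ψ => by
      have hb : ∀ φ, BddAbove (Set.range fun x => w x * ‖T φ x‖) := fun φ => by
        obtain ⟨C, hC⟩ := hbdd φ
        exact ⟨C, by rintro _ ⟨x, rfl⟩; exact hC x⟩
      refine ciSup_le fun x => ?_
      calc w x * ‖T (φ + ψ) x‖ ≤ w x * ‖T φ x‖ + w x * ‖T ψ x‖ := by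
            rw [hadd, ← mul_add]
            exact mul_le_mul_of_nonneg_left (norm_add_le _ _) (hw x)
        _ ≤ _ := add_le_add (le_ciSup (hb φ) x) (le_ciSup (hb ψ) x))
    (fun c φ => by
      rw [Real.mul_iSup_of_nonneg (norm_nonneg c)]
      congr 1
      funext x
      rw [hsmul, norm_mul, mul_left_comm])

/-- `p_l(φ) = sup_x exp(l|x|) |φ(x)|`. -/
def seminormP (l : Set.Ioi (0 : ℝ)) : Seminorm ℂ (GelfandShilov d) :=
  supSeminorm (fun φ => φ) (fun x => Real.exp (l * absOne x)) (fun _ => (Real.exp_pos _).le)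
    (fun _ _ _ => rfl) (fun _ _ _ => rfl) (fun φ => φ.isGelfandShilov.decay l l.2)

/-- `q_l(φ) = sup_ξ exp(l|ξ|) |φ̂(ξ)|`. -/
def seminormQ (l : Set.Ioi (0 : ℝ)) : Seminorm ℂ (GelfandShilov d) :=
  supSeminorm (fun φ => angFourier φ) (fun ξ => Real.exp (l * absOne ξ))
    (fun _ => (Real.exp_pos _).le)
    (fun φ ψ x => angFourier_add φ.isGelfandShilov.integrable ψ.isGelfandShilov.integrable x)
    (fun c φ x => angFourier_smul c φ x)
    (fun φ => φ.isGelfandShilov.decayFourier l l.2)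

lemma seminormP_apply (l : Set.Ioi (0 : ℝ)) (φ : GelfandShilov d) :
    seminormP l φ = ⨆ x, Real.exp (l * absOne x) * ‖φ x‖ := rfl

lemma seminormQ_apply (l : Set.Ioi (0 : ℝ)) (φ : GelfandShilov d) :
    seminormQ l φ = ⨆ ξ, Real.exp (l * absOne ξ) * ‖angFourier φ ξ‖ := rfl

/-- The family of all `p_l`, `q_l` with `l > 0`. -/
def seminormFamily (d : ℕ) :
    SeminormFamily ℂ (GelfandShilov d) (Set.Ioi (0 : ℝ) ⊕ Set.Ioi (0 : ℝ)) :=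
  Sum.elim seminormP seminormQ

/-- The locally convex topology generated by the seminorms `p_l`, `q_l`. -/
instance : TopologicalSpace (GelfandShilov d) :=
  (seminormFamily d).moduleFilterBasis.topology

lemma withSeminorms (d : ℕ) : WithSeminorms (seminormFamily d) := ⟨rfl⟩

end GelfandShilov

/-- The tempered ultradistributions `𝒮'_m = 𝒮'_1`: the continuous linear functionals on the
Gelfand-Shilov space. -/
abbrev UltraDistribution (d : ℕ) : Type := GelfandShilov d →L[ℂ] ℂ

/-! ### The spaces `E^s_{p,q}` -/

/-- The cube `k + [-3/2, 3/2]^d` of angular frequencies, expressed in the frequency variable of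
Mathlib's Fourier transform (angular frequency divided by `2π`). -/
def freqCube {d : ℕ} (k : Fin d → ℤ) : Set (Rd d) :=
  {ξ | ∀ i, |2 * Real.pi * ξ i - k i| ≤ 3 / 2}

/-- The (tempered distributional) Fourier transform of `f ∈ L^p` has support in
`k + [-3/2, 3/2]^d`, that is, it vanishes on the open complement of this closed cube. -/
def HasSpectrumIn {d : ℕ} {p : ℝ≥0∞} [Fact (1 ≤ p)] (f : Lp ℂ p (volume : Measure (Rd d)))
    (k : Fin d → ℤ) : Prop :=
  Distribution.IsVanishingOn (𝓕 (Lp.toTemperedDistribution f : 𝓢'(Rd d, ℂ)) : 𝓢'(Rd d, ℂ))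
    (freqCube k)ᶜ

variable (d : ℕ) (s : ℝ) (p q : ℝ≥0∞) [Fact (1 ≤ p)] [Fact (1 ≤ q)]

/-- The weighted sequence `{2^{s|k|} f_k}`. -/
def weighted {d : ℕ} (s : ℝ) {p : ℝ≥0∞} [Fact (1 ≤ p)]
    (f : (Fin d → ℤ) → Lp ℂ p (volume : Measure (Rd d))) :
    PreLp (fun _ : Fin d → ℤ => Lp ℂ p (volume : Measure (Rd d))) :=
  fun k => ((2 : ℝ) ^ (s * absOneInt k)) • f k

/-- `u = ∑_k f_k` in `𝒮'_m` with `f_k ∈ L^p`, `supp f̂_k ⊂ k + [-3/2, 3/2]^d` and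
`{2^{s|k|} f_k} ∈ ℓ^q(L^p)`. -/
structure IsDecomposition {d : ℕ} (s : ℝ) {p : ℝ≥0∞} (q : ℝ≥0∞) [Fact (1 ≤ p)]
    (u : UltraDistribution d)
    (f : (Fin d → ℤ) → Lp ℂ p (volume : Measure (Rd d))) : Prop where
  spectrum : ∀ k, HasSpectrumIn (f k) k
  hasSum : ∀ φ : GelfandShilov d, HasSum (fun k => ∫ x, f k x * φ x) (u φ)
  memlp : Memℓp (weighted s f) q

/-- The norms `‖{2^{s|k|} f_k}‖_{ℓ^q(L^p)}` of all decompositions of `u`. -/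
def decompositionNorms {d : ℕ} (u : UltraDistribution d) : Set ℝ :=
  {r | ∃ (f : (Fin d → ℤ) → Lp ℂ p (volume : Measure (Rd d))) (h : IsDecomposition s q u f),
    r = ‖(⟨weighted s f, h.memlp⟩ :
      lp (fun _ : Fin d → ℤ => Lp ℂ p (volume : Measure (Rd d))) q)‖}

variable {d s p q}

lemma integrable_mul (f : Lp ℂ p (volume : Measure (Rd d))) (φ : GelfandShilov d) :
    Integrable (fun x => f x * φ x) volume := by
  have := ENNReal.HolderConjugate.inv_one_sub_inv' (Fact.out : 1 ≤ p)
  have h1 : (1 : ℝ≥0∞) ≤ (1 - p⁻¹)⁻¹ := by simp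
  exact (Lp.memLp f).integrable_mul (φ.isGelfandShilov.memLp h1)

lemma weighted_add (f g : (Fin d → ℤ) → Lp ℂ p (volume : Measure (Rd d))) :
    weighted s (f + g) = weighted s f + weighted s g := by
  funext k; exact smul_add _ _ _

lemma weighted_smul (c : ℂ) (f : (Fin d → ℤ) → Lp ℂ p (volume : Measure (Rd d))) :
    weighted s (c • f) = c • weighted s f := by
  funext k; exact smul_comm _ c (f k)

lemma IsDecomposition.add {u v : UltraDistribution d}
    {f g : (Fin d → ℤ) → Lp ℂ p (volume : Measure (Rd d))}
    (hf : IsDecomposition s q u f) (hg : IsDecomposition s q v g) :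
    IsDecomposition s q (u + v) (f + g) := by
  refine ⟨fun k φ hφ => ?_, fun φ => ?_, ?_⟩
  · have h : Lp.toTemperedDistribution (f k + g k) =
      Lp.toTemperedDistribution (f k) + Lp.toTemperedDistribution (g k) :=
      map_add (Lp.toTemperedDistributionCLM ℂ (volume : Measure (Rd d)) p) (f k) (g k)
    have h1 := hf.spectrum k φ hφ
    have h2 := hg.spectrum k φ hφ
    rw [TemperedDistribution.fourier_apply] at h1 h2 ⊢
    rw [Pi.add_apply, h]
    exact (congrArg₂ (· + ·) h1 h2).trans (add_zero 0)
  · convert (hf.hasSum φ).add (hg.hasSum φ) using 2 with k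
    · rw [← integral_add (integrable_mul _ _) (integrable_mul _ _)]
      refine integral_congr_ae ?_
      filter_upwards [Lp.coeFn_add (f k) (g k)] with x hx
      rw [Pi.add_apply, hx, Pi.add_apply, add_mul]
    · rfl
  · rw [weighted_add]
    exact hf.memlp.add hg.memlp

lemma IsDecomposition.smul {u : UltraDistribution d}
    {f : (Fin d → ℤ) → Lp ℂ p (volume : Measure (Rd d))}
    (hf : IsDecomposition s q u f) (c : ℂ) : IsDecomposition s q (c • u) (c • f) := by
  refine ⟨fun k φ hφ => ?_, fun φ => ?_, ?_⟩
  · have h : Lp.toTemperedDistribution (c • f k) = c • Lp.toTemperedDistribution (f k) :=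
      map_smul (Lp.toTemperedDistributionCLM ℂ (volume : Measure (Rd d)) p) c (f k)
    have h1 := hf.spectrum k φ hφ
    rw [TemperedDistribution.fourier_apply] at h1 ⊢
    rw [Pi.smul_apply, h]
    exact (congrArg (c • ·) h1).trans (smul_zero c)
  · convert (hf.hasSum φ).const_smul c using 2 with k
    · rw [← integral_smul]
      refine integral_congr_ae ?_
      filter_upwards [Lp.coeFn_smul c (f k)] with x hx
      rw [Pi.smul_apply, hx, Pi.smul_apply, smul_eq_mul, smul_eq_mul, mul_assoc]
    · rfl
  · rw [weighted_smul]
    exact hf.memlp.const_smul c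

lemma isDecomposition_zero :
    IsDecomposition s q (0 : UltraDistribution d)
      (0 : (Fin d → ℤ) → Lp ℂ p (volume : Measure (Rd d))) := by
  refine ⟨fun k φ hφ => ?_, fun φ => ?_, ?_⟩
  · have h : Lp.toTemperedDistribution (0 : Lp ℂ p (volume : Measure (Rd d))) = 0 :=
      map_zero (Lp.toTemperedDistributionCLM ℂ (volume : Measure (Rd d)) p)
    rw [TemperedDistribution.fourier_apply, Pi.zero_apply, h]
    rfl
  · convert hasSum_zero (α := ℂ) (β := Fin d → ℤ) using 2 with k
    · rw [← integral_zero (Rd d) ℂ]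
      refine integral_congr_ae ?_
      filter_upwards [Lp.coeFn_zero ℂ p (volume : Measure (Rd d))] with x hx
      rw [Pi.zero_apply, hx, Pi.zero_apply, zero_mul]
    · rfl
  · have : weighted s (0 : (Fin d → ℤ) → Lp ℂ p (volume : Measure (Rd d))) = 0 := by
      funext k; exact smul_zero _
    rw [this]
    exact zero_memℓp

variable (d s p q)

/-- The elements of `𝒮'_m` that admit a decomposition. -/
def expModSubmodule : Submodule ℂ (UltraDistribution d) where
  carrier := {u | ∃ f : (Fin d → ℤ) → Lp ℂ p (volume : Measure (Rd d)), IsDecomposition s q u f}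
  zero_mem' := ⟨0, isDecomposition_zero⟩
  add_mem' := by
    rintro u v ⟨f, hf⟩ ⟨g, hg⟩
    exact ⟨f + g, hf.add hg⟩
  smul_mem' := by
    rintro c u ⟨f, hf⟩
    exact ⟨c • f, hf.smul c⟩

/-- The space `E^s_{p,q}(ℝ^d)`. It is a type of its own, so that its topology is the one
of its norm. -/
def ExpMod : Type := expModSubmodule d s p q

namespace ExpMod

variable {d s p q}

instance : AddCommGroup (ExpMod d s p q) :=
  inferInstanceAs (AddCommGroup (expModSubmodule d s p q))

instance : Module ℂ (ExpMod d s p q) :=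
  inferInstanceAs (Module ℂ (expModSubmodule d s p q))

/-- The inclusion of `E^s_{p,q}` in `𝒮'_m`. -/
def toUltra : ExpMod d s p q →ₗ[ℂ] UltraDistribution d := (expModSubmodule d s p q).subtype

/-- `‖u‖ = inf ‖{2^{s|k|} f_k}‖_{ℓ^q(L^p)}` over all decompositions `u = ∑_k f_k`. -/
instance : Norm (ExpMod d s p q) := ⟨fun u => sInf (decompositionNorms s p q u.toUltra)⟩

lemma norm_def (u : ExpMod d s p q) : ‖u‖ = sInf (decompositionNorms s p q u.toUltra) := rfl

lemma decompositionNorms_nonempty (u : ExpMod d s p q) :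
    (decompositionNorms s p q u.toUltra).Nonempty := by
  obtain ⟨f, hf⟩ := u.2
  exact ⟨_, f, hf, rfl⟩

lemma nonneg_of_mem {u : UltraDistribution d} {r : ℝ} (hr : r ∈ decompositionNorms s p q u) :
    0 ≤ r := by
  obtain ⟨f, hf, rfl⟩ := hr
  exact norm_nonneg _

lemma bddBelow (u : UltraDistribution d) : BddBelow (decompositionNorms s p q u) :=
  ⟨0, fun _ hr => nonneg_of_mem hr⟩

lemma norm_smul_le_aux (c : ℂ) (u : ExpMod d s p q) : ‖c • u‖ ≤ ‖c‖ * ‖u‖ := by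
  rw [norm_def u, ← smul_eq_mul, ← Real.sInf_smul_of_nonneg (norm_nonneg c)]
  refine le_csInf (u.decompositionNorms_nonempty.image _) ?_
  rintro _ ⟨r, ⟨f, hf, rfl⟩, rfl⟩
  refine csInf_le (bddBelow _) ⟨c • f, ?_, ?_⟩
  · rw [map_smul]; exact hf.smul c
  · simp only [smul_eq_mul]
    rw [← norm_smul]
    congr 1
    exact Subtype.ext (weighted_smul c f).symm

/-- The infimum is a seminorm on `E^s_{p,q}`. -/
lemma seminormedCore : SeminormedSpace.Core ℂ (ExpMod d s p q) where
  norm_nonneg u := Real.sInf_nonneg fun _ hr => nonneg_of_mem hr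
  norm_smul c u := by
    refine le_antisymm (norm_smul_le_aux c u) ?_
    rcases eq_or_ne c 0 with rfl | hc
    · rw [norm_zero, zero_mul]
      exact Real.sInf_nonneg fun _ hr => nonneg_of_mem hr
    · have h := norm_smul_le_aux c⁻¹ (c • u)
      rw [inv_smul_smul₀ hc, norm_inv, inv_mul_eq_div, le_div_iff₀ (norm_pos_iff.2 hc)] at h
      rwa [mul_comm]
  norm_triangle u v := by
    rw [norm_def u, norm_def v, ← csInf_add u.decompositionNorms_nonempty (bddBelow _)
      v.decompositionNorms_nonempty (bddBelow _)]
    refine le_csInf (u.decompositionNorms_nonempty.add v.decompositionNorms_nonempty) ?_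
    rintro _ ⟨_, ⟨f, hf, rfl⟩, _, ⟨g, hg, rfl⟩, rfl⟩
    have hfg : IsDecomposition s q (toUltra (u + v)) (f + g) := by
      rw [map_add]; exact hf.add hg
    refine (csInf_le (bddBelow _) ⟨f + g, hfg, rfl⟩).trans ?_
    refine le_trans (le_of_eq ?_) (norm_add_le _ _)
    congr 1
    exact Subtype.ext (weighted_add f g)

instance : SeminormedAddCommGroup (ExpMod d s p q) :=
  SeminormedAddCommGroup.ofCore seminormedCore

instance : NormedSpace ℂ (ExpMod d s p q) where
  norm_smul_le c u := (seminormedCore.norm_smul c u).le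

end ExpMod

end ExpModulation

end

/-!
The sequences `w` in `ℓ^q(L^p)` whose `k`-th entry has spectrum in the `k`-th frequency cube form a
Banach space, `w ↦ ∑ₖ 2^{-s|k|} wₖ` maps it onto `E^s_{p,q}`, and the norm of `E^s_{p,q}` is the
quotient seminorm, so absolutely convergent series in `E^s_{p,q}` lift and hence converge. The sums
make sense, and the seminorm is definite, because the part of a test function in the `k`-th cube
decays faster than any exponential in `|k|`.

For the duality, fix a smooth even partition of unity over the lattice whose pieces fit in these
cubes. A functional on `E^s_{p,q}` extends by Hahn-Banach from the closed subspace to `ℓ^q(L^p)`;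
each component, composed with a piece of the partition of unity, is given by an integral kernel in
`L^{p'}`, and converse Hölder inequalities bound the kernels in `ℓ^{q'}(L^{p'})`. Conversely the
components of an element of `E^{-s}_{p',q'}` are paired with wide frequency cutoffs of `f`, which do
not depend on the decomposition of `f`. The restriction to test functions is injective because they
are dense: a Schwartz function with compact spectrum times a wide Gaussian is a test function.
-/

noncomputable section

namespace ExpModulation

/-! ### Smooth frequency cutoffs -/

section Cutoffs

variable {d : ℕ}

/-- A smooth even function on the line, bounded by one and supported in `[-3, 3]`: the
one-dimensional profile of the multipliers that localise frequencies to a cube. -/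
structure Cutoff where
  toFun : ℝ → ℝ
  smooth : ContDiff ℝ (⊤ : ℕ∞) toFun
  even : ∀ t, toFun (-t) = toFun t
  eq_zero : ∀ t, 3 ≤ |t| → toFun t = 0
  abs_le_one : ∀ t, |toFun t| ≤ 1

namespace Cutoff

open Real (smoothTransition)

lemma smoothTransition_one_sub (t : ℝ) : smoothTransition (1 - t) = 1 - smoothTransition t := by
  have h := (smoothTransition.pos_denom t).ne'
  rw [smoothTransition, smoothTransition, sub_sub_cancel, add_comm (expNegInvGlue (1 - t)),
    eq_sub_iff_add_eq, ← add_div, add_comm (expNegInvGlue (1 - t)), div_self h]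

lemma smoothTransition_sub_eq_zero {a t : ℝ} (ha : 1 ≤ 2 * a) (ht : a ≤ |t|) :
    smoothTransition (t + a) - smoothTransition (t + (1 - a)) = 0 := by
  rcases le_abs.1 ht with h | h
  · rw [smoothTransition.one_of_one_le (by linarith), smoothTransition.one_of_one_le (by linarith),
      sub_self]
  · rw [smoothTransition.zero_of_nonpos (by linarith),
      smoothTransition.zero_of_nonpos (by linarith), sub_self]

/-- The plateau function `t ↦ S(t + a) - S(t + 1 - a)` built from the smooth transition `S`:
it vanishes for `|t| ≥ a` and equals one for `|t| ≤ a - 1`. -/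
def plateau (a : ℝ) (ha : 1 ≤ 2 * a) (ha' : a ≤ 3) : Cutoff where
  toFun t := smoothTransition (t + a) - smoothTransition (t + (1 - a))
  smooth := (smoothTransition.contDiff.comp (contDiff_id.add contDiff_const)).sub
    (smoothTransition.contDiff.comp (contDiff_id.add contDiff_const))
  even t := by
    rw [show -t + a = 1 - (t + (1 - a)) by ring, show -t + (1 - a) = 1 - (t + a) by ring,
      smoothTransition_one_sub, smoothTransition_one_sub]
    ring
  eq_zero t ht := smoothTransition_sub_eq_zero ha (ha'.trans ht)
  abs_le_one t := by
    rw [abs_le]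
    constructor <;> linarith [smoothTransition.nonneg (t + a), smoothTransition.le_one (t + a),
      smoothTransition.nonneg (t + (1 - a)), smoothTransition.le_one (t + (1 - a))]

/-- The generator of a partition of unity over the integers, supported in `[-1, 1]`. -/
def narrow : Cutoff := plateau 1 (by norm_num) (by norm_num)

/-- A cutoff that is one on `[-2, 2]`. -/
def wide : Cutoff := plateau 3 (by norm_num) le_rfl

lemma wide_eq_one {t : ℝ} (ht : |t| ≤ 2) : wide.toFun t = 1 := by
  obtain ⟨h1, h2⟩ := abs_le.1 ht
  simp only [wide, plateau]
  rw [smoothTransition.one_of_one_le (by linarith),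
    smoothTransition.zero_of_nonpos (by linarith), sub_zero]

lemma narrow_eq_zero {t : ℝ} (ht : 1 ≤ |t|) : narrow.toFun t = 0 :=
  smoothTransition_sub_eq_zero (by norm_num) ht

lemma narrow_nonneg (t : ℝ) : 0 ≤ narrow.toFun t :=
  sub_nonneg.2 (smoothTransition.monotone (by linarith))

lemma narrow_fract_add_narrow_fract_sub_one (t : ℝ) :
    narrow.toFun (t - ⌊t⌋) + narrow.toFun (t - (⌊t⌋ + 1)) = 1 := by
  have h1 := Int.floor_le t
  have h2 := Int.lt_floor_add_one t
  simp only [narrow, plateau, sub_self, add_zero, sub_add_cancel, ← sub_sub]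
  rw [smoothTransition.one_of_one_le (x := t - ⌊t⌋ + 1) (by linarith),
    smoothTransition.zero_of_nonpos (x := t - ⌊t⌋ - 1) (by linarith)]
  ring

/-- The function `ξ ↦ ∏_i τ(2π ξ_i - k_i)`; the factor `2π` converts the frequency variable of
Mathlib's Fourier transform to angular frequency. -/
def tensor (τ : Cutoff) (k : Fin d → ℤ) (ξ : Rd d) : ℝ :=
  ∏ i, τ.toFun (2 * Real.pi * ξ i - k i)

variable {τ : Cutoff} {k : Fin d → ℤ} {ξ : Rd d}

lemma contDiff_tensor (τ : Cutoff) (k : Fin d → ℤ) : ContDiff ℝ (⊤ : ℕ∞) (τ.tensor k) :=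
  contDiff_prod fun i _ => τ.smooth.comp
    ((contDiff_const.mul (contDiff_piLp_apply 2 (i := i))).sub contDiff_const)

lemma tensor_eq_zero {i : Fin d} (h : 3 ≤ |2 * Real.pi * ξ i - k i|) : τ.tensor k ξ = 0 :=
  Finset.prod_eq_zero (Finset.mem_univ i) (τ.eq_zero _ h)

lemma narrow_tensor_eq_zero {i : Fin d} (h : 1 ≤ |2 * Real.pi * ξ i - k i|) :
    narrow.tensor k ξ = 0 :=
  Finset.prod_eq_zero (Finset.mem_univ i) (narrow_eq_zero h)

lemma wide_tensor_eq_one (h : ∀ i, |2 * Real.pi * ξ i - k i| ≤ 2) : wide.tensor k ξ = 1 :=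
  Finset.prod_eq_one fun i _ => wide_eq_one (h i)

lemma abs_tensor_le_one (τ : Cutoff) (k : Fin d → ℤ) (ξ : Rd d) : |τ.tensor k ξ| ≤ 1 := by
  rw [tensor, Finset.abs_prod]
  exact Finset.prod_le_one (fun _ _ => abs_nonneg _) fun _ _ => τ.abs_le_one _

lemma narrow_tensor_nonneg (k : Fin d → ℤ) (ξ : Rd d) : 0 ≤ narrow.tensor k ξ :=
  Finset.prod_nonneg fun _ _ => narrow_nonneg _

lemma tensor_neg (τ : Cutoff) (k : Fin d → ℤ) (ξ : Rd d) : τ.tensor k (-ξ) = τ.tensor (-k) ξ := by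
  refine Finset.prod_congr rfl fun i _ => ?_
  rw [← τ.even, PiLp.neg_apply, Pi.neg_apply, Int.cast_neg]
  ring_nf

lemma hasSum_narrow_tensor (ξ : Rd d) : HasSum (fun k => narrow.tensor k ξ) 1 := by
  set J : Fin d → Finset ℤ := fun i => {⌊2 * Real.pi * ξ i⌋, ⌊2 * Real.pi * ξ i⌋ + 1} with hJ
  have hsum : ∑ k ∈ Fintype.piFinset J, narrow.tensor k ξ = 1 := by
    simp only [tensor]
    rw [← Finset.prod_univ_sum J fun i (j : ℤ) => narrow.toFun (2 * Real.pi * ξ i - j)]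
    refine Finset.prod_eq_one fun i _ => ?_
    rw [Finset.sum_pair (by simp), Int.cast_add, Int.cast_one,
      narrow_fract_add_narrow_fract_sub_one]
  rw [← hsum]
  refine hasSum_sum_of_ne_finset_zero fun k hk => ?_
  rw [Fintype.mem_piFinset, not_forall] at hk
  obtain ⟨i, hi⟩ := hk
  refine narrow_tensor_eq_zero (i := i) (not_lt.1 fun hlt => hi ?_)
  obtain ⟨h1, h2⟩ := abs_lt.1 hlt
  have h3 : k i - 1 ≤ ⌊2 * Real.pi * ξ i⌋ := Int.le_floor.2 (by push_cast; linarith)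
  have h4 : ⌊2 * Real.pi * ξ i⌋ < k i + 1 := Int.floor_lt.2 (by push_cast; linarith)
  simp only [hJ, Finset.mem_insert, Finset.mem_singleton]
  omega

lemma sum_narrow_tensor_of_subset {S : Finset (Fin d → ℤ)}
    (hS : ∀ k : Fin d → ℤ, (∀ i, |2 * Real.pi * ξ i - k i| < 1) → k ∈ S) :
    ∑ k ∈ S, narrow.tensor k ξ = 1 := by
  refine HasSum.unique (hasSum_sum_of_ne_finset_zero fun k hk => ?_) (hasSum_narrow_tensor ξ)
  obtain ⟨i, hi⟩ := not_forall.1 fun h => hk (hS k h)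
  exact narrow_tensor_eq_zero (not_lt.1 hi)

lemma hasCompactSupport_tensor (τ : Cutoff) (k : Fin d → ℤ) :
    HasCompactSupport (fun ξ => (τ.tensor k ξ : ℂ)) := by
  refine HasCompactSupport.of_support_subset_isCompact
    (isCompact_closedBall (0 : Rd d) (∑ i, ((3 + |(k i : ℝ)|) / (2 * Real.pi)))) fun ξ hξ => ?_
  rw [mem_closedBall_zero_iff]
  refine (norm_le_absOne ξ).trans (Finset.sum_le_sum fun i _ => ?_)
  have h : |2 * Real.pi * ξ i - k i| < 3 :=
    not_le.1 fun h => hξ (by simp [tensor_eq_zero h])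
  rw [le_div_iff₀ Real.two_pi_pos, ← abs_of_pos Real.two_pi_pos, ← abs_mul, mul_comm]
  linarith [abs_sub_abs_le_abs_sub (2 * Real.pi * ξ i) (k i)]

/-- The tensor product `τ.tensor k` as a Schwartz function: the Fourier multiplier that localises
to a neighbourhood of the cube of index `k`. -/
def symbol (τ : Cutoff) (k : Fin d → ℤ) : 𝓢(Rd d, ℂ) :=
  (τ.hasCompactSupport_tensor k).toSchwartzMap
    (Complex.ofRealCLM.contDiff.comp (τ.contDiff_tensor k))

@[simp] lemma symbol_apply (τ : Cutoff) (k : Fin d → ℤ) (ξ : Rd d) :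
    τ.symbol k ξ = (τ.tensor k ξ : ℂ) :=
  rfl

end Cutoff

end Cutoffs

/-! ### Fourier multipliers and pairings on Schwartz functions -/

section Multiplier

variable {V : Type*} [NormedAddCommGroup V] [InnerProductSpace ℝ V] [FiniteDimensional ℝ V]
  [MeasurableSpace V] [BorelSpace V]

lemma fourierInv_apply_eq_fourier_neg (ψ : 𝓢(V, ℂ)) (ξ : V) : 𝓕⁻ ψ ξ = 𝓕 ψ (-ξ) := by
  rw [SchwartzMap.fourierInv_apply_eq]
  rfl

lemma fourier_fourier_apply (ψ : 𝓢(V, ℂ)) (x : V) : 𝓕 (𝓕 ψ) x = ψ (-x) := by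
  rw [← neg_neg x, ← fourierInv_apply_eq_fourier_neg, FourierTransform.fourierInv_fourier_eq,
    neg_neg]

lemma fourier_fourierMultiplier_apply (M ψ : 𝓢(V, ℂ)) (ξ : V) :
    𝓕 (fourierMultiplierCLM ℂ M ψ) ξ = M ξ * 𝓕 ψ ξ := by
  rw [fourierMultiplierCLM_apply, FourierTransform.fourier_fourierInv_eq,
    smulLeftCLM_apply_apply M.hasTemperateGrowth, smul_eq_mul]

lemma fourier_injective : Function.Injective (𝓕 : 𝓢(V, ℂ) → 𝓢(V, ℂ)) :=
  Function.LeftInverse.injective FourierTransform.fourierInv_fourier_eq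

lemma fourierMultiplier_eq_convolution (M ψ : 𝓢(V, ℂ)) :
    fourierMultiplierCLM ℂ M ψ = convolution (ContinuousLinearMap.mul ℂ ℂ) (𝓕⁻ M) ψ := by
  refine fourier_injective (SchwartzMap.ext fun ξ => ?_)
  rw [fourier_fourierMultiplier_apply, SchwartzMap.fourier_convolution,
    FourierTransform.fourier_fourierInv_eq]
  rfl

lemma fourierMultiplier_apply_eq_integral (M ψ : 𝓢(V, ℂ)) (x : V) :
    fourierMultiplierCLM ℂ M ψ x = ∫ t, 𝓕⁻ M t * ψ (x - t) := by
  rw [fourierMultiplier_eq_convolution, SchwartzMap.convolution_apply]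
  rfl

lemma fourierMultiplier_comm (M ψ : 𝓢(V, ℂ)) :
    fourierMultiplierCLM ℂ M ψ = fourierMultiplierCLM ℂ (𝓕 ψ : 𝓢(V, ℂ)) (𝓕⁻ M) := by
  refine fourier_injective (SchwartzMap.ext fun ξ => ?_)
  rw [fourier_fourierMultiplier_apply, fourier_fourierMultiplier_apply,
    FourierTransform.fourier_fourierInv_eq, mul_comm]

lemma integral_fourierMultiplier_mul {M M' : 𝓢(V, ℂ)} (h : ∀ ξ, M' ξ = M (-ξ)) (ψ φ : 𝓢(V, ℂ)) :
    ∫ x, fourierMultiplierCLM ℂ M ψ x * φ x = ∫ x, ψ x * fourierMultiplierCLM ℂ M' φ x := by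
  calc ∫ x, fourierMultiplierCLM ℂ M ψ x * φ x
      = ∫ ξ, 𝓕 (fourierMultiplierCLM ℂ M ψ) ξ * 𝓕⁻ φ ξ := by
        rw [← SchwartzMap.integral_fourierInv_mul_eq, FourierTransform.fourierInv_fourier_eq]
    _ = ∫ ξ, 𝓕 ψ ξ * 𝓕⁻ (fourierMultiplierCLM ℂ M' φ) ξ := by
        refine integral_congr_ae (Eventually.of_forall fun ξ => ?_)
        simp only [fourier_fourierMultiplier_apply, fourierInv_apply_eq_fourier_neg, h, neg_neg]
        ring
    _ = ∫ x, ψ x * fourierMultiplierCLM ℂ M' φ x := by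
        rw [SchwartzMap.integral_fourier_mul_eq, FourierTransform.fourier_fourierInv_eq]

section Pairing

variable {α : Type*} [MeasurableSpace α] (μ : Measure α) (p p' : ℝ≥0∞)
  [ENNReal.HolderConjugate p p'] [Fact (1 ≤ p)] [Fact (1 ≤ p')]

/-- The bilinear pairing `(f, g) ↦ ∫ f g` of `L^p` and `L^{p'}`. -/
abbrev mulPairing : Lp ℂ p μ →L[ℂ] Lp ℂ p' μ →L[ℂ] ℂ :=
  (ContinuousLinearMap.mul ℂ ℂ).lpPairing μ p p'

variable {μ p p'}

lemma mulPairing_apply (f : Lp ℂ p μ) (g : Lp ℂ p' μ) :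
    mulPairing μ p p' f g = ∫ x, f x * g x ∂μ :=
  ContinuousLinearMap.lpPairing_eq_integral _ _ _

lemma norm_mulPairing_le (f : Lp ℂ p μ) (g : Lp ℂ p' μ) :
    ‖mulPairing μ p p' f g‖ ≤ ‖f‖ * ‖g‖ := by
  have h : mulPairing μ p p' f g =
      L1.integral ((ContinuousLinearMap.mul ℂ ℂ).holder (μ := μ) 1 f g) := by
    rw [mulPairing_apply, L1.integral_eq_integral]
    exact (integral_congr_ae ((ContinuousLinearMap.mul ℂ ℂ).coeFn_holder f g)).symm
  rw [h]
  refine (L1.norm_integral_le _).trans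
    ((ContinuousLinearMap.norm_holder_apply_apply_le (r := 1) _ f g).trans ?_)
  rw [mul_assoc]
  exact mul_le_of_le_one_left (by positivity) (ContinuousLinearMap.opNorm_mul_le ℂ ℂ)

end Pairing

section SchwartzPairing

variable (p : ℝ≥0∞) [Fact (1 ≤ p)]

/-- The functional `f ↦ ∫ f φ` on `L^p` attached to a Schwartz function `φ`. -/
def schwartzPairing : 𝓢(V, ℂ) →ₗ[ℂ] Lp ℂ p (volume : Measure V) →L[ℂ] ℂ :=
  haveI := ENNReal.HolderConjugate.inv_one_sub_inv' (Fact.out : 1 ≤ p)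
  haveI : Fact (1 ≤ (1 - p⁻¹)⁻¹) := ⟨by simp⟩
  (mulPairing volume p (1 - p⁻¹)⁻¹).flip.toLinearMap ∘ₗ
    (SchwartzMap.toLpCLM ℂ ℂ (1 - p⁻¹)⁻¹ (volume : Measure V)).toLinearMap

variable {p}

lemma mulPairing_toLp {p' : ℝ≥0∞} [ENNReal.HolderConjugate p p'] [Fact (1 ≤ p')]
    (f : Lp ℂ p (volume : Measure V)) (φ : 𝓢(V, ℂ)) :
    mulPairing volume p p' f (φ.toLp p') = ∫ x, f x * φ x := by
  rw [mulPairing_apply]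
  refine integral_congr_ae ?_
  filter_upwards [φ.coeFn_toLp p' volume] with x hx
  rw [hx]

lemma schwartzPairing_apply (φ : 𝓢(V, ℂ)) (f : Lp ℂ p (volume : Measure V)) :
    schwartzPairing p φ f = ∫ x, f x * φ x :=
  haveI := ENNReal.HolderConjugate.inv_one_sub_inv' (Fact.out : 1 ≤ p)
  haveI : Fact (1 ≤ (1 - p⁻¹)⁻¹) := ⟨by simp⟩
  mulPairing_toLp f φ

lemma schwartzPairing_toLp (φ ψ : 𝓢(V, ℂ)) :
    schwartzPairing p φ (ψ.toLp p) = ∫ x, ψ x * φ x := by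
  rw [schwartzPairing_apply]
  refine integral_congr_ae ?_
  filter_upwards [ψ.coeFn_toLp p volume] with x hx
  rw [hx]

lemma norm_schwartzPairing_le (p' : ℝ≥0∞) [ENNReal.HolderConjugate p p'] [Fact (1 ≤ p')]
    (φ : 𝓢(V, ℂ)) (f : Lp ℂ p (volume : Measure V)) :
    ‖schwartzPairing p φ f‖ ≤ ‖f‖ * ‖φ.toLp p'‖ := by
  rw [schwartzPairing_apply, ← mulPairing_toLp (p' := p')]
  exact norm_mulPairing_le _ _

lemma ext_schwartzPairing {f g : Lp ℂ p (volume : Measure V)}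
    (h : ∀ φ, schwartzPairing p φ f = schwartzPairing p φ g) : f = g := by
  have hker : f - g ∈ (Lp.toTemperedDistributionCLM ℂ (volume : Measure V) p).ker := by
    rw [LinearMap.mem_ker]
    ext φ
    have hφ := h φ
    rw [← sub_eq_zero, ← map_sub, schwartzPairing_apply] at hφ
    change Lp.toTemperedDistribution (f - g) φ = 0
    rw [Lp.toTemperedDistribution_apply]
    simpa only [smul_eq_mul, mul_comm] using hφ
  rw [Lp.ker_toTemperedDistributionCLM_eq_bot] at hker
  exact sub_eq_zero.1 ((Submodule.mem_bot ℂ).1 hker)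

end SchwartzPairing

/-! ### Fourier multipliers on `L^p` -/

section MultiplierLp

variable {p : ℝ≥0∞} [Fact (1 ≤ p)]

variable (p) in
/-- Translation by `t` on `L^p`. -/
def translateLp (t : V) : Lp ℂ p (volume : Measure V) →ₗᵢ[ℂ] Lp ℂ p (volume : Measure V) :=
  Lp.compMeasurePreservingₗᵢ ℂ (fun x => x - t) (measurePreserving_sub_right volume t)

lemma coeFn_translateLp_toLp (t : V) (ψ : 𝓢(V, ℂ)) :
    translateLp p t (ψ.toLp p) =ᵐ[volume] fun x => ψ (x - t) :=
  (Lp.coeFn_compMeasurePreserving _ _).trans <|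
    (measurePreserving_sub_right volume t).quasiMeasurePreserving.ae_eq_comp
      (ψ.coeFn_toLp p volume)

lemma continuous_translateLp (hp : p ≠ ∞) (f : Lp ℂ p (volume : Measure V)) :
    Continuous fun t => translateLp p t f :=
  Continuous.compMeasurePreservingLp (f := fun _ : V => f)
    (g := fun t : V => (⟨fun x => x - t, by fun_prop⟩ : C(V, V))) continuous_const
    (ContinuousMap.continuous_of_continuous_uncurry _ (continuous_snd.sub continuous_fst))
    (fun t => measurePreserving_sub_right volume t) hp

lemma integrable_smul_translateLp (hp : p ≠ ∞) (K : 𝓢(V, ℂ)) (f : Lp ℂ p (volume : Measure V)) :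
    Integrable (fun t => K t • translateLp p t f) volume := by
  refine (K.integrable.norm.mul_const ‖f‖).mono'
    (K.continuous.smul (continuous_translateLp hp f)).aestronglyMeasurable
    (Eventually.of_forall fun t => ?_)
  rw [norm_smul, LinearIsometry.norm_map]

/-- The Fourier multiplier with Schwartz symbol `M` on `L^p`, `p < ∞`, realised as a convolution
with `𝓕⁻ M`. -/
def multiplierLp (hp : p ≠ ∞) (M : 𝓢(V, ℂ)) :
    Lp ℂ p (volume : Measure V) →L[ℂ] Lp ℂ p (volume : Measure V) :=
  LinearMap.mkContinuous
    { toFun := fun f => ∫ t, 𝓕⁻ M t • translateLp p t f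
      map_add' := fun f g => by
        rw [← integral_add (integrable_smul_translateLp hp _ f)
          (integrable_smul_translateLp hp _ g)]
        simp only [map_add, smul_add]
      map_smul' := fun c f => by
        simp only [map_smul, RingHom.id_apply]
        rw [← integral_smul]
        simp only [smul_comm c] }
    (∫ t, ‖𝓕⁻ M t‖) fun f => by
      refine (norm_integral_le_integral_norm _).trans (le_of_eq ?_)
      simp only [norm_smul, LinearIsometry.norm_map, integral_mul_const]

lemma multiplierLp_apply (hp : p ≠ ∞) (M : 𝓢(V, ℂ)) (f : Lp ℂ p (volume : Measure V)) :
    multiplierLp hp M f = ∫ t, 𝓕⁻ M t • translateLp p t f := rfl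

lemma norm_multiplierLp_le (hp : p ≠ ∞) (M : 𝓢(V, ℂ)) :
    ‖multiplierLp (p := p) hp M‖ ≤ ∫ t, ‖𝓕⁻ M t‖ :=
  LinearMap.mkContinuous_norm_le _ (by positivity) _

lemma integrable_uncurry_mul_comp_sub (K ψ φ : 𝓢(V, ℂ)) :
    Integrable (Function.uncurry fun t x => K t * ψ (x - t) * φ x) (volume.prod volume) := by
  refine ((K.integrable.mul_prod φ.integrable).bdd_mul (c := ‖ψ.toBoundedContinuousFunction‖)
    (f := fun z : V × V => ψ (z.2 - z.1)) (by fun_prop) (Eventually.of_forall fun z =>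
      ψ.toBoundedContinuousFunction.norm_coe_le_norm (z.2 - z.1))).congr
    (Eventually.of_forall fun z => ?_)
  simp only [Function.uncurry]
  ring

lemma multiplierLp_toLp (hp : p ≠ ∞) (M ψ : 𝓢(V, ℂ)) :
    multiplierLp hp M (ψ.toLp p) = (fourierMultiplierCLM ℂ M ψ).toLp p := by
  refine ext_schwartzPairing fun φ => ?_
  have htrans : ∀ t, schwartzPairing p φ (𝓕⁻ M t • translateLp p t (ψ.toLp p)) =
      ∫ x, 𝓕⁻ M t * ψ (x - t) * φ x := fun t => by
    rw [map_smul, schwartzPairing_apply, smul_eq_mul, ← integral_const_mul]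
    refine integral_congr_ae ?_
    filter_upwards [coeFn_translateLp_toLp (p := p) t ψ] with x hx
    rw [hx, mul_assoc]
  rw [multiplierLp_apply, ← ContinuousLinearMap.integral_comp_comm _
    (integrable_smul_translateLp hp _ _), schwartzPairing_toLp]
  simp only [htrans]
  rw [integral_integral_swap (integrable_uncurry_mul_comp_sub _ _ _)]
  simp only [integral_mul_const, ← fourierMultiplier_apply_eq_integral]

lemma schwartzPairing_multiplierLp (hp : p ≠ ∞) {M M' : 𝓢(V, ℂ)} (h : ∀ ξ, M' ξ = M (-ξ))
    (φ : 𝓢(V, ℂ)) (f : Lp ℂ p (volume : Measure V)) :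
    schwartzPairing p φ (multiplierLp hp M f) =
      schwartzPairing p (fourierMultiplierCLM ℂ M' φ) f := by
  have hdense : DenseRange fun ψ : 𝓢(V, ℂ) => ψ.toLp p := SchwartzMap.denseRange_toLpCLM hp
  refine congrFun (hdense.equalizer
    ((schwartzPairing p φ).continuous.comp (multiplierLp hp M).continuous)
    (schwartzPairing p _).continuous (funext fun ψ => ?_)) f
  simp only [Function.comp_apply]
  rw [multiplierLp_toLp, schwartzPairing_toLp, schwartzPairing_toLp,
    integral_fourierMultiplier_mul h]

/-- The kernel representing the functional `ψ ↦ Λ (𝓕⁻ (M 𝓕 ψ))`, see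
`apply_fourierMultiplier_toLp`. -/
def multiplierKernel (Λ : Lp ℂ p (volume : Measure V) →L[ℂ] ℂ) (M : 𝓢(V, ℂ)) (t : V) : ℂ :=
  Λ (translateLp p t ((𝓕⁻ M).toLp p))

lemma continuous_multiplierKernel (hp : p ≠ ∞) (Λ : Lp ℂ p (volume : Measure V) →L[ℂ] ℂ)
    (M : 𝓢(V, ℂ)) : Continuous (multiplierKernel Λ M) :=
  Λ.continuous.comp (continuous_translateLp hp _)

lemma norm_multiplierKernel_le (Λ : Lp ℂ p (volume : Measure V) →L[ℂ] ℂ) (M : 𝓢(V, ℂ)) (t : V) :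
    ‖multiplierKernel Λ M t‖ ≤ ‖Λ‖ * ‖(𝓕⁻ M).toLp p‖ := by
  refine (Λ.le_opNorm _).trans (le_of_eq ?_)
  rw [LinearIsometry.norm_map]

lemma apply_fourierMultiplier_toLp (hp : p ≠ ∞) (Λ : Lp ℂ p (volume : Measure V) →L[ℂ] ℂ)
    (M ψ : 𝓢(V, ℂ)) :
    Λ ((fourierMultiplierCLM ℂ M ψ).toLp p) = ∫ t, ψ t * multiplierKernel Λ M t := by
  rw [fourierMultiplier_comm, ← multiplierLp_toLp hp, multiplierLp_apply,
    ← ContinuousLinearMap.integral_comp_comm _ (integrable_smul_translateLp hp _ _),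
    FourierTransform.fourierInv_fourier_eq]
  simp only [map_smul, smul_eq_mul, multiplierKernel]

end MultiplierLp

end Multiplier

/-! ### Frequency-localised parts and bounded spectra -/

section Band

variable {d : ℕ}

/-- The part of a Schwartz function near the frequency cube of index `k`: the Fourier multiplier
with symbol `τ.tensor k`. -/
def band (τ : Cutoff) (k : Fin d → ℤ) : 𝓢(Rd d, ℂ) →L[ℂ] 𝓢(Rd d, ℂ) :=
  fourierMultiplierCLM ℂ (τ.symbol k)

lemma fourier_band (τ : Cutoff) (k : Fin d → ℤ) (ψ : 𝓢(Rd d, ℂ)) (ξ : Rd d) :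
    𝓕 (band τ k ψ) ξ = (τ.tensor k ξ : ℂ) * 𝓕 ψ ξ :=
  fourier_fourierMultiplier_apply _ _ _

lemma symbol_neg_apply (τ : Cutoff) (k : Fin d → ℤ) (ξ : Rd d) :
    τ.symbol (-k) ξ = τ.symbol k (-ξ) := by
  rw [Cutoff.symbol_apply, Cutoff.symbol_apply, Cutoff.tensor_neg]

lemma integral_band_mul (τ : Cutoff) (k : Fin d → ℤ) (ψ φ : 𝓢(Rd d, ℂ)) :
    ∫ x, band τ k ψ x * φ x = ∫ x, ψ x * band τ (-k) φ x :=
  integral_fourierMultiplier_mul (symbol_neg_apply τ k) ψ φ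

lemma band_fourier_eq_zero {k : Fin d → ℤ} {u : 𝓢(Rd d, ℂ)} (hu : tsupport u ⊆ (freqCube k)ᶜ) :
    band .narrow (-k) (𝓕 u) = 0 := by
  refine fourier_injective (SchwartzMap.ext fun ξ => ?_)
  have hzero : 𝓕 (0 : 𝓢(Rd d, ℂ)) = 0 := map_zero (fourierCLM ℂ 𝓢(Rd d, ℂ))
  rw [fourier_band, fourier_fourier_apply, hzero, zero_apply, ← Cutoff.tensor_neg]
  by_cases hξ : -ξ ∈ freqCube k
  · rw [image_eq_zero_of_notMem_tsupport fun h => hu h hξ, mul_zero]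
  · obtain ⟨i, hi⟩ := not_forall.1 hξ
    rw [Cutoff.narrow_tensor_eq_zero (i := i) (by linarith), Complex.ofReal_zero, zero_mul]

variable {p : ℝ≥0∞} [Fact (1 ≤ p)]

/-- The extension of `band` to `L^p`, `p < ∞`. -/
def bandLp (hp : p ≠ ∞) (τ : Cutoff) (k : Fin d → ℤ) :
    Lp ℂ p (volume : Measure (Rd d)) →L[ℂ] Lp ℂ p (volume : Measure (Rd d)) :=
  multiplierLp hp (τ.symbol k)

lemma bandLp_toLp (hp : p ≠ ∞) (τ : Cutoff) (k : Fin d → ℤ) (ψ : 𝓢(Rd d, ℂ)) :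
    bandLp hp τ k (ψ.toLp p) = (band τ k ψ).toLp p :=
  multiplierLp_toLp hp _ ψ

lemma schwartzPairing_bandLp (hp : p ≠ ∞) (τ : Cutoff) (k : Fin d → ℤ) (φ : 𝓢(Rd d, ℂ))
    (f : Lp ℂ p (volume : Measure (Rd d))) :
    schwartzPairing p φ (bandLp hp τ k f) = schwartzPairing p (band τ (-k) φ) f :=
  schwartzPairing_multiplierLp hp (symbol_neg_apply τ k) φ f

end Band

section Spectrum

variable {d : ℕ} {p : ℝ≥0∞} [Fact (1 ≤ p)] {f : Lp ℂ p (volume : Measure (Rd d))} {k : Fin d → ℤ}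

lemma hasSpectrumIn_iff : HasSpectrumIn f k ↔
    ∀ u : 𝓢(Rd d, ℂ), tsupport u ⊆ (freqCube k)ᶜ → schwartzPairing p (𝓕 u) f = 0 := by
  refine forall_congr' fun u => imp_congr_right fun _ => ?_
  rw [TemperedDistribution.fourier_apply, Lp.toTemperedDistribution_apply, schwartzPairing_apply]
  simp only [smul_eq_mul, mul_comm]

lemma hasSpectrumIn_of_forall_band_eq_zero
    (h : ∀ φ, band .narrow (-k) φ = 0 → schwartzPairing p φ f = 0) : HasSpectrumIn f k :=
  hasSpectrumIn_iff.2 fun _ hu => h _ (band_fourier_eq_zero hu)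

lemma hasSpectrumIn_bandLp (hp : p ≠ ∞) (k : Fin d → ℤ) (f : Lp ℂ p (volume : Measure (Rd d))) :
    HasSpectrumIn (bandLp hp .narrow k f) k :=
  hasSpectrumIn_of_forall_band_eq_zero fun φ hφ => by
    rw [schwartzPairing_bandLp, hφ, map_zero, zero_apply]

lemma hasSpectrumIn_toLp_band (k : Fin d → ℤ) (ψ : 𝓢(Rd d, ℂ)) :
    HasSpectrumIn ((band .narrow k ψ).toLp p) k :=
  hasSpectrumIn_of_forall_band_eq_zero fun φ hφ => by
    simp only [schwartzPairing_toLp, integral_band_mul, hφ, zero_apply, mul_zero, integral_zero]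

lemma tsupport_subset_compl_freqCube {u : 𝓢(Rd d, ℂ)}
    (h : ∀ ξ : Rd d, (∀ i, |2 * Real.pi * ξ i - k i| < 2) → u ξ = 0) :
    tsupport u ⊆ (freqCube k)ᶜ := by
  have hopen : IsOpen {ξ : Rd d | ∀ i, |2 * Real.pi * ξ i - k i| < 2} := by
    simp only [Set.ofPred_forall]
    exact isOpen_iInter_of_finite fun i => isOpen_lt (by fun_prop) continuous_const
  have hsupp : tsupport u ⊆ {ξ : Rd d | ∀ i, |2 * Real.pi * ξ i - k i| < 2}ᶜ :=
    closure_minimal (fun ξ hξ hξ' => hξ (h ξ hξ')) hopen.isClosed_compl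
  exact hsupp.trans (Set.compl_subset_compl.2 fun ξ hξ i => (hξ i).trans_lt (by norm_num))

lemma HasSpectrumIn.schwartzPairing_eq_zero (hf : HasSpectrumIn f k) {φ : 𝓢(Rd d, ℂ)}
    (hφ : ∀ ξ : Rd d, (∀ i, |2 * Real.pi * ξ i + k i| < 2) → 𝓕 φ ξ = 0) :
    schwartzPairing p φ f = 0 := by
  have h := hasSpectrumIn_iff.1 hf (𝓕⁻ φ) (tsupport_subset_compl_freqCube fun ξ hξ => ?_)
  · rwa [FourierTransform.fourier_fourierInv_eq] at h
  · rw [fourierInv_apply_eq_fourier_neg]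
    refine hφ _ fun i => ?_
    rw [PiLp.neg_apply, ← abs_neg]
    convert hξ i using 2
    ring

lemma HasSpectrumIn.schwartzPairing_wide_band (hf : HasSpectrumIn f k) (φ : 𝓢(Rd d, ℂ)) :
    schwartzPairing p (band .wide (-k) φ) f = schwartzPairing p φ f := by
  rw [← sub_eq_zero, ← sub_apply, ← map_sub]
  refine hf.schwartzPairing_eq_zero fun ξ hξ => ?_
  have hsub : 𝓕 (band .wide (-k) φ - φ) = 𝓕 (band .wide (-k) φ) - 𝓕 φ :=
    map_sub (fourierCLM ℂ 𝓢(Rd d, ℂ)) _ _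
  rw [hsub, sub_apply, fourier_band, Cutoff.wide_tensor_eq_one fun i => ?_, Complex.ofReal_one,
    one_mul, sub_self]
  rw [Pi.neg_apply, Int.cast_neg, sub_neg_eq_add]
  exact (hξ i).le

lemma HasSpectrumIn.schwartzPairing_band_eq_zero (hf : HasSpectrumIn f k) (τ : Cutoff)
    {m : Fin d → ℤ} {i : Fin d} (hi : 5 ≤ |m i + k i|) (φ : 𝓢(Rd d, ℂ)) :
    schwartzPairing p (band τ m φ) f = 0 := by
  refine hf.schwartzPairing_eq_zero fun ξ hξ => ?_
  rw [fourier_band, Cutoff.tensor_eq_zero (i := i), Complex.ofReal_zero, zero_mul]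
  have hmk : (5 : ℝ) ≤ |(m i : ℝ) + k i| := by exact_mod_cast hi
  have htri := abs_sub_abs_le_abs_sub ((m i : ℝ) + k i) (2 * Real.pi * ξ i + k i)
  rw [add_sub_add_right_eq_sub, abs_sub_comm] at htri
  linarith [hξ i]

variable (p) in
/-- The functions in `L^p` with spectrum in the cube of index `k`. -/
def spectral (k : Fin d → ℤ) : Submodule ℂ (Lp ℂ p (volume : Measure (Rd d))) :=
  ⨅ (u : 𝓢(Rd d, ℂ)) (_ : tsupport u ⊆ (freqCube k)ᶜ), (schwartzPairing p (𝓕 u)).ker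

lemma mem_spectral : f ∈ spectral p k ↔ HasSpectrumIn f k := by
  simp only [spectral, Submodule.mem_iInf, hasSpectrumIn_iff]
  rfl

lemma isClosed_spectral (k : Fin d → ℤ) :
    IsClosed (spectral p k : Set (Lp ℂ p (volume : Measure (Rd d)))) := by
  simp only [spectral, Submodule.coe_iInf]
  exact isClosed_iInter fun u => isClosed_iInter fun _ => (schwartzPairing p (𝓕 u)).isClosed_ker

end Spectrum

/-! ### Decay of frequency-localised parts -/

section WeightedMultiplier

lemma one_add_norm_le_mul {E : Type*} [SeminormedAddCommGroup E] (x t : E) :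
    1 + ‖x‖ ≤ (1 + ‖t‖) * (1 + ‖x - t‖) := by
  have h := norm_add_le t (x - t)
  rw [add_sub_cancel] at h
  nlinarith [mul_nonneg (norm_nonneg t) (norm_nonneg (x - t))]

variable {V : Type*} [NormedAddCommGroup V] [InnerProductSpace ℝ V] [FiniteDimensional ℝ V]
  [MeasurableSpace V] [BorelSpace V]

lemma norm_fourierMultiplier_le {M φ : 𝓢(V, ℂ)} {c : ℝ} (h : ∀ ξ, M ξ ≠ 0 → ‖𝓕 φ ξ‖ ≤ c) (x : V) :
    ‖fourierMultiplierCLM ℂ M φ x‖ ≤ (∫ ξ, ‖M ξ‖) * c := by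
  have hinv : fourierMultiplierCLM ℂ M φ x =
      𝓕 (𝓕 (fourierMultiplierCLM ℂ M φ) : 𝓢(V, ℂ)) (-x) := by
    rw [fourier_fourier_apply, neg_neg]
  rw [hinv, ← integral_mul_const]
  refine (VectorFourier.norm_fourierIntegral_le_integral_norm _ _ _ _ _).trans ?_
  refine integral_mono (𝓕 (fourierMultiplierCLM ℂ M φ) : 𝓢(V, ℂ)).integrable.norm
    (M.integrable.norm.mul_const _) fun ξ => ?_
  simp only [fourier_fourierMultiplier_apply, norm_mul]
  by_cases hξ : M ξ = 0
  · simp only [hξ, norm_zero, zero_mul, le_refl]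
  · exact mul_le_mul_of_nonneg_left (h ξ hξ) (norm_nonneg _)

lemma integrable_one_add_norm_pow_mul_norm (u : 𝓢(V, ℂ)) (n : ℕ) :
    Integrable (fun t => (1 + ‖t‖) ^ n * ‖u t‖) volume := by
  have h : Integrable (fun t => 2 ^ (n - 1) * (‖u t‖ + ‖t‖ ^ n * ‖u t‖)) volume :=
    (u.integrable.norm.add (u.integrable_pow_mul volume n)).const_mul _
  refine h.mono (by fun_prop) (Eventually.of_forall fun t => ?_)
  rw [Real.norm_of_nonneg (by positivity), Real.norm_of_nonneg (by positivity)]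
  calc (1 + ‖t‖) ^ n * ‖u t‖ ≤ 2 ^ (n - 1) * (1 ^ n + ‖t‖ ^ n) * ‖u t‖ := by
        gcongr
        exact add_pow_le zero_le_one (norm_nonneg t) n
    _ = 2 ^ (n - 1) * (‖u t‖ + ‖t‖ ^ n * ‖u t‖) := by rw [one_pow]; ring

lemma one_add_norm_pow_mul_norm_fourierMultiplier_le {φ : 𝓢(V, ℂ)} {n : ℕ} {P : ℝ}
    (h : ∀ x, (1 + ‖x‖) ^ n * ‖φ x‖ ≤ P) (M : 𝓢(V, ℂ)) (x : V) :
    (1 + ‖x‖) ^ n * ‖fourierMultiplierCLM ℂ M φ x‖ ≤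
      (∫ t, (1 + ‖t‖) ^ n * ‖𝓕⁻ M t‖) * P := by
  have hconv : ‖fourierMultiplierCLM ℂ M φ x‖ ≤ ∫ t, ‖𝓕⁻ M t‖ * ‖φ (x - t)‖ := by
    rw [fourierMultiplier_apply_eq_integral]
    refine (norm_integral_le_integral_norm _).trans (le_of_eq ?_)
    simp only [norm_mul]
  refine (mul_le_mul_of_nonneg_left hconv (by positivity)).trans ?_
  rw [← integral_const_mul, ← integral_mul_const]
  refine integral_mono_of_nonneg (Eventually.of_forall fun t => by positivity)
    ((integrable_one_add_norm_pow_mul_norm (𝓕⁻ M) n).mul_const P) (Eventually.of_forall fun t => ?_)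
  calc (1 + ‖x‖) ^ n * (‖𝓕⁻ M t‖ * ‖φ (x - t)‖)
      ≤ ((1 + ‖t‖) * (1 + ‖x - t‖)) ^ n * (‖𝓕⁻ M t‖ * ‖φ (x - t)‖) := by
        gcongr
        exact one_add_norm_le_mul x t
    _ = ((1 + ‖t‖) ^ n * ‖𝓕⁻ M t‖) * ((1 + ‖x - t‖) ^ n * ‖φ (x - t)‖) := by
        rw [mul_pow]; ring
    _ ≤ ((1 + ‖t‖) ^ n * ‖𝓕⁻ M t‖) * P := mul_le_mul_of_nonneg_left (h _) (by positivity)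

variable (V) in
lemma memLp_one_add_norm_pow_inv {n : ℕ} (hn : Module.finrank ℝ V < n) {r : ℝ≥0∞} (hr : 1 ≤ r) :
    MemLp (fun x : V => ((1 + ‖x‖) ^ n)⁻¹) r volume := by
  have hcont : Continuous fun x : V => ((1 + ‖x‖) ^ n)⁻¹ :=
    Continuous.inv₀ (by fun_prop) fun x => by positivity
  by_cases hr' : r = ∞
  · subst hr'
    refine memLp_top_of_bound hcont.aestronglyMeasurable 1 (Eventually.of_forall fun x => ?_)
    rw [Real.norm_of_nonneg (by positivity)]
    exact inv_le_one_of_one_le₀ (one_le_pow₀ (by linarith [norm_nonneg x]))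
  have hr1 : 1 ≤ r.toReal := by
    simpa using (ENNReal.toReal_le_toReal ENNReal.one_ne_top hr').2 hr
  have hexp : (Module.finrank ℝ V : ℝ) < n * r.toReal := by
    have : (Module.finrank ℝ V : ℝ) < n := by exact_mod_cast hn
    nlinarith
  rw [← integrable_norm_rpow_iff hcont.aestronglyMeasurable (zero_lt_one.trans_le hr).ne' hr']
  refine (integrable_one_add_norm hexp).congr (Eventually.of_forall fun x => ?_)
  simp only
  rw [Real.norm_of_nonneg (by positivity), Real.rpow_neg (by positivity),
    Real.inv_rpow (by positivity), ← Real.rpow_natCast, ← Real.rpow_mul (by positivity)]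

lemma exists_norm_toLp_le {n : ℕ} (hn : Module.finrank ℝ V < n) (r : ℝ≥0∞) [Fact (1 ≤ r)] :
    ∃ K : ℝ, 0 ≤ K ∧ ∀ (u : 𝓢(V, ℂ)) (c : ℝ), (∀ x, (1 + ‖x‖) ^ n * ‖u x‖ ≤ c) →
      ‖u.toLp r‖ ≤ K * c := by
  have hmem := memLp_one_add_norm_pow_inv V hn (Fact.out : 1 ≤ r)
  refine ⟨(eLpNorm (fun x : V => ((1 + ‖x‖) ^ n)⁻¹) r volume).toReal, ENNReal.toReal_nonneg,
    fun u c hc => ?_⟩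
  have hc0 : 0 ≤ c := le_trans (by positivity) (hc 0)
  rw [SchwartzMap.norm_toLp]
  have hle : eLpNorm u r volume ≤ eLpNorm (c • fun x : V => ((1 + ‖x‖) ^ n)⁻¹) r volume := by
    refine eLpNorm_mono fun x => ?_
    rw [Pi.smul_apply, smul_eq_mul, Real.norm_of_nonneg (by positivity), ← div_eq_mul_inv,
      le_div_iff₀ (by positivity), mul_comm]
    exact hc x
  rw [eLpNorm_const_smul] at hle
  refine (ENNReal.toReal_mono (ENNReal.mul_ne_top (by simp) hmem.eLpNorm_ne_top) hle).trans
    (le_of_eq ?_)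
  rw [ENNReal.toReal_mul, toReal_enorm, Real.norm_of_nonneg hc0, mul_comm]

end WeightedMultiplier

section Decay

variable {d : ℕ}

lemma absOneInt_nonneg (k : Fin d → ℤ) : 0 ≤ absOneInt k :=
  Finset.sum_nonneg fun _ _ => abs_nonneg _

lemma absOneInt_neg (k : Fin d → ℤ) : absOneInt (-k) = absOneInt k := by
  simp [absOneInt]

/-- The centre of the frequency cube of index `k`, in the variable of Mathlib's transform. -/
def freqCentre (k : Fin d → ℤ) : Rd d := WithLp.toLp 2 fun i => (k i : ℝ) / (2 * Real.pi)

namespace Cutoff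

variable (τ : Cutoff) (k : Fin d → ℤ)

lemma symbol_eq_symbol_zero (ξ : Rd d) : τ.symbol k ξ = τ.symbol 0 (ξ + -freqCentre k) := by
  simp only [symbol_apply, tensor, freqCentre, PiLp.add_apply, PiLp.neg_apply, Pi.zero_apply,
    Int.cast_zero, mul_add, mul_neg, mul_div_cancel₀ _ Real.two_pi_pos.ne', sub_eq_add_neg,
    neg_zero, add_zero]

lemma norm_fourierInv_symbol (x : Rd d) : ‖𝓕⁻ (τ.symbol k) x‖ = ‖𝓕⁻ (τ.symbol 0) x‖ := by
  have hshift : (τ.symbol k : Rd d → ℂ) = τ.symbol 0 ∘ fun ξ => ξ + -freqCentre k :=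
    funext (τ.symbol_eq_symbol_zero k)
  rw [fourierInv_apply_eq_fourier_neg, fourierInv_apply_eq_fourier_neg, SchwartzMap.fourier_coe,
    SchwartzMap.fourier_coe, hshift]
  have hmod := congrFun (VectorFourier.fourierIntegral_comp_add_right Real.fourierChar volume
    (innerₗ (Rd d)) (τ.symbol 0) (-freqCentre k)) (-x)
  change ‖VectorFourier.fourierIntegral Real.fourierChar volume (innerₗ (Rd d)) _ (-x)‖ = _
  rw [hmod, Circle.norm_smul]
  rfl

lemma integral_norm_symbol : ∫ ξ, ‖τ.symbol k ξ‖ = ∫ ξ, ‖τ.symbol (0 : Fin d → ℤ) ξ‖ := by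
  simp only [τ.symbol_eq_symbol_zero k]
  exact integral_add_right_eq_self (fun ξ => ‖τ.symbol (0 : Fin d → ℤ) ξ‖) (-freqCentre k)

variable {τ k}

lemma absOneInt_sub_le_absOne {ξ : Rd d} (h : τ.symbol k ξ ≠ 0) :
    absOneInt k - 3 * d ≤ absOne ((2 * Real.pi) • ξ) := by
  have hcoord : ∀ i, |(k i : ℝ)| - 3 ≤ |((2 * Real.pi) • ξ) i| := fun i => by
    have hlt : |2 * Real.pi * ξ i - k i| < 3 :=
      not_le.1 fun hge => h (by rw [symbol_apply, tensor_eq_zero hge, Complex.ofReal_zero])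
    have htri := abs_sub_abs_le_abs_sub (k i : ℝ) (2 * Real.pi * ξ i)
    rw [abs_sub_comm] at htri
    rw [PiLp.smul_apply, smul_eq_mul]
    linarith
  calc absOneInt k - 3 * d = ∑ i, (|(k i : ℝ)| - 3) := by
        simp [absOneInt, Finset.sum_sub_distrib, mul_comm]
    _ ≤ _ := Finset.sum_le_sum fun i _ => hcoord i

end Cutoff

lemma norm_bandLp_le {p : ℝ≥0∞} [Fact (1 ≤ p)] (hp : p ≠ ∞) (τ : Cutoff) (k : Fin d → ℤ) :
    ‖bandLp hp τ k‖ ≤ ∫ t, ‖𝓕⁻ (τ.symbol (0 : Fin d → ℤ)) t‖ := by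
  have h := norm_multiplierLp_le hp (τ.symbol k)
  simp only [τ.norm_fourierInv_symbol k] at h
  exact h

/-- Polynomial decay of `φ` with constant `P` and exponential decay of rate `l` of its Fourier
transform with constant `Q`. The power `2(d+1)` leaves the integrable weight `(1+|x|)^{-(d+1)}`
once the two bounds have been interpolated. -/
structure DecayBound (l P Q : ℝ) (φ : 𝓢(Rd d, ℂ)) : Prop where
  space : ∀ x, (1 + ‖x‖) ^ (2 * (d + 1)) * ‖φ x‖ ≤ P
  freq : ∀ ξ, Real.exp (l * absOne ξ) * ‖angFourier φ ξ‖ ≤ Q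

variable {l P Q : ℝ} {φ : 𝓢(Rd d, ℂ)}

lemma DecayBound.space_nonneg (h : DecayBound l P Q φ) : 0 ≤ P :=
  le_trans (by positivity) (h.space 0)

lemma DecayBound.norm_fourier_le (h : DecayBound l P Q φ) (ξ : Rd d) :
    ‖𝓕 φ ξ‖ ≤ Real.exp (-(l * absOne ((2 * Real.pi) • ξ))) * Q := by
  have hfreq := h.freq ((2 * Real.pi) • ξ)
  rw [angFourier, inv_smul_smul₀ Real.two_pi_pos.ne'] at hfreq
  rw [Real.exp_neg, ← div_eq_inv_mul, le_div_iff₀ (Real.exp_pos _), mul_comm]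
  exact hfreq

lemma DecayBound.norm_band_le (hl : 0 ≤ l) (h : DecayBound l P Q φ) (τ : Cutoff) (k : Fin d → ℤ)
    (x : Rd d) : ‖band τ k φ x‖ ≤ (∫ ξ, ‖τ.symbol (0 : Fin d → ℤ) ξ‖) *
      (Real.exp (3 * d * l) * (Real.exp (-l * absOneInt k) * Q)) := by
  have hQ : 0 ≤ Q := le_trans (by positivity) (h.freq 0)
  rw [← τ.integral_norm_symbol k]
  refine norm_fourierMultiplier_le (fun ξ hξ => (h.norm_fourier_le ξ).trans ?_) x
  rw [← mul_assoc, ← Real.exp_add]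
  gcongr
  nlinarith [Cutoff.absOneInt_sub_le_absOne hξ]

lemma DecayBound.one_add_norm_pow_mul_norm_band_le (h : DecayBound l P Q φ) (τ : Cutoff)
    (k : Fin d → ℤ) (x : Rd d) : (1 + ‖x‖) ^ (2 * (d + 1)) * ‖band τ k φ x‖ ≤
      (∫ t, (1 + ‖t‖) ^ (2 * (d + 1)) * ‖𝓕⁻ (τ.symbol (0 : Fin d → ℤ)) t‖) * P := by
  have hband := one_add_norm_pow_mul_norm_fourierMultiplier_le h.space (τ.symbol k) x
  simp only [τ.norm_fourierInv_symbol k] at hband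
  exact hband

variable (d) in
lemma exists_one_add_norm_pow_mul_norm_band_le (τ : Cutoff) (hl : 0 ≤ l) : ∃ C : ℝ, 0 ≤ C ∧
    ∀ (φ : 𝓢(Rd d, ℂ)) (P Q : ℝ), DecayBound l P Q φ → ∀ (k : Fin d → ℤ) (x : Rd d),
      (1 + ‖x‖) ^ (d + 1) * ‖band τ k φ x‖ ≤
        C * (Real.exp (-(l / 2) * absOneInt k) * √(P * Q)) := by
  set A := (∫ ξ, ‖τ.symbol (0 : Fin d → ℤ) ξ‖) * Real.exp (3 * d * l) with hA
  set D := ∫ t, (1 + ‖t‖) ^ (2 * (d + 1)) * ‖𝓕⁻ (τ.symbol (0 : Fin d → ℤ)) t‖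
  refine ⟨√(A * D), Real.sqrt_nonneg _, fun φ P Q h k x => ?_⟩
  have hP := h.space_nonneg
  have hexp : Real.exp (-(l / 2) * absOneInt k) = √(Real.exp (-l * absOneInt k)) := by
    rw [← Real.exp_half]; congr 1; ring
  rw [hexp, ← Real.sqrt_mul (by positivity), ← Real.sqrt_mul (by positivity)]
  -- the square splits into the weighted bound in space times the bound coming from frequency
  refine Real.le_sqrt_of_sq_le ?_
  calc ((1 + ‖x‖) ^ (d + 1) * ‖band τ k φ x‖) ^ 2
      = ((1 + ‖x‖) ^ (2 * (d + 1)) * ‖band τ k φ x‖) * ‖band τ k φ x‖ := by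
        rw [mul_pow, ← pow_mul]; ring
    _ ≤ (D * P) * (A * (Real.exp (-l * absOneInt k) * Q)) := by
        refine mul_le_mul (h.one_add_norm_pow_mul_norm_band_le τ k x) ?_ (norm_nonneg _)
          (by positivity)
        rw [hA, mul_assoc]
        exact h.norm_band_le hl τ k x
    _ = A * D * (Real.exp (-l * absOneInt k) * (P * Q)) := by ring

variable (d) in
lemma exists_norm_toLp_band_le (τ : Cutoff) (hl : 0 ≤ l) (r : ℝ≥0∞) [Fact (1 ≤ r)] :
    ∃ C : ℝ, 0 ≤ C ∧ ∀ (φ : 𝓢(Rd d, ℂ)) (P Q : ℝ), DecayBound l P Q φ → ∀ k : Fin d → ℤ,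
      ‖(band τ k φ).toLp r‖ ≤ C * (Real.exp (-(l / 2) * absOneInt k) * √(P * Q)) := by
  obtain ⟨C, hC0, hC⟩ := exists_one_add_norm_pow_mul_norm_band_le d τ hl
  obtain ⟨K, hK0, hK⟩ := exists_norm_toLp_le (V := Rd d) (n := d + 1) (by simp) r
  refine ⟨K * C, by positivity, fun φ P Q h k => ?_⟩
  rw [mul_assoc]
  exact hK _ _ fun x => hC φ P Q h k x

variable (d) in
lemma exists_norm_schwartzPairing_le (p : ℝ≥0∞) [Fact (1 ≤ p)] (hl : 0 ≤ l) :
    ∃ C : ℝ, 0 ≤ C ∧ ∀ (k : Fin d → ℤ) (f : Lp ℂ p (volume : Measure (Rd d))),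
      HasSpectrumIn f k → ∀ (φ : 𝓢(Rd d, ℂ)) (P Q : ℝ), DecayBound l P Q φ →
      ‖schwartzPairing p φ f‖ ≤
        C * (Real.exp (-(l / 2) * absOneInt k) * (‖f‖ * √(P * Q))) := by
  obtain ⟨p', hpp', hp'⟩ : ∃ p', ENNReal.HolderConjugate p p' ∧ Fact (1 ≤ p') :=
    ⟨_, .inv_one_sub_inv' (Fact.out : 1 ≤ p), ⟨by simp⟩⟩
  obtain ⟨C, hC0, hC⟩ := exists_norm_toLp_band_le d .wide hl p'
  refine ⟨C, hC0, fun k f hf φ P Q h => ?_⟩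
  have hband := hC φ P Q h (-k)
  rw [absOneInt_neg] at hband
  rw [← hf.schwartzPairing_wide_band, mul_left_comm _ ‖f‖, mul_left_comm C]
  exact (norm_schwartzPairing_le p' _ f).trans (mul_le_mul_of_nonneg_left hband (norm_nonneg _))

end Decay

/-! ### Gelfand-Shilov functions are Schwartz functions -/

section RapidDecay

/-- A function is rapidly decaying if its product with every power of `1 + ‖x‖` is bounded; no
derivatives are involved. -/
def RapidDecay {E G : Type*} [Norm E] [Norm G] (g : E → G) : Prop :=
  ∀ m : ℕ, ∃ C : ℝ, ∀ x, (1 + ‖x‖) ^ m * ‖g x‖ ≤ C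

variable {E G : Type*} [NormedAddCommGroup E] [NormedSpace ℝ E] [NormedAddCommGroup G]
  [NormedSpace ℝ G] {F g : E → G}

lemma norm_fderiv_apply_le_of_lipschitzWith (hF : Differentiable ℝ F) {B : NNReal}
    (hB : LipschitzWith B (fderiv ℝ F)) (x w : E) :
    ‖fderiv ℝ F x w‖ ≤ ‖F (x + w)‖ + ‖F x‖ + B * ‖w‖ ^ 2 := by
  have htaylor : ‖F (x + w) - F x - fderiv ℝ F x w‖ ≤ B * ‖w‖ * ‖w‖ := by
    have hball : x + w ∈ Metric.closedBall x ‖w‖ := by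
      rw [mem_closedBall_iff_norm, add_sub_cancel_left]
    have h := (convex_closedBall x ‖w‖).norm_image_sub_le_of_norm_fderiv_le' (𝕜 := ℝ)
      (φ := fderiv ℝ F x) (C := B * ‖w‖) (fun z _ => hF z) (fun z hz => ?_)
      (Metric.mem_closedBall_self (norm_nonneg w)) hball
    · rwa [add_sub_cancel_left] at h
    · refine (hB.norm_sub_le z x).trans ?_
      gcongr
      exact mem_closedBall_iff_norm.1 hz
  calc ‖fderiv ℝ F x w‖ = ‖(F (x + w) - F x) - (F (x + w) - F x - fderiv ℝ F x w)‖ := by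
        rw [sub_sub_cancel]
    _ ≤ ‖F (x + w)‖ + ‖F x‖ + B * ‖w‖ * ‖w‖ :=
        (norm_sub_le _ _).trans (add_le_add (norm_sub_le _ _) htaylor)
    _ = ‖F (x + w)‖ + ‖F x‖ + B * ‖w‖ ^ 2 := by ring

-- Landau's inequality with step `(1 + ‖x‖) ^ (-m)`
protected lemma RapidDecay.fderiv (h : RapidDecay F) (hF : Differentiable ℝ F) {B : NNReal}
    (hB : LipschitzWith B (fderiv ℝ F)) : RapidDecay (fderiv ℝ F) := by
  intro m
  obtain ⟨C, hC⟩ := h (2 * m)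
  have hC0 : 0 ≤ C := le_trans (by positivity) (hC 0)
  refine ⟨2 ^ (2 * m) * C + C + B, fun x => ?_⟩
  set r := (1 + ‖x‖) ^ m with hr
  have hr1 : 1 ≤ r := one_le_pow₀ (by linarith [norm_nonneg x])
  have hr0 : 0 < r := by linarith
  have hrr : r ^ 2 = (1 + ‖x‖) ^ (2 * m) := by rw [hr, ← pow_mul, mul_comm]
  rw [← le_div_iff₀' hr0]
  refine ContinuousLinearMap.opNorm_le_of_unit_norm (by positivity) fun v hv => ?_
  have hw : ‖r⁻¹ • v‖ = r⁻¹ := by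
    rw [norm_smul, hv, mul_one, Real.norm_of_nonneg (by positivity)]
  have hx : r ^ 2 * ‖F x‖ ≤ C := hrr ▸ hC x
  have hy : r ^ 2 * ‖F (x + r⁻¹ • v)‖ ≤ 2 ^ (2 * m) * C := by
    set y := x + r⁻¹ • v with hy
    have hxy : 1 + ‖x‖ ≤ 2 * (1 + ‖y‖) := by
      have hsub : ‖y - x‖ ≤ 1 := by
        rw [hy, add_sub_cancel_left, hw]; exact inv_le_one_of_one_le₀ hr1
      linarith [norm_le_norm_add_norm_sub y x, norm_nonneg y]
    calc r ^ 2 * ‖F y‖ ≤ (2 * (1 + ‖y‖)) ^ (2 * m) * ‖F y‖ := by rw [hrr]; gcongr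
      _ = 2 ^ (2 * m) * ((1 + ‖y‖) ^ (2 * m) * ‖F y‖) := by rw [mul_pow]; ring
      _ ≤ 2 ^ (2 * m) * C := by gcongr; exact hC y
  have hstep := norm_fderiv_apply_le_of_lipschitzWith hF hB x (r⁻¹ • v)
  rw [hw, map_smul, norm_smul, Real.norm_of_nonneg (by positivity)] at hstep
  rw [le_div_iff₀ hr0]
  calc ‖fderiv ℝ F x v‖ * r = r ^ 2 * (r⁻¹ * ‖fderiv ℝ F x v‖) := by field_simp
    _ ≤ r ^ 2 * (‖F (x + r⁻¹ • v)‖ + ‖F x‖ + B * r⁻¹ ^ 2) := by gcongr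
    _ = r ^ 2 * ‖F (x + r⁻¹ • v)‖ + r ^ 2 * ‖F x‖ + B := by field_simp
    _ ≤ 2 ^ (2 * m) * C + C + B := by gcongr

lemma lipschitzWith_fderiv_iteratedFDeriv {n : ℕ}
    (hg : Differentiable ℝ (iteratedFDeriv ℝ (n + 1) g)) {B : NNReal}
    (hB : ∀ x, ‖iteratedFDeriv ℝ (n + 2) g x‖ ≤ B) :
    LipschitzWith B (fderiv ℝ (iteratedFDeriv ℝ n g)) := by
  have hlip : LipschitzWith B (iteratedFDeriv ℝ (n + 1) g) :=
    lipschitzWith_of_nnnorm_fderiv_le hg fun x => by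
      rw [← NNReal.coe_le_coe, coe_nnnorm, norm_fderiv_iteratedFDeriv]
      exact hB x
  rw [fderiv_iteratedFDeriv, ← one_mul B]
  exact (continuousMultilinearCurryLeftEquiv ℝ (fun _ : Fin (n + 1) => E) G).isometry.lipschitz.comp
    hlip

protected lemma RapidDecay.iteratedFDeriv (h : RapidDecay g) (hg : ContDiff ℝ (⊤ : ℕ∞) g)
    (hbdd : ∀ n : ℕ, ∃ B : ℝ, ∀ x, ‖iteratedFDeriv ℝ n g x‖ ≤ B) (n : ℕ) :
    RapidDecay (iteratedFDeriv ℝ n g) := by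
  have hdiff : ∀ n : ℕ, Differentiable ℝ (iteratedFDeriv ℝ n g) := fun n =>
    hg.differentiable_iteratedFDeriv (mod_cast ENat.natCast_lt_top n)
  induction n with
  | zero => simpa only [RapidDecay, norm_iteratedFDeriv_zero] using h
  | succ n ih =>
    obtain ⟨B, hB⟩ := hbdd (n + 2)
    have hlip := lipschitzWith_fderiv_iteratedFDeriv (hdiff (n + 1))
      fun x => (hB x).trans (Real.le_coe_toNNReal B)
    simpa only [RapidDecay, norm_fderiv_iteratedFDeriv] using ih.fderiv (hdiff n) hlip

end RapidDecay

section FourierRapidDecay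

variable {V : Type*} [NormedAddCommGroup V] [InnerProductSpace ℝ V] [FiniteDimensional ℝ V]
  [MeasurableSpace V] [BorelSpace V] {f : V → ℂ}

lemma RapidDecay.integrable_pow_mul (h : RapidDecay f) (hf : Continuous f) (n : ℕ) :
    Integrable (fun x => ‖x‖ ^ n * ‖f x‖) volume := by
  obtain ⟨C, hC⟩ := h (n + (Module.finrank ℝ V + 1))
  have hweight := memLp_one_iff_integrable.1
    (memLp_one_add_norm_pow_inv V (Nat.lt_succ_self _) le_rfl)
  refine (hweight.const_mul C).mono' (by fun_prop) (Eventually.of_forall fun x => ?_)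
  rw [Real.norm_of_nonneg (by positivity), ← div_eq_mul_inv, le_div_iff₀ (by positivity)]
  calc ‖x‖ ^ n * ‖f x‖ * (1 + ‖x‖) ^ (Module.finrank ℝ V + 1)
      ≤ (1 + ‖x‖) ^ n * ‖f x‖ * (1 + ‖x‖) ^ (Module.finrank ℝ V + 1) := by
        gcongr
        linarith
    _ = (1 + ‖x‖) ^ (n + (Module.finrank ℝ V + 1)) * ‖f x‖ := by rw [pow_add]; ring
    _ ≤ C := hC x

lemma RapidDecay.exists_norm_iteratedFDeriv_fourier_le (h : RapidDecay f) (hf : Continuous f)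
    (n : ℕ) : ∃ B : ℝ, ∀ ξ, ‖iteratedFDeriv ℝ n (𝓕 f) ξ‖ ≤ B := by
  have hint : ∀ k m : ℕ, (k : ℕ∞) ≤ ⊤ → (m : ℕ∞) ≤ 0 →
      Integrable (fun v => ‖v‖ ^ k * ‖iteratedFDeriv ℝ m f v‖) volume := by
    intro k m _ hm
    obtain rfl : m = 0 := by simpa using hm
    simpa only [norm_iteratedFDeriv_zero] using h.integrable_pow_mul hf k
  have hle := Real.pow_mul_norm_iteratedFDeriv_fourier_le
    (contDiff_zero.2 hf : ContDiff ℝ ((0 : ℕ∞) : WithTop ℕ∞) f) hint (k := n) (n := 0) le_top le_rfl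
  simp only [pow_zero, one_mul] at hle
  exact ⟨_, hle⟩

lemma RapidDecay.exists_schwartz (h : RapidDecay f) (hF : RapidDecay (𝓕 f)) (hf : Continuous f) :
    ∃ φ : 𝓢(V, ℂ), (φ : V → ℂ) = f := by
  have hint : Integrable f volume := by
    have := h.integrable_pow_mul hf 0
    simp only [pow_zero, one_mul] at this
    exact (integrable_norm_iff hf.aestronglyMeasurable).1 this
  have hcont : Continuous (𝓕 f) := VectorFourier.fourierIntegral_continuous
    Real.continuous_fourierChar (L := innerₗ V) continuous_inner hint
  have hintF : Integrable (𝓕 f) volume := by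
    have := hF.integrable_pow_mul hcont 0
    simp only [pow_zero, one_mul] at this
    exact (integrable_norm_iff hcont.aestronglyMeasurable).1 this
  set u : V → ℂ := fun ξ => 𝓕 f (-ξ) with hu
  have hucont : Continuous u := hcont.comp continuous_neg
  have hudecay : RapidDecay u := fun m => by
    obtain ⟨C, hC⟩ := hF m
    exact ⟨C, fun ξ => norm_neg ξ ▸ hC (-ξ)⟩
  have hfu : f = 𝓕 u := by
    rw [hu, ← Real.fourierInv_eq_fourier_comp_neg, hf.fourierInv_fourier_eq hint hintF]
  have hsmooth : ContDiff ℝ (⊤ : ℕ∞) f :=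
    hfu ▸ Real.contDiff_fourier fun n _ => RapidDecay.integrable_pow_mul hudecay hucont n
  have hdecay := h.iteratedFDeriv hsmooth
    (hfu ▸ RapidDecay.exists_norm_iteratedFDeriv_fourier_le hudecay hucont)
  refine ⟨⟨f, hsmooth, fun k n => ?_⟩, rfl⟩
  obtain ⟨C, hC⟩ := hdecay n k
  refine ⟨C, fun x => le_trans ?_ (hC x)⟩
  gcongr
  linarith

end FourierRapidDecay

section Schwartz

variable {d : ℕ}

lemma absOne_nonneg (x : Rd d) : 0 ≤ absOne x :=
  Finset.sum_nonneg fun _ _ => abs_nonneg _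

lemma absOne_smul {c : ℝ} (hc : 0 ≤ c) (x : Rd d) : absOne (c • x) = c * absOne x := by
  simp [absOne, abs_mul, abs_of_nonneg hc, Finset.mul_sum]

lemma fourier_eq_angFourier (f : Rd d → ℂ) (ξ : Rd d) :
    𝓕 f ξ = angFourier f ((2 * Real.pi) • ξ) := by
  rw [angFourier, inv_smul_smul₀ Real.two_pi_pos.ne']

lemma one_add_norm_pow_mul_norm_le_of_exp {C : ℝ} {n : ℕ} {u : Rd d → ℂ}
    (h : ∀ x, Real.exp (n * absOne x) * ‖u x‖ ≤ C) (x : Rd d) :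
    (1 + ‖x‖) ^ n * ‖u x‖ ≤ C := by
  refine le_trans (mul_le_mul_of_nonneg_right ?_ (norm_nonneg _)) (h x)
  rw [Real.exp_nat_mul]
  refine pow_le_pow_left₀ (by positivity) ?_ n
  linarith [norm_le_absOne x, Real.add_one_le_exp (absOne x)]

variable {f : Rd d → ℂ}

lemma IsGelfandShilov.rapidDecay (hf : IsGelfandShilov f) : RapidDecay f := fun n => by
  obtain ⟨C, hC⟩ := hf.decay (n + 1) (by positivity)
  refine ⟨C, one_add_norm_pow_mul_norm_le_of_exp fun x => le_trans ?_ (hC x)⟩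
  gcongr
  · exact absOne_nonneg x
  · linarith

lemma IsGelfandShilov.rapidDecay_fourier (hf : IsGelfandShilov f) : RapidDecay (𝓕 f) := fun n => by
  obtain ⟨C, hC⟩ := hf.decayFourier (n + 1) (by positivity)
  refine ⟨C, one_add_norm_pow_mul_norm_le_of_exp fun x => le_trans ?_ (hC ((2 * Real.pi) • x))⟩
  rw [fourier_eq_angFourier, absOne_smul Real.two_pi_pos.le]
  have hx := absOne_nonneg x
  gcongr
  · linarith
  · nlinarith [Real.pi_gt_three]

namespace GelfandShilov

lemma exists_schwartz (φ : GelfandShilov d) : ∃ ψ : 𝓢(Rd d, ℂ), (ψ : Rd d → ℂ) = φ :=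
  φ.isGelfandShilov.rapidDecay.exists_schwartz φ.isGelfandShilov.rapidDecay_fourier
    φ.isGelfandShilov.smooth.continuous

/-- A Gelfand-Shilov function as a Schwartz function. -/
def toSchwartz (φ : GelfandShilov d) : 𝓢(Rd d, ℂ) := φ.exists_schwartz.choose

@[simp] lemma coe_toSchwartz (φ : GelfandShilov d) : (φ.toSchwartz : Rd d → ℂ) = φ.1 :=
  φ.exists_schwartz.choose_spec

lemma toSchwartz_apply (φ : GelfandShilov d) (x : Rd d) : φ.toSchwartz x = φ x :=
  congrFun φ.coe_toSchwartz x

lemma toSchwartz_add (φ ψ : GelfandShilov d) :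
    (φ + ψ).toSchwartz = φ.toSchwartz + ψ.toSchwartz := by
  ext x
  rw [add_apply, toSchwartz_apply, toSchwartz_apply, toSchwartz_apply]
  rfl

lemma toSchwartz_smul (c : ℂ) (φ : GelfandShilov d) :
    (c • φ).toSchwartz = c • φ.toSchwartz := by
  ext x
  rw [smul_apply, toSchwartz_apply, toSchwartz_apply]
  rfl

lemma le_seminormP (l : Set.Ioi (0 : ℝ)) (φ : GelfandShilov d) (x : Rd d) :
    Real.exp (l * absOne x) * ‖φ x‖ ≤ seminormP l φ := by
  rw [seminormP_apply]
  obtain ⟨C, hC⟩ := φ.isGelfandShilov.decay l l.2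
  exact le_ciSup (f := fun x => Real.exp (l * absOne x) * ‖φ x‖) ⟨C, Set.forall_mem_range.2 hC⟩ x

lemma le_seminormQ (l : Set.Ioi (0 : ℝ)) (φ : GelfandShilov d) (ξ : Rd d) :
    Real.exp (l * absOne ξ) * ‖angFourier φ ξ‖ ≤ seminormQ l φ := by
  rw [seminormQ_apply]
  obtain ⟨C, hC⟩ := φ.isGelfandShilov.decayFourier l l.2
  exact le_ciSup (f := fun ξ => Real.exp (l * absOne ξ) * ‖angFourier φ ξ‖)
    ⟨C, Set.forall_mem_range.2 hC⟩ ξ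

/-- The index of the seminorm `seminormP` that controls the field `DecayBound.space`. -/
def spaceExponent (d : ℕ) : Set.Ioi (0 : ℝ) :=
  ⟨((2 * (d + 1) : ℕ) : ℝ), by rw [Set.mem_Ioi]; positivity⟩

lemma decayBound (l : Set.Ioi (0 : ℝ)) (φ : GelfandShilov d) :
    DecayBound l (seminormP (spaceExponent d) φ) (seminormQ l φ) φ.toSchwartz where
  space x := by
    rw [toSchwartz_apply]
    exact one_add_norm_pow_mul_norm_le_of_exp (le_seminormP (spaceExponent d) φ) x
  freq ξ := by
    rw [coe_toSchwartz]
    exact le_seminormQ l φ ξ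

end GelfandShilov

end Schwartz

/-! ### `E^s_{p,q}` as a quotient of a Banach space -/

section LatticeWeights

lemma summable_prod_apply {ι α : Type*} [Fintype ι] {f : α → ℝ} (hf : Summable f)
    (hf0 : ∀ a, 0 ≤ f a) : Summable fun k : ι → α => ∏ i, f (k i) := by
  classical
  refine summable_of_sum_le (c := ∏ _i : ι, ∑' a, f a)
    (fun k => Finset.prod_nonneg fun i _ => hf0 (k i)) fun S => ?_
  let T (i : ι) : Finset α := S.image fun k => k i
  have hS : S ⊆ Fintype.piFinset T := fun k hk =>
    Fintype.mem_piFinset.2 fun i => Finset.mem_image_of_mem _ hk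
  calc ∑ k ∈ S, ∏ i, f (k i) ≤ ∑ k ∈ Fintype.piFinset T, ∏ i, f (k i) :=
        Finset.sum_le_sum_of_subset_of_nonneg hS fun k _ _ =>
          Finset.prod_nonneg fun i _ => hf0 (k i)
    _ = ∏ i, ∑ a ∈ T i, f a := (Finset.prod_univ_sum T fun _ => f).symm
    _ ≤ ∏ _i : ι, ∑' a, f a :=
        Finset.prod_le_prod (fun i _ => Finset.sum_nonneg fun a _ => hf0 a)
          fun i _ => hf.sum_le_tsum _ fun a _ => hf0 a

variable {d : ℕ}

variable (d) in
lemma summable_exp_neg_absOneInt : Summable fun k : Fin d → ℤ => Real.exp (-absOneInt k) := by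
  have hZ : Summable fun j : ℤ => Real.exp (-|(j : ℝ)|) :=
    Summable.of_nat_of_neg (by simpa using Real.summable_exp_neg_nat)
      (by simpa using Real.summable_exp_neg_nat)
  simpa only [absOneInt, ← Finset.sum_neg_distrib, Real.exp_sum] using
    summable_prod_apply hZ fun j => (Real.exp_pos _).le

/-- The weight `2^{s|k|}`. -/
def weight (s : ℝ) (k : Fin d → ℤ) : ℝ := (2 : ℝ) ^ (s * absOneInt k)

lemma weight_pos (s : ℝ) (k : Fin d → ℤ) : 0 < weight s k := Real.rpow_pos_of_pos two_pos _

lemma weight_neg_mul (s : ℝ) (k : Fin d → ℤ) : weight (-s) k * weight s k = 1 := by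
  rw [weight, weight, ← Real.rpow_add two_pos, neg_mul, neg_add_cancel, Real.rpow_zero]

lemma weight_mul_neg (s : ℝ) (k : Fin d → ℤ) : weight s k * weight (-s) k = 1 := by
  rw [mul_comm, weight_neg_mul]

lemma weight_neg_index (s : ℝ) (k : Fin d → ℤ) : weight s (-k) = weight s k := by
  rw [weight, weight, absOneInt_neg]

/-- An exponent `l` for which the decay `e^{-l|k|/2}` of the pairing with the `k`-th piece beats
the weight `2^{s|k|}` by a factor `e^{-|k|}`. -/
def rate (s : ℝ) : Set.Ioi (0 : ℝ) :=
  ⟨2 * (|s| * Real.log 2 + 1), by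
    have := Real.log_pos one_lt_two
    rw [Set.mem_Ioi]; positivity⟩

lemma rate_neg (s : ℝ) : rate (-s) = rate s := by simp [rate]

lemma weight_mul_exp_le (s : ℝ) (k : Fin d → ℤ) :
    weight s k * Real.exp (-((rate s : ℝ) / 2) * absOneInt k) ≤ Real.exp (-absOneInt k) := by
  have hlog := Real.log_pos one_lt_two
  have habs := mul_le_mul_of_nonneg_right (le_abs_self s) (mul_nonneg hlog.le (absOneInt_nonneg k))
  rw [weight, Real.rpow_def_of_pos two_pos, ← Real.exp_add, Real.exp_le_exp]
  simp only [rate]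
  linarith

end LatticeWeights

section SpectralSequences

variable (d : ℕ) (p q : ℝ≥0∞) [Fact (1 ≤ p)]

/-- The space `ℓ^q(ℤ^d; L^p)`. -/
abbrev SeqLp : Type := lp (fun _ : Fin d → ℤ => Lp ℂ p (volume : Measure (Rd d))) q

/-- The closed subspace of the sequences in `ℓ^q(ℤ^d; L^p)` whose `k`-th entry has spectrum in the
cube of index `k`. -/
def spectralSeq : Submodule ℂ (SeqLp d p q) :=
  ⨅ k, (spectral p k).comap (lp.evalₗ (𝕜 := ℂ) _ q k)

variable {d p q}

lemma mem_spectralSeq {w : SeqLp d p q} : w ∈ spectralSeq d p q ↔ ∀ k, HasSpectrumIn (w k) k := by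
  simp [spectralSeq, Submodule.mem_iInf, mem_spectral]

variable [Fact (1 ≤ q)]

lemma isClosed_spectralSeq : IsClosed (spectralSeq d p q : Set (SeqLp d p q)) := by
  simp only [spectralSeq, Submodule.coe_iInf]
  exact isClosed_iInter fun k => (isClosed_spectral k).preimage
    (lp.evalCLM ℂ (fun _ : Fin d → ℤ => Lp ℂ p (volume : Measure (Rd d))) q k).continuous

instance : CompleteSpace (spectralSeq d p q) := isClosed_spectralSeq.completeSpace_coe

lemma norm_apply_le (w : SeqLp d p q) (k : Fin d → ℤ) : ‖w k‖ ≤ ‖w‖ :=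
  lp.norm_apply_le_norm (zero_lt_one.trans_le (Fact.out : 1 ≤ q)).ne' w k

/-- The pairing `∑ₖ 2^{-s|k|} ∫ wₖ φ`, that is, the action on `φ` of the distribution whose
decomposition has the weighted norm `‖w‖`. -/
def seqPairing (s : ℝ) (w : SeqLp d p q) (φ : 𝓢(Rd d, ℂ)) : ℂ :=
  ∑' k, (weight (-s) k : ℂ) * schwartzPairing p φ (w k)

variable (d p q) in
lemma exists_norm_seqPairing_term_le (s : ℝ) : ∃ C : ℝ, 0 ≤ C ∧
    ∀ w ∈ spectralSeq d p q, ∀ (φ : 𝓢(Rd d, ℂ)) (P Q : ℝ), DecayBound (rate s) P Q φ →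
      ∀ k, ‖(weight (-s) k : ℂ) * schwartzPairing p φ (w k)‖ ≤
        C * (‖w‖ * √(P * Q)) * Real.exp (-absOneInt k) := by
  obtain ⟨C, hC0, hC⟩ := exists_norm_schwartzPairing_le d p (rate s).2.le
  refine ⟨C, hC0, fun w hw φ P Q h k => ?_⟩
  have hweight : weight (-s) k * Real.exp (-((rate s : ℝ) / 2) * absOneInt k) ≤
      Real.exp (-absOneInt k) := rate_neg s ▸ weight_mul_exp_le (-s) k
  have hpos := (weight_pos (-s) k).le
  have hle := norm_apply_le w k
  rw [norm_mul, Complex.norm_real, Real.norm_of_nonneg hpos]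
  calc weight (-s) k * ‖schwartzPairing p φ (w k)‖
      ≤ weight (-s) k * (C * (Real.exp (-((rate s : ℝ) / 2) * absOneInt k) *
        (‖w k‖ * √(P * Q)))) :=
        mul_le_mul_of_nonneg_left (hC k _ (mem_spectralSeq.1 hw k) φ P Q h) hpos
    _ = C * (‖w k‖ * √(P * Q)) *
        (weight (-s) k * Real.exp (-((rate s : ℝ) / 2) * absOneInt k)) := by ring
    _ ≤ C * (‖w‖ * √(P * Q)) * Real.exp (-absOneInt k) := by gcongr

lemma summable_seqPairing {s : ℝ} {w : SeqLp d p q} (hw : w ∈ spectralSeq d p q)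
    {φ : 𝓢(Rd d, ℂ)} {P Q : ℝ} (h : DecayBound (rate s) P Q φ) :
    Summable fun k => (weight (-s) k : ℂ) * schwartzPairing p φ (w k) := by
  obtain ⟨C, -, hC⟩ := exists_norm_seqPairing_term_le d p q s
  exact .of_norm_bounded ((summable_exp_neg_absOneInt d).mul_left _) (hC w hw φ P Q h)

variable (d p q) in
lemma exists_norm_seqPairing_le (s : ℝ) : ∃ C : ℝ, 0 ≤ C ∧
    ∀ w ∈ spectralSeq d p q, ∀ (φ : 𝓢(Rd d, ℂ)) (P Q : ℝ), DecayBound (rate s) P Q φ →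
      ‖seqPairing s w φ‖ ≤ C * (‖w‖ * √(P * Q)) := by
  obtain ⟨C, hC0, hC⟩ := exists_norm_seqPairing_term_le d p q s
  refine ⟨C * ∑' k : Fin d → ℤ, Real.exp (-absOneInt k), by positivity, fun w hw φ P Q h => ?_⟩
  refine (tsum_of_norm_bounded ((summable_exp_neg_absOneInt d).hasSum.mul_left _)
    (hC w hw φ P Q h)).trans_eq ?_
  ring

/-- The distribution `∑ₖ 2^{-s|k|} wₖ`, as a linear functional. -/
def synthesisLinear (s : ℝ) (w : spectralSeq d p q) : GelfandShilov d →ₗ[ℂ] ℂ where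
  toFun φ := seqPairing s w.1 φ.toSchwartz
  map_add' φ ψ := by
    rw [seqPairing, GelfandShilov.toSchwartz_add, map_add]
    simp only [add_apply, mul_add]
    exact (summable_seqPairing w.2 (φ.decayBound _)).tsum_add
      (summable_seqPairing w.2 (ψ.decayBound _))
  map_smul' c φ := by
    rw [seqPairing, GelfandShilov.toSchwartz_smul, map_smul]
    simp only [smul_apply, smul_eq_mul, RingHom.id_apply, seqPairing, ← tsum_mul_left,
      mul_left_comm]

lemma GelfandShilov.continuous_of_norm_le {u : GelfandShilov d →ₗ[ℂ] ℂ} {C : ℝ} (hC : 0 ≤ C)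
    {a b : Set.Ioi (0 : ℝ)} (h : ∀ φ, ‖u φ‖ ≤ C * √(seminormP a φ * seminormQ b φ)) :
    Continuous u := by
  refine WithSeminorms.continuous_normedSpace_rng ℂ (withSeminorms d) u
    ⟨{Sum.inl a, Sum.inr b}, ⟨C, hC⟩, fun φ => ?_⟩
  rw [Finset.sup_insert, Finset.sup_singleton]
  change ‖u φ‖ ≤ C * (seminormP a φ ⊔ seminormQ b φ)
  refine (h φ).trans (mul_le_mul_of_nonneg_left ?_ hC)
  refine Real.sqrt_le_iff.2 ⟨le_sup_of_le_left (apply_nonneg _ _), ?_⟩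
  rw [sq]
  exact mul_le_mul le_sup_left le_sup_right (apply_nonneg _ _)
    (le_sup_of_le_left (apply_nonneg _ _))

lemma continuous_synthesisLinear (s : ℝ) (w : spectralSeq d p q) :
    Continuous (synthesisLinear s w) := by
  obtain ⟨C, hC0, hC⟩ := exists_norm_seqPairing_le d p q s
  refine GelfandShilov.continuous_of_norm_le (C := C * ‖w‖)
    (a := GelfandShilov.spaceExponent d) (b := rate s) (by positivity) fun φ => ?_
  rw [mul_assoc]
  exact hC w.1 w.2 _ _ _ (φ.decayBound _)

/-- The map `w ↦ ∑ₖ 2^{-s|k|} wₖ` into `𝒮'_m`. -/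
def synthesis (s : ℝ) : spectralSeq d p q →ₗ[ℂ] UltraDistribution d where
  toFun w := ⟨synthesisLinear s w, continuous_synthesisLinear s w⟩
  map_add' w v := by
    ext φ
    change seqPairing s (w + v).1 _ = seqPairing s w.1 _ + seqPairing s v.1 _
    rw [seqPairing, seqPairing, seqPairing,
      ← (summable_seqPairing w.2 (φ.decayBound (rate s))).tsum_add
        (summable_seqPairing v.2 (φ.decayBound (rate s)))]
    refine tsum_congr fun k => ?_
    rw [← mul_add, ← map_add]
    rfl
  map_smul' c w := by
    ext φ
    change seqPairing s (c • w).1 _ = c * seqPairing s w.1 _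
    rw [seqPairing, seqPairing, ← tsum_mul_left]
    refine tsum_congr fun k => ?_
    rw [mul_left_comm, ← smul_eq_mul (a := c), ← map_smul]
    rfl

lemma synthesis_apply (s : ℝ) (w : spectralSeq d p q) (φ : GelfandShilov d) :
    synthesis s w φ = seqPairing s w.1 φ.toSchwartz := rfl

lemma weight_mul_schwartzPairing (s : ℝ) (f : Lp ℂ p (volume : Measure (Rd d))) (k : Fin d → ℤ)
    (φ : GelfandShilov d) :
    (weight s k : ℂ) * schwartzPairing p φ.toSchwartz f = ∫ x, (weight s k • f) x * φ x := by
  have hcoe : weight s k • f = (weight s k : ℂ) • f := (Complex.coe_smul _ _).symm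
  rw [hcoe, ← smul_eq_mul, ← map_smul, schwartzPairing_apply, GelfandShilov.coe_toSchwartz]

lemma weighted_weight_neg_smul (s : ℝ) (w : (Fin d → ℤ) → Lp ℂ p (volume : Measure (Rd d))) :
    weighted s (fun k => weight (-s) k • w k) = w := by
  funext k
  change weight s k • (weight (-s) k • w k) = w k
  rw [smul_smul, weight_mul_neg, one_smul]

lemma weight_neg_smul_weighted (s : ℝ) (f : (Fin d → ℤ) → Lp ℂ p (volume : Measure (Rd d)))
    (k : Fin d → ℤ) : weight (-s) k • weighted s f k = f k := by
  change weight (-s) k • (weight s k • f k) = f k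
  rw [smul_smul, weight_neg_mul, one_smul]

lemma HasSpectrumIn.real_smul {f : Lp ℂ p (volume : Measure (Rd d))} {k : Fin d → ℤ}
    (hf : HasSpectrumIn f k) (c : ℝ) : HasSpectrumIn (c • f) k :=
  mem_spectral.1 (Submodule.smul_of_tower_mem _ c (mem_spectral.2 hf))

lemma isDecomposition_synthesis (s : ℝ) (w : spectralSeq d p q) :
    IsDecomposition s q (synthesis s w) fun k => weight (-s) k • w.1 k where
  spectrum k := (mem_spectralSeq.1 w.2 k).real_smul _
  hasSum φ := by
    simp only [← weight_mul_schwartzPairing]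
    exact (summable_seqPairing w.2 (φ.decayBound (rate s))).hasSum
  memlp := by
    rw [weighted_weight_neg_smul]
    exact lp.memℓp w.1

lemma IsDecomposition.exists_synthesis_eq {s : ℝ} {u : UltraDistribution d}
    {f : (Fin d → ℤ) → Lp ℂ p (volume : Measure (Rd d))} (hf : IsDecomposition s q u f) :
    ∃ w : spectralSeq d p q, w.1 = ⟨weighted s f, hf.memlp⟩ ∧ synthesis s w = u := by
  refine ⟨⟨⟨weighted s f, hf.memlp⟩,
    mem_spectralSeq.2 fun k => (hf.spectrum k).real_smul (weight s k)⟩, rfl, ?_⟩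
  ext φ
  rw [synthesis_apply, seqPairing, ← (hf.hasSum φ).tsum_eq]
  refine tsum_congr fun k => ?_
  rw [weight_mul_schwartzPairing, weight_neg_smul_weighted]

end SpectralSequences

namespace ExpMod

variable {d : ℕ} {s : ℝ} {p q : ℝ≥0∞} [Fact (1 ≤ p)] [Fact (1 ≤ q)]

lemma toUltra_injective : Function.Injective (toUltra : ExpMod d s p q → UltraDistribution d) :=
  Subtype.val_injective

lemma ext_apply {u v : ExpMod d s p q} (h : ∀ φ : GelfandShilov d, u.toUltra φ = v.toUltra φ) :
    u = v := toUltra_injective (ContinuousLinearMap.ext h)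

/-- The quotient map, without its norm bound. -/
def quotLinear (s : ℝ) : spectralSeq d p q →ₗ[ℂ] ExpMod d s p q :=
  (synthesis s).codRestrict (expModSubmodule d s p q) fun w => ⟨_, isDecomposition_synthesis s w⟩

lemma norm_quotLinear_le (w : spectralSeq d p q) : ‖quotLinear s w‖ ≤ ‖w‖ := by
  refine csInf_le (bddBelow _) ⟨_, isDecomposition_synthesis s w, ?_⟩
  rw [Submodule.coe_norm]
  congr 1
  exact Subtype.ext (weighted_weight_neg_smul s w.1).symm

/-- The quotient map `w ↦ ∑ₖ 2^{-s|k|} wₖ` onto `E^s_{p,q}`. -/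
def quot (s : ℝ) : spectralSeq d p q →L[ℂ] ExpMod d s p q :=
  LinearMap.mkContinuous (quotLinear (d := d) (p := p) (q := q) s) 1 fun w =>
    (norm_quotLinear_le w).trans_eq (one_mul _).symm

lemma toUltra_quot (w : spectralSeq d p q) : (quot s w).toUltra = synthesis s w := rfl

lemma norm_quot_le (w : spectralSeq d p q) : ‖quot s w‖ ≤ ‖w‖ := norm_quotLinear_le w

lemma exists_quot_eq_norm_lt (u : ExpMod d s p q) {ε : ℝ} (hε : 0 < ε) :
    ∃ w : spectralSeq d p q, quot s w = u ∧ ‖w‖ < ‖u‖ + ε := by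
  have hlt : sInf (decompositionNorms s p q u.toUltra) < ‖u‖ + ε := by
    rw [← norm_def]
    exact lt_add_of_pos_right _ hε
  obtain ⟨_, ⟨f, hf, rfl⟩, hf_lt⟩ := exists_lt_of_csInf_lt u.decompositionNorms_nonempty hlt
  obtain ⟨w, hw, hwu⟩ := hf.exists_synthesis_eq
  refine ⟨w, toUltra_injective hwu, ?_⟩
  rwa [Submodule.coe_norm, hw]

lemma quot_surjective : Function.Surjective (quot s : spectralSeq d p q → ExpMod d s p q) :=
  fun u =>
    let ⟨w, hw, _⟩ := u.exists_quot_eq_norm_lt one_pos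
    ⟨w, hw⟩

variable (d s p q) in
lemma exists_norm_toUltra_apply_le : ∃ C : ℝ, 0 ≤ C ∧ ∀ (u : ExpMod d s p q) (φ : GelfandShilov d),
    ‖u.toUltra φ‖ ≤ C * (‖u‖ * √(GelfandShilov.seminormP (GelfandShilov.spaceExponent d) φ *
      GelfandShilov.seminormQ (rate s) φ)) := by
  obtain ⟨C, hC0, hC⟩ := exists_norm_seqPairing_le d p q s
  refine ⟨C, hC0, fun u φ => ?_⟩
  set R := √(GelfandShilov.seminormP (GelfandShilov.spaceExponent d) φ *
    GelfandShilov.seminormQ (rate s) φ)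
  have hbound : ∀ ε : ℝ, 0 < ε → ‖u.toUltra φ‖ ≤ C * ((‖u‖ + ε) * R) := fun ε hε => by
    obtain ⟨w, hw, hlt⟩ := u.exists_quot_eq_norm_lt hε
    have hle : ‖u.toUltra φ‖ ≤ C * (‖w‖ * R) := by
      rw [← hw, toUltra_quot, synthesis_apply]
      exact hC w.1 w.2 _ _ _ (φ.decayBound _)
    exact hle.trans (by gcongr)
  have hlim : Tendsto (fun ε : ℝ => C * ((‖u‖ + ε) * R)) (𝓝[>] 0) (𝓝 (C * ((‖u‖ + 0) * R))) :=
    (Continuous.tendsto (by fun_prop) 0).mono_left nhdsWithin_le_nhds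
  rw [add_zero] at hlim
  exact ge_of_tendsto hlim (eventually_mem_nhdsWithin.mono hbound)

lemma norm_eq_zero_iff (u : ExpMod d s p q) : ‖u‖ = 0 ↔ u = 0 := by
  refine ⟨fun h => ext_apply fun φ => ?_, fun h => by rw [h, norm_zero]⟩
  obtain ⟨C, -, hC⟩ := exists_norm_toUltra_apply_le d s p q
  rw [map_zero, zero_apply, ← norm_le_zero_iff]
  simpa only [h, zero_mul, mul_zero] using hC u φ

instance : NormedAddCommGroup (ExpMod d s p q) :=
  NormedAddCommGroup.ofSeparation fun u h => (norm_eq_zero_iff u).1 h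

instance : CompleteSpace (ExpMod d s p q) := by
  refine NormedAddCommGroup.completeSpace_of_summable_imp_tendsto fun u hu => ?_
  choose w hw hlt using fun n => (u n).exists_quot_eq_norm_lt (pow_pos (one_half_pos (α := ℝ)) n)
  have hsum : Summable w :=
    .of_norm_bounded (hu.add summable_geometric_two) fun n => (hlt n).le
  refine ⟨quot s (∑' n, w n), ?_⟩
  simpa only [hw] using ((quot s).hasSum hsum.hasSum).tendsto_sum_nat

end ExpMod

/-! ### Converse Hölder inequalities -/

section HolderConjugate

variable {p p' : ℝ≥0∞} [ENNReal.HolderConjugate p p']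

lemma holderConjugate_toReal [Fact (1 ≤ p)] (hp1 : p ≠ 1) (hp : p ≠ ∞) :
    p.toReal.HolderConjugate p'.toReal := by
  have h1 : 1 < p := lt_of_le_of_ne Fact.out (Ne.symm hp1)
  refine ENNReal.HolderConjugate.toReal ?_
  simpa using (ENNReal.toReal_lt_toReal ENNReal.one_ne_top hp).2 h1

variable (p') in
lemma holderConjugate_one_eq_top [ENNReal.HolderConjugate 1 p'] : p' = ∞ := by
  rw [← ENNReal.HolderConjugate.conjExponent_eq (p := 1) (q := p')]
  simp [ENNReal.conjExponent]

end HolderConjugate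

section DualityMap

/-- The map `z ↦ |z| ^ (r - 2) z̄`; composed with `g ∈ L^r` it produces the function on which the
pairing with `g` attains the norm of `g`. -/
def dualityMap (r : ℝ) (z : ℂ) : ℂ := ((‖z‖ ^ (r - 2) : ℝ) : ℂ) * starRingEnd ℂ z

lemma norm_dualityMap {r : ℝ} (hr : 1 < r) (z : ℂ) : ‖dualityMap r z‖ = ‖z‖ ^ (r - 1) := by
  rw [dualityMap, norm_mul, Complex.norm_real, RCLike.norm_conj,
    Real.norm_of_nonneg (by positivity)]
  rcases eq_or_ne z 0 with rfl | hz
  · rw [norm_zero, mul_zero, Real.zero_rpow (by linarith)]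
  · rw [← Real.rpow_add_one (norm_ne_zero_iff.2 hz)]
    ring_nf

lemma dualityMap_mul_self {r : ℝ} (hr : r ≠ 0) (z : ℂ) :
    dualityMap r z * z = ((‖z‖ ^ r : ℝ) : ℂ) := by
  rcases eq_or_ne z 0 with rfl | hz
  · rw [mul_zero, norm_zero, Real.zero_rpow hr, Complex.ofReal_zero]
  · rw [dualityMap, mul_assoc, Complex.conj_mul', ← Complex.ofReal_pow, ← Complex.ofReal_mul,
      ← Real.rpow_add_natCast (norm_ne_zero_iff.2 hz)]
    norm_num

lemma measurable_dualityMap (r : ℝ) : Measurable (dualityMap r) :=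
  (Complex.continuous_ofReal.measurable.comp (measurable_norm.pow_const (r - 2))).mul
    Complex.continuous_conj.measurable

variable {α : Type*} [MeasurableSpace α] {μ : Measure α} {p p' : ℝ≥0∞} [Fact (1 ≤ p)]
  [ENNReal.HolderConjugate p p']

lemma eLpNorm_dualityMap_comp (hp1 : p ≠ 1) (hp : p ≠ ∞) (g : α → ℂ) :
    eLpNorm (dualityMap p'.toReal ∘ g) p μ = eLpNorm g p' μ ^ (p'.toReal - 1) := by
  have hc := holderConjugate_toReal (p' := p') hp1 hp
  have hr : 0 < p'.toReal - 1 := sub_pos.2 hc.symm.lt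
  have hp' : p' ≠ ∞ := by
    rintro rfl
    exact hc.symm.ne_zero ENNReal.toReal_top
  have hexp : p * ENNReal.ofReal (p'.toReal - 1) = p' := by
    rw [← ENNReal.toReal_eq_toReal_iff' (ENNReal.mul_ne_top hp ENNReal.ofReal_ne_top) hp',
      ENNReal.toReal_mul, ENNReal.toReal_ofReal hr.le]
    linarith [hc.mul_eq_add]
  rw [← eLpNorm_norm]
  simp only [Function.comp_apply, norm_dualityMap hc.symm.lt]
  rw [eLpNorm_norm_rpow _ hr, hexp]

variable [Fact (1 ≤ p')]

lemma norm_le_of_norm_mulPairing_le (hp1 : p ≠ 1) (hp : p ≠ ∞) {D : ℝ} (hD : 0 ≤ D)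
    (g : Lp ℂ p' μ) (h : ∀ f : Lp ℂ p μ, ‖mulPairing μ p p' f g‖ ≤ D * ‖f‖) : ‖g‖ ≤ D := by
  have hc := holderConjugate_toReal (p' := p') hp1 hp
  set r := p'.toReal with hr
  have hr1 : 1 < r := hc.symm.lt
  have hr0 : r ≠ 0 := hc.symm.ne_zero
  have hp'0 : p' ≠ 0 ∧ p' ≠ ∞ := (ENNReal.toReal_ne_zero).1 hr0
  have hnorm : eLpNorm (dualityMap r ∘ g) p μ = eLpNorm g p' μ ^ (r - 1) :=
    eLpNorm_dualityMap_comp hp1 hp g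
  have hmem : MemLp (dualityMap r ∘ g) p μ := by
    refine ⟨((measurable_dualityMap r).comp_aemeasurable
      (Lp.memLp g).1.aemeasurable).aestronglyMeasurable, ?_⟩
    rw [hnorm]
    exact ENNReal.rpow_lt_top_of_nonneg (by linarith) (Lp.memLp g).eLpNorm_ne_top
  have hpair : mulPairing μ p p' (hmem.toLp _) g = ((‖g‖ ^ r : ℝ) : ℂ) := by
    have hcongr : ∫ x, hmem.toLp _ x * g x ∂μ = ∫ x, ((‖g x‖ ^ r : ℝ) : ℂ) ∂μ := by
      refine integral_congr_ae ?_
      filter_upwards [hmem.coeFn_toLp] with x hx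
      rw [hx, Function.comp_apply, dualityMap_mul_self hr0]
    rw [mulPairing_apply, hcongr, integral_complex_ofReal, Lp.norm_def,
      (Lp.memLp g).eLpNorm_eq_integral_rpow_norm hp'0.1 hp'0.2,
      ENNReal.toReal_ofReal (by positivity), ← hr, ← Real.rpow_mul (by positivity),
      inv_mul_cancel₀ hr0, Real.rpow_one]
  have hle : ‖g‖ ^ r ≤ D * ‖g‖ ^ (r - 1) := by
    have := h (hmem.toLp _)
    rwa [hpair, Lp.norm_toLp, hnorm, ← ENNReal.toReal_rpow, ← Lp.norm_def, Complex.norm_real,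
      Real.norm_of_nonneg (by positivity)] at this
  rcases (norm_nonneg g).eq_or_lt with h0 | h0
  · rwa [← h0]
  · rw [← sub_add_cancel r 1, Real.rpow_add_one h0.ne', mul_comm] at hle
    rw [sub_add_cancel] at hle
    exact le_of_mul_le_mul_right hle (by positivity)

end DualityMap

section RieszKernel

variable {V : Type*} [NormedAddCommGroup V] [InnerProductSpace ℝ V] [FiniteDimensional ℝ V]

variable (V) in
lemma exists_schwartz_exhaustion : ∃ η : ℕ → 𝓢(V, ℂ), (∀ n x, ‖η n x‖ ≤ 1) ∧
    ∀ x, Tendsto (fun n => η n x) atTop (𝓝 1) := by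
  let b : ℕ → ContDiffBump (0 : V) := fun n => ⟨n + 1, n + 2, by positivity, by linarith⟩
  have hcompact : ∀ n, HasCompactSupport fun x => ((b n x : ℝ) : ℂ) := fun n =>
    (b n).hasCompactSupport.comp_left (g := fun t : ℝ => (t : ℂ)) Complex.ofReal_zero
  have hsmooth : ∀ n, ContDiff ℝ (⊤ : ℕ∞) fun x => ((b n x : ℝ) : ℂ) := fun n =>
    Complex.ofRealCLM.contDiff.comp (b n).contDiff
  refine ⟨fun n => (hcompact n).toSchwartzMap (hsmooth n), fun n x => ?_, fun x => ?_⟩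
  · change ‖((b n x : ℝ) : ℂ)‖ ≤ 1
    rw [Complex.norm_real, Real.norm_of_nonneg (b n).nonneg]
    exact (b n).le_one
  · refine tendsto_const_nhds.congr' ?_
    filter_upwards [eventually_ge_atTop ⌈‖x‖⌉₊] with n hn
    have hx : x ∈ Metric.closedBall (0 : V) (b n).rIn := by
      rw [mem_closedBall_zero_iff]
      exact (Nat.ceil_le.1 hn).trans (by change (n : ℝ) ≤ n + 1; linarith)
    change (1 : ℂ) = ((b n x : ℝ) : ℂ)
    rw [(b n).one_of_mem_closedBall hx, Complex.ofReal_one]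

variable [MeasurableSpace V] [BorelSpace V] {p p' : ℝ≥0∞} [Fact (1 ≤ p)] [Fact (1 ≤ p')]
  [ENNReal.HolderConjugate p p']

lemma mulPairing_toLp_left (ψ : 𝓢(V, ℂ)) (g : Lp ℂ p' (volume : Measure V)) :
    mulPairing volume p p' (ψ.toLp p) g = ∫ x, ψ x * g x := by
  rw [mulPairing_apply]
  refine integral_congr_ae ?_
  filter_upwards [ψ.coeFn_toLp p volume] with x hx
  rw [hx]

lemma norm_toLp_le_of_integral_schwartz_le (hp1 : p ≠ 1) (hp : p ≠ ∞) {D : ℝ} (hD : 0 ≤ D)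
    {γ : V → ℂ} (η : 𝓢(V, ℂ)) (hη : ∀ x, ‖η x‖ ≤ 1) (hmem : MemLp (fun x => η x * γ x) p' volume)
    (h : ∀ ψ : 𝓢(V, ℂ), ‖∫ x, ψ x * γ x‖ ≤ D * ‖ψ.toLp p‖) : ‖hmem.toLp _‖ ≤ D := by
  have hdense : DenseRange fun ψ : 𝓢(V, ℂ) => ψ.toLp p := SchwartzMap.denseRange_toLpCLM hp
  refine norm_le_of_norm_mulPairing_le (p := p) hp1 hp hD _ fun f => ?_
  refine hdense.induction_on f (isClosed_le (by fun_prop) (by fun_prop)) fun ψ => ?_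
  let u : 𝓢(V, ℂ) := smulLeftCLM ℂ η ψ
  have hu : ∀ x, u x = η x * ψ x := smulLeftCLM_apply_apply η.hasTemperateGrowth ψ
  have hint : ∫ x, ψ x * hmem.toLp _ x = ∫ x, u x * γ x := by
    refine integral_congr_ae ?_
    filter_upwards [hmem.coeFn_toLp] with x hx
    rw [hx, hu]
    ring
  rw [mulPairing_toLp_left, hint]
  refine (h u).trans (mul_le_mul_of_nonneg_left ?_ hD)
  rw [SchwartzMap.norm_toLp, SchwartzMap.norm_toLp]
  refine ENNReal.toReal_mono (ψ.memLp p volume).eLpNorm_ne_top (eLpNorm_mono fun x => ?_)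
  rw [hu, norm_mul]
  exact mul_le_of_le_one_left (norm_nonneg _) (hη x)

lemma eLpNorm_le_of_integral_schwartz_le (hp1 : p ≠ 1) (hp : p ≠ ∞) {D B : ℝ} (hD : 0 ≤ D)
    {γ : V → ℂ} (hγ : Continuous γ) (hB : ∀ x, ‖γ x‖ ≤ B)
    (h : ∀ ψ : 𝓢(V, ℂ), ‖∫ x, ψ x * γ x‖ ≤ D * ‖ψ.toLp p‖) :
    eLpNorm γ p' volume ≤ ENNReal.ofReal D := by
  obtain ⟨η, hη, hlim⟩ := exists_schwartz_exhaustion V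
  have hmem : ∀ n, MemLp (fun x => η n x * γ x) p' volume := fun n => by
    refine ((η n).memLp p' volume).of_le_mul (c := B)
      (((η n).continuous.mul hγ).aestronglyMeasurable) (Eventually.of_forall fun x => ?_)
    rw [norm_mul, mul_comm]
    exact mul_le_mul_of_nonneg_right (hB x) (norm_nonneg _)
  have hle : ∀ n, eLpNorm (fun x => η n x * γ x) p' volume ≤ ENNReal.ofReal D := fun n => by
    have := norm_toLp_le_of_integral_schwartz_le hp1 hp hD (η n) (hη n) (hmem n) h
    rw [Lp.norm_toLp] at this
    exact (ENNReal.le_ofReal_iff_toReal_le (hmem n).eLpNorm_ne_top hD).2 this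
  refine (Lp.eLpNorm_lim_le_liminf_eLpNorm (fun n => (hmem n).1) γ
    (Eventually.of_forall fun x => by simpa using (hlim x).mul_const (γ x))).trans ?_
  refine liminf_le_of_le (by isBoundedDefault) fun b hb => ?_
  obtain ⟨n, hn⟩ := hb.exists
  exact hn.trans (hle n)

lemma eLpNorm_multiplierKernel_le (hp : p ≠ ∞) (Λ : Lp ℂ p (volume : Measure V) →L[ℂ] ℂ)
    (M : 𝓢(V, ℂ)) :
    eLpNorm (multiplierKernel Λ M) p' volume ≤ ENNReal.ofReal ((∫ t, ‖(𝓕⁻ M) t‖) * ‖Λ‖) := by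
  by_cases hp1 : p = 1
  · subst hp1
    obtain rfl := holderConjugate_one_eq_top p'
    rw [eLpNorm_exponent_top]
    refine eLpNormEssSup_le_of_ae_bound (Eventually.of_forall fun t => ?_)
    refine (norm_multiplierKernel_le Λ M t).trans (le_of_eq ?_)
    rw [mul_comm, SchwartzMap.norm_toLp, eLpNorm_one_eq_lintegral_enorm,
      integral_norm_eq_lintegral_enorm (𝓕⁻ M).continuous.aestronglyMeasurable]
  · refine eLpNorm_le_of_integral_schwartz_le (p := p) hp1 hp (by positivity)
      (continuous_multiplierKernel hp Λ M) (norm_multiplierKernel_le Λ M) fun ψ => ?_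
    rw [← apply_fourierMultiplier_toLp hp, ← multiplierLp_toLp hp, mul_right_comm, mul_comm]
    exact Λ.le_opNorm_of_le ((multiplierLp hp M).le_of_opNorm_le (norm_multiplierLp_le hp M) _)

lemma exists_schwartzPairing_eq_apply_fourierMultiplier (hp : p ≠ ∞)
    (Λ : Lp ℂ p (volume : Measure V) →L[ℂ] ℂ) (M : 𝓢(V, ℂ)) :
    ∃ G : Lp ℂ p' (volume : Measure V),
      (∀ ψ, schwartzPairing p' ψ G = Λ ((fourierMultiplierCLM ℂ M ψ).toLp p)) ∧
      ‖G‖ ≤ (∫ t, ‖(𝓕⁻ M) t‖) * ‖Λ‖ := by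
  have hbound := eLpNorm_multiplierKernel_le (p' := p') hp Λ M
  have hmem : MemLp (multiplierKernel Λ M) p' volume :=
    ⟨(continuous_multiplierKernel hp Λ M).aestronglyMeasurable,
      hbound.trans_lt ENNReal.ofReal_lt_top⟩
  refine ⟨hmem.toLp _, fun ψ => ?_, ?_⟩
  · rw [apply_fourierMultiplier_toLp hp, schwartzPairing_apply]
    refine integral_congr_ae ?_
    filter_upwards [hmem.coeFn_toLp] with x hx
    rw [hx, mul_comm]
  · rw [Lp.norm_toLp]
    exact ENNReal.toReal_le_of_le_ofReal (by positivity) hbound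

end RieszKernel

section Components

variable {ι κ : Type*} [DecidableEq ι] {E : ι → Type*} {F : κ → Type*}
  [∀ i, NormedAddCommGroup (E i)] [∀ i, NormedSpace ℂ (E i)] [∀ i, NormedAddCommGroup (F i)]
  {q q' : ℝ≥0∞} [Fact (1 ≤ q)]

lemma exists_norm_le_one_apply_eq_ofReal {X : Type*} [NormedAddCommGroup X] [NormedSpace ℂ X]
    (Λ : X →L[ℂ] ℂ) {ε : ℝ} (hε : 0 < ε) :
    ∃ x : X, ‖x‖ ≤ 1 ∧ ∃ t : ℝ, ‖Λ‖ - ε ≤ t ∧ Λ x = (t : ℂ) := by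
  obtain ⟨x, hx, hlt⟩ := Λ.exists_lt_apply_of_lt_opNorm (sub_lt_self ‖Λ‖ hε)
  rcases eq_or_ne (Λ x) 0 with h0 | h0
  · rw [h0, norm_zero] at hlt
    exact ⟨0, by simp, 0, hlt.le, by simp⟩
  refine ⟨((‖Λ x‖ : ℂ) / Λ x) • x, ?_, ‖Λ x‖, hlt.le, ?_⟩
  · rw [norm_smul, norm_div, Complex.norm_real, norm_norm, div_self (norm_ne_zero_iff.2 h0),
      one_mul]
    exact hx.le
  · rw [map_smul, smul_eq_mul, div_mul_cancel₀ _ h0]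

/-- The restriction of a functional on `ℓ^q` to the `i`-th coordinate. -/
def component (Λ : lp E q →L[ℂ] ℂ) (i : ι) : E i →L[ℂ] ℂ :=
  Λ ∘L lp.singleContinuousLinearMap ℂ E q i

lemma component_apply (Λ : lp E q →L[ℂ] ℂ) (i : ι) (x : E i) :
    component Λ i x = Λ (lp.single q i x) := rfl

lemma norm_component_le (Λ : lp E q →L[ℂ] ℂ) (i : ι) : ‖component Λ i‖ ≤ ‖Λ‖ := by
  refine ContinuousLinearMap.opNorm_le_bound _ (norm_nonneg _) fun x => ?_
  rw [component_apply]
  refine (Λ.le_opNorm _).trans (le_of_eq ?_)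
  rw [lp.norm_single (zero_lt_one.trans_le (Fact.out : 1 ≤ q))]

lemma norm_sum_single_smul_le_one (hq : 0 < q.toReal) {S : Finset ι} {a : ι → ℝ}
    (ha : ∀ i, 0 ≤ a i) (hsum : ∑ i ∈ S, a i ^ q.toReal ≤ 1) {x : ∀ i, E i}
    (hx : ∀ i, ‖x i‖ ≤ 1) : ‖∑ i ∈ S, lp.single q i ((a i : ℂ) • x i)‖ ≤ 1 := by
  rw [← Real.rpow_le_rpow_iff (norm_nonneg _) zero_le_one hq, Real.one_rpow,
    lp.norm_sum_single hq]
  refine (Finset.sum_le_sum fun i _ => Real.rpow_le_rpow (norm_nonneg _) ?_ hq.le).trans hsum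
  rw [norm_smul, Complex.norm_real, Real.norm_of_nonneg (ha i)]
  exact mul_le_of_le_one_right (ha i) (hx i)

lemma sum_mul_norm_component_le (hq : q ≠ ∞) (Λ : lp E q →L[ℂ] ℂ) (S : Finset ι) (a : ι → ℝ)
    (ha : ∀ i, 0 ≤ a i) (hsum : ∑ i ∈ S, a i ^ q.toReal ≤ 1) :
    ∑ i ∈ S, a i * ‖component Λ i‖ ≤ ‖Λ‖ := by
  have hq0 : 0 < q.toReal :=
    ENNReal.toReal_pos (zero_lt_one.trans_le (Fact.out : 1 ≤ q)).ne' hq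
  have key : ∀ ε : ℝ, 0 < ε → ∑ i ∈ S, a i * (‖component Λ i‖ - ε) ≤ ‖Λ‖ := fun ε hε => by
    choose x hx t ht hxt using fun i => exists_norm_le_one_apply_eq_ofReal (component Λ i) hε
    have happly : Λ (∑ i ∈ S, lp.single q i ((a i : ℂ) • x i)) =
        ((∑ i ∈ S, a i * t i : ℝ) : ℂ) := by
      rw [map_sum, Complex.ofReal_sum]
      refine Finset.sum_congr rfl fun i _ => ?_
      rw [← component_apply, map_smul, hxt, smul_eq_mul, Complex.ofReal_mul]
    calc ∑ i ∈ S, a i * (‖component Λ i‖ - ε) ≤ ∑ i ∈ S, a i * t i :=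
          Finset.sum_le_sum fun i _ => mul_le_mul_of_nonneg_left (ht i) (ha i)
      _ ≤ ‖((∑ i ∈ S, a i * t i : ℝ) : ℂ)‖ := by
          rw [Complex.norm_real]
          exact le_abs_self _
      _ ≤ ‖Λ‖ * 1 := by
          rw [← happly]
          exact Λ.le_opNorm_of_le (norm_sum_single_smul_le_one hq0 ha hsum hx)
      _ = ‖Λ‖ := mul_one _
  have hlim : Tendsto (fun ε : ℝ => ∑ i ∈ S, a i * (‖component Λ i‖ - ε)) (𝓝[>] 0)
      (𝓝 (∑ i ∈ S, a i * (‖component Λ i‖ - 0))) :=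
    (Continuous.tendsto (by fun_prop) 0).mono_left nhdsWithin_le_nhds
  simp only [sub_zero] at hlim
  exact le_of_tendsto hlim (eventually_mem_nhdsWithin.mono key)

variable [ENNReal.HolderConjugate q q']

lemma sum_norm_component_rpow_le (hq1 : q ≠ 1) (hq : q ≠ ∞) (Λ : lp E q →L[ℂ] ℂ)
    (S : Finset ι) : ∑ i ∈ S, ‖component Λ i‖ ^ q'.toReal ≤ ‖Λ‖ ^ q'.toReal := by
  have hc := holderConjugate_toReal (p' := q') hq1 hq
  obtain ⟨b, hb, hmax⟩ := (NNReal.isGreatest_Lp S (fun i => ‖component Λ i‖₊) hc.symm).1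
  have hroot : (∑ i ∈ S, ‖component Λ i‖ ^ q'.toReal) ^ (1 / q'.toReal) =
      ∑ i ∈ S, (b i : ℝ) * ‖component Λ i‖ := by
    have := congrArg NNReal.toReal hmax
    simp only at this
    push_cast at this
    rw [← this]
    exact Finset.sum_congr rfl fun i _ => mul_comm _ _
  rw [← Real.rpow_inv_le_iff_of_pos (by positivity) (norm_nonneg _) hc.symm.pos, ← one_div, hroot]
  exact sum_mul_norm_component_le hq Λ S _ (fun i => (b i).2) (by exact_mod_cast hb)

lemma exists_lp_of_norm_le_component [Fact (1 ≤ q')] (hq : q ≠ ∞) (Λ : lp E q →L[ℂ] ℂ) {C : ℝ}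
    (hC : 0 ≤ C) (σ : κ ↪ ι) (g : ∀ i, F i) (hg : ∀ i, ‖g i‖ ≤ C * ‖component Λ (σ i)‖) :
    ∃ G : lp F q', (∀ i, G i = g i) ∧ ‖G‖ ≤ C * ‖Λ‖ := by
  by_cases hq1 : q = 1
  · subst hq1
    obtain rfl := holderConjugate_one_eq_top q'
    have hb : ∀ i, ‖g i‖ ≤ C * ‖Λ‖ := fun i =>
      (hg i).trans (mul_le_mul_of_nonneg_left (norm_component_le Λ _) hC)
    exact ⟨⟨g, memℓp_infty ⟨C * ‖Λ‖, by rintro _ ⟨i, rfl⟩; exact hb i⟩⟩, fun _ => rfl,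
      lp.norm_le_of_forall_le (by positivity) hb⟩
  have hc := holderConjugate_toReal (p' := q') hq1 hq
  have hsum : ∀ S : Finset κ, ∑ i ∈ S, ‖g i‖ ^ q'.toReal ≤ (C * ‖Λ‖) ^ q'.toReal := fun S => by
    calc ∑ i ∈ S, ‖g i‖ ^ q'.toReal ≤
        ∑ i ∈ S, C ^ q'.toReal * ‖component Λ (σ i)‖ ^ q'.toReal := by
          refine Finset.sum_le_sum fun i _ => ?_
          rw [← Real.mul_rpow hC (norm_nonneg _)]
          exact Real.rpow_le_rpow (norm_nonneg _) (hg i) hc.symm.nonneg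
      _ = C ^ q'.toReal * ∑ i ∈ S.map σ, ‖component Λ i‖ ^ q'.toReal := by
          rw [Finset.sum_map, Finset.mul_sum]
      _ ≤ C ^ q'.toReal * ‖Λ‖ ^ q'.toReal := by
          gcongr
          exact sum_norm_component_rpow_le hq1 hq Λ _
      _ = _ := by rw [Real.mul_rpow hC (norm_nonneg _)]
  exact ⟨⟨g, memℓp_gen' hsum⟩, fun _ => rfl,
    lp.norm_le_of_forall_sum_le hc.symm.pos (by positivity) hsum⟩

end Components

/-! ### Test functions as elements of `E^s_{p,q}` -/

section BandSequences

variable {d : ℕ}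

lemma exists_lp_of_norm_le_summable {ι : Type*} {E : ι → Type*}
    [∀ i, NormedAddCommGroup (E i)] [∀ i, NormedSpace ℂ (E i)] [∀ i, CompleteSpace (E i)]
    (q : ℝ≥0∞) [Fact (1 ≤ q)] (x : ∀ i, E i) {b : ι → ℝ} (hb : Summable b)
    (hx : ∀ i, ‖x i‖ ≤ b i) : ∃ w : lp E q, (∀ i, w i = x i) ∧ ‖w‖ ≤ ∑' i, b i := by
  classical
  have hx' : ∀ i, ‖lp.single q i (x i)‖ ≤ b i := fun i => by
    rw [lp.norm_single (zero_lt_one.trans_le Fact.out)]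
    exact hx i
  have hs : Summable fun i => lp.single q i (x i) := .of_norm_bounded hb hx'
  refine ⟨∑' i, lp.single q i (x i), fun i => ?_, tsum_of_norm_bounded hb.hasSum hx'⟩
  refine ((lp.evalCLM ℂ E q i).map_tsum hs).trans ((tsum_eq_single i fun j hj => ?_).trans ?_)
  · exact lp.single_apply_ne q j (x j) hj.symm
  · exact lp.single_apply_self q i (x i)

lemma hasSum_integral_band_mul (φ ψ : 𝓢(Rd d, ℂ)) :
    HasSum (fun k : Fin d → ℤ => ∫ x, band .narrow k φ x * ψ x) (∫ x, φ x * ψ x) := by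
  have parseval : ∀ u : 𝓢(Rd d, ℂ), ∫ x, u x * ψ x = ∫ ξ, 𝓕 u ξ * 𝓕⁻ ψ ξ := fun u => by
    rw [← SchwartzMap.integral_fourierInv_mul_eq, FourierTransform.fourierInv_fourier_eq]
  let v : 𝓢(Rd d, ℂ) := smulLeftCLM ℂ ⇑(𝓕 φ : 𝓢(Rd d, ℂ)) (𝓕⁻ ψ)
  have hv : ∀ ξ, 𝓕 φ ξ * 𝓕⁻ ψ ξ = v ξ := fun ξ =>
    (smulLeftCLM_apply_apply (𝓕 φ).hasTemperateGrowth (𝓕⁻ ψ) ξ).symm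
  have hpart : ∀ ξ, HasSum (fun k => Cutoff.narrow.tensor k ξ * ‖v ξ‖) ‖v ξ‖ := fun ξ => by
    simpa only [one_mul] using (Cutoff.hasSum_narrow_tensor ξ).mul_right ‖v ξ‖
  simp only [parseval, fourier_band, mul_assoc, hv]
  refine hasSum_integral_of_dominated_convergence
    (fun k ξ => Cutoff.narrow.tensor k ξ * ‖v ξ‖) (fun k => ?_)
    (fun k => .of_forall fun ξ => ?_) (.of_forall fun ξ => (hpart ξ).summable) ?_
    (.of_forall fun ξ => ?_)
  · exact ((Cutoff.narrow.symbol k).continuous.mul v.continuous).aestronglyMeasurable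
  · rw [norm_mul, Complex.norm_real, Real.norm_of_nonneg (Cutoff.narrow_tensor_nonneg _ _)]
  · simpa only [(hpart _).tsum_eq] using v.integrable.norm
  · simpa only [Complex.ofReal_one, one_mul] using
      (Complex.hasSum_ofReal.2 (Cutoff.hasSum_narrow_tensor ξ)).mul_right (v ξ)

variable {s : ℝ} {p q : ℝ≥0∞} [Fact (1 ≤ p)]

/-- `w` is the weighted sequence of the frequency-localised parts of `φ`: the canonical
decomposition of `φ`, which represents `φ` in `E^s_{p,q}`. -/
def IsBandSeq (s : ℝ) (φ : 𝓢(Rd d, ℂ)) (w : spectralSeq d p q) : Prop :=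
  ∀ k, w.1 k = weight s k • (band .narrow k φ).toLp p volume

lemma IsBandSeq.sub {φ ψ : 𝓢(Rd d, ℂ)} {w v : spectralSeq d p q} (hw : IsBandSeq s φ w)
    (hv : IsBandSeq s ψ v) : IsBandSeq s (φ - ψ) (w - v) := fun k => by
  rw [Submodule.coe_sub, lp.coeFn_sub, Pi.sub_apply, hw k, hv k, ← smul_sub, map_sub]
  exact congrArg _ (map_sub (SchwartzMap.toLpCLM ℂ ℂ p (volume : Measure (Rd d))) _ _).symm

lemma IsBandSeq.unique {φ : 𝓢(Rd d, ℂ)} {w v : spectralSeq d p q} (hw : IsBandSeq s φ w)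
    (hv : IsBandSeq s φ v) : w = v :=
  Subtype.ext (lp.ext (funext fun k => (hw k).trans (hv k).symm))

lemma weight_mul_schwartzPairing_weight_smul (s : ℝ) (k : Fin d → ℤ) (η : 𝓢(Rd d, ℂ))
    (f : Lp ℂ p (volume : Measure (Rd d))) :
    (weight (-s) k : ℂ) * schwartzPairing p η (weight s k • f) = schwartzPairing p η f := by
  have hcoe : weight s k • f = (weight s k : ℂ) • f := (Complex.coe_smul _ _).symm
  rw [hcoe, map_smul, smul_eq_mul, ← mul_assoc, ← Complex.ofReal_mul, weight_neg_mul,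
    Complex.ofReal_one, one_mul]

lemma IsBandSeq.seqPairing_eq {φ : 𝓢(Rd d, ℂ)} {w : spectralSeq d p q} (hw : IsBandSeq s φ w)
    (ψ : 𝓢(Rd d, ℂ)) : seqPairing s w.1 ψ = ∫ x, φ x * ψ x := by
  rw [seqPairing, ← (hasSum_integral_band_mul φ ψ).tsum_eq]
  refine tsum_congr fun k => ?_
  rw [hw k, weight_mul_schwartzPairing_weight_smul, schwartzPairing_toLp]

variable [Fact (1 ≤ q)]

variable (d p q s) in
lemma exists_isBandSeq : ∃ C : ℝ, 0 ≤ C ∧ ∀ (φ : 𝓢(Rd d, ℂ)) (P Q : ℝ),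
    DecayBound (rate s) P Q φ →
      ∃ w : spectralSeq d p q, IsBandSeq s φ w ∧ ‖w‖ ≤ C * √(P * Q) := by
  obtain ⟨C, hC0, hC⟩ := exists_norm_toLp_band_le d .narrow (rate s).2.le p
  refine ⟨C * ∑' k : Fin d → ℤ, Real.exp (-absOneInt k), by positivity, fun φ P Q h => ?_⟩
  have hterm : ∀ k, ‖weight s k • (band .narrow k φ).toLp p volume‖ ≤
      C * √(P * Q) * Real.exp (-absOneInt k) := fun k => by
    rw [norm_smul, Real.norm_of_nonneg (weight_pos s k).le]
    calc weight s k * ‖(band .narrow k φ).toLp p volume‖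
        ≤ weight s k * (C * (Real.exp (-((rate s : ℝ) / 2) * absOneInt k) * √(P * Q))) :=
          mul_le_mul_of_nonneg_left (hC φ P Q h k) (weight_pos s k).le
      _ = C * √(P * Q) * (weight s k * Real.exp (-((rate s : ℝ) / 2) * absOneInt k)) := by ring
      _ ≤ C * √(P * Q) * Real.exp (-absOneInt k) :=
          mul_le_mul_of_nonneg_left (weight_mul_exp_le s k) (by positivity)
  obtain ⟨w, hw, hnorm⟩ := exists_lp_of_norm_le_summable
    (E := fun _ : Fin d → ℤ => Lp ℂ p (volume : Measure (Rd d))) q _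
    ((summable_exp_neg_absOneInt d).mul_left (C * √(P * Q))) hterm
  refine ⟨⟨w, mem_spectralSeq.2 fun k => ?_⟩, hw, hnorm.trans_eq ?_⟩
  · rw [hw]
    exact (hasSpectrumIn_toLp_band k φ).real_smul _
  · rw [tsum_mul_left]
    ring

lemma IsBandSeq.toUltra_quot_apply {φ : 𝓢(Rd d, ℂ)} {w : spectralSeq d p q}
    (hw : IsBandSeq s φ w) (ψ : GelfandShilov d) :
    (ExpMod.quot s w).toUltra ψ = ∫ x, φ x * ψ x := by
  rw [ExpMod.toUltra_quot, synthesis_apply, hw.seqPairing_eq, GelfandShilov.coe_toSchwartz]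

variable (s p q) in
/-- The band sequence of a test function. -/
def GelfandShilov.bandSeq (φ : GelfandShilov d) : spectralSeq d p q :=
  ((exists_isBandSeq d s p q).choose_spec.2 _ _ _ (φ.decayBound (rate s))).choose

lemma GelfandShilov.isBandSeq_bandSeq (φ : GelfandShilov d) :
    IsBandSeq s φ.toSchwartz (φ.bandSeq s p q) :=
  ((exists_isBandSeq d s p q).choose_spec.2 _ _ _ (φ.decayBound (rate s))).choose_spec.1

variable (s p q) in
/-- The inclusion of the test functions into `E^s_{p,q}`. -/
def GelfandShilov.toExpMod (φ : GelfandShilov d) : ExpMod d s p q :=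
  ExpMod.quot s (φ.bandSeq s p q)

lemma GelfandShilov.toUltra_toExpMod (φ ψ : GelfandShilov d) :
    (φ.toExpMod s p q).toUltra ψ = ∫ x, φ x * ψ x := by
  rw [toExpMod, φ.isBandSeq_bandSeq.toUltra_quot_apply, coe_toSchwartz]

end BandSequences

/-! ### From functionals on `E^s_{p,q}` to elements of `E^{-s}_{p',q'}` -/

section DualSequence

variable {d : ℕ} {s : ℝ} {p q p' q' : ℝ≥0∞} [Fact (1 ≤ p)] [Fact (1 ≤ q)] [Fact (1 ≤ p')]

lemma IsBandSeq.seqPairing_eq_apply (hq : q ≠ ∞) {Λ : SeqLp d p q →L[ℂ] ℂ} {G : SeqLp d p' q'}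
    (hG : ∀ k ψ, schwartzPairing p' ψ (G k) = component Λ (-k) ((band .narrow (-k) ψ).toLp p))
    {φ : 𝓢(Rd d, ℂ)} {w : spectralSeq d p q} (hw : IsBandSeq s φ w) :
    seqPairing (-s) G φ = Λ w.1 := by
  rw [← (Λ.hasSum (lp.hasSum_single hq w.1)).tsum_eq, seqPairing, ← (Equiv.neg _).tsum_eq]
  refine tsum_congr fun k => ?_
  have hcoe : w.1 k = (weight s k : ℂ) • (band .narrow k φ).toLp p volume :=
    (hw k).trans (Complex.coe_smul _ _).symm
  rw [Equiv.neg_apply, neg_neg, hG, neg_neg, weight_neg_index, ← component_apply, hcoe, map_smul,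
    smul_eq_mul]

variable [ENNReal.HolderConjugate p p'] [Fact (1 ≤ q')] [ENNReal.HolderConjugate q q']

variable (p' q') in
lemma exists_spectralSeq_eq_component (hp : p ≠ ∞) (hq : q ≠ ∞) (Λ : SeqLp d p q →L[ℂ] ℂ) :
    ∃ G : spectralSeq d p' q',
      (∀ k ψ, schwartzPairing p' ψ (G.1 k) =
        component Λ (-k) ((band .narrow (-k) ψ).toLp p)) ∧
      ‖G‖ ≤ (∫ t, ‖(𝓕⁻ (Cutoff.narrow.symbol (0 : Fin d → ℤ))) t‖) * ‖Λ‖ := by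
  choose g hg hg_norm using fun k =>
    exists_schwartzPairing_eq_apply_fourierMultiplier (p' := p') hp (component Λ k)
      (Cutoff.narrow.symbol k)
  simp only [Cutoff.norm_fourierInv_symbol Cutoff.narrow] at hg_norm
  obtain ⟨G, hG, hG_norm⟩ := exists_lp_of_norm_le_component (q' := q') hq Λ (by positivity)
    (Equiv.neg (Fin d → ℤ)).toEmbedding (fun k => g (-k)) fun k => hg_norm (-k)
  have hpairing : ∀ k ψ, schwartzPairing p' ψ (G k) =
      component Λ (-k) ((band .narrow (-k) ψ).toLp p) := fun k ψ => by
    rw [hG, hg]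
    rfl
  refine ⟨⟨G, mem_spectralSeq.2 fun k =>
    hasSpectrumIn_of_forall_band_eq_zero fun φ hφ => ?_⟩, hpairing, hG_norm⟩
  have hzero : (0 : 𝓢(Rd d, ℂ)).toLp p volume = 0 :=
    map_zero (SchwartzMap.toLpCLM ℂ ℂ p (volume : Measure (Rd d)))
  rw [hpairing, hφ, hzero, map_zero]

variable (d s p q p' q') in
lemma exists_expMod_of_dual (hp : p ≠ ∞) (hq : q ≠ ∞) : ∃ C : ℝ,
    ∀ L : ExpMod d s p q →L[ℂ] ℂ, ∃ v : ExpMod d (-s) p' q', ‖v‖ ≤ C * ‖L‖ ∧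
      ∀ φ : GelfandShilov d, v.toUltra φ = L (φ.toExpMod s p q) := by
  refine ⟨∫ t, ‖(𝓕⁻ (Cutoff.narrow.symbol (0 : Fin d → ℤ))) t‖, fun L => ?_⟩
  obtain ⟨Λ, hΛ, hΛ_norm⟩ := exists_extension_norm_eq (spectralSeq d p q) (L ∘L ExpMod.quot s)
  have hΛL : ‖Λ‖ ≤ ‖L‖ := by
    rw [hΛ_norm]
    exact ContinuousLinearMap.opNorm_le_bound _ (norm_nonneg _) fun w =>
      L.le_opNorm_of_le (ExpMod.norm_quot_le w)
  obtain ⟨G, hG, hG_norm⟩ := exists_spectralSeq_eq_component p' q' hp hq Λ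
  refine ⟨ExpMod.quot (-s) G, ?_, fun φ => ?_⟩
  · exact (ExpMod.norm_quot_le G).trans
      (hG_norm.trans (mul_le_mul_of_nonneg_left hΛL (by positivity)))
  · rw [ExpMod.toUltra_quot, synthesis_apply, φ.isBandSeq_bandSeq.seqPairing_eq_apply hq hG]
    exact hΛ _

end DualSequence

/-! ### Gaussian damping -/

section FourierMul

variable {V : Type*} [NormedAddCommGroup V] [InnerProductSpace ℝ V] [FiniteDimensional ℝ V]
  [MeasurableSpace V] [BorelSpace V]

lemma fourier_mul_eq_integral (θ : 𝓢(V, ℂ)) {g : V → ℂ} (hg : Integrable g volume) (ξ : V) :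
    𝓕 (fun x => θ x * g x) ξ = ∫ η, 𝓕 θ η * 𝓕 g (ξ - η) := by
  set h : V → ℂ := fun x => Real.fourierChar (-inner ℝ x ξ) • g x with hh
  have hint : Integrable h volume :=
    (Real.fourierIntegral_convergent_iff ξ).2 hg
  have hfourier : ∀ η, 𝓕 h η = 𝓕 g (ξ + η) := fun η => by
    simp only [Real.fourier_eq, hh, smul_smul, ← AddChar.map_add_eq_mul, inner_add_right, neg_add]
    exact integral_congr_ae (Eventually.of_forall fun x => by simp only [add_comm])
  have hflip : ∫ x, 𝓕 (𝓕⁻ θ : 𝓢(V, ℂ)) x * h x = ∫ η, (𝓕⁻ θ : 𝓢(V, ℂ)) η * 𝓕 h η := by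
    have := VectorFourier.integral_fourierIntegral_smul_eq_flip (L := innerₗ V)
      Real.continuous_fourierChar continuous_inner
      ((𝓕⁻ θ : 𝓢(V, ℂ)).integrable (μ := volume)) hint
    rwa [flip_innerₗ] at this
  calc 𝓕 (fun x => θ x * g x) ξ = ∫ x, 𝓕 (𝓕⁻ θ : 𝓢(V, ℂ)) x * h x := by
        rw [Real.fourier_eq, FourierTransform.fourier_fourierInv_eq]
        simp only [hh, mul_smul_comm]
    _ = ∫ η, 𝓕 θ (-η) * 𝓕 g (ξ + η) := by
        simp only [hflip, hfourier, fourierInv_apply_eq_fourier_neg]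
    _ = ∫ η, 𝓕 θ η * 𝓕 g (ξ - η) := by
        rw [← integral_neg_eq_self]
        simp only [neg_neg, sub_eq_add_neg]

lemma integrable_exp_neg_mul_sq_norm {b : ℝ} (hb : 0 < b) :
    Integrable (fun x : V => Real.exp (-b * ‖x‖ ^ 2)) volume := by
  have h := (GaussianFourier.integrable_cexp_neg_mul_sq_norm_add (V := V) (b := b)
    (by rwa [Complex.ofReal_re]) 0 0).norm
  refine h.congr (Eventually.of_forall fun x => ?_)
  simp only [zero_mul, add_zero, Complex.norm_exp]
  norm_cast

end FourierMul

section Damping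

variable {d : ℕ}

/-- The Gaussian `exp (-ε ‖x‖²)`. -/
def gaussian (ε : ℝ) (x : Rd d) : ℂ := Complex.exp (-ε * ‖x‖ ^ 2)

lemma gaussian_eq_ofReal (ε : ℝ) (x : Rd d) : gaussian ε x = (Real.exp (-ε * ‖x‖ ^ 2) : ℝ) := by
  rw [gaussian, Complex.ofReal_exp]
  push_cast
  rfl

lemma norm_gaussian (ε : ℝ) (x : Rd d) : ‖gaussian ε x‖ = Real.exp (-ε * ‖x‖ ^ 2) := by
  rw [gaussian_eq_ofReal, Complex.norm_real, Real.norm_of_nonneg (Real.exp_pos _).le]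

lemma contDiff_gaussian (ε : ℝ) : ContDiff ℝ (⊤ : ℕ∞) (gaussian ε : Rd d → ℂ) := by
  rw [funext (gaussian_eq_ofReal ε)]
  exact Complex.ofRealCLM.contDiff.comp (contDiff_const.mul (contDiff_norm_sq ℝ)).exp

lemma integrable_gaussian {ε : ℝ} (hε : 0 < ε) : Integrable (gaussian ε : Rd d → ℂ) volume := by
  rw [funext (gaussian_eq_ofReal ε)]
  exact (integrable_exp_neg_mul_sq_norm hε).ofReal

lemma norm_gaussian_sub_one_le {ε : ℝ} (hε : 0 ≤ ε) (x : Rd d) :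
    ‖gaussian ε x - 1‖ ≤ ε * ‖x‖ ^ 2 := by
  have hle : Real.exp (-ε * ‖x‖ ^ 2) ≤ 1 := Real.exp_le_one_iff.2 (by nlinarith [sq_nonneg ‖x‖])
  have hge := Real.add_one_le_exp (-ε * ‖x‖ ^ 2)
  rw [gaussian_eq_ofReal, ← Complex.ofReal_one, ← Complex.ofReal_sub, Complex.norm_real,
    Real.norm_eq_abs, abs_sub_comm, abs_of_nonneg (by linarith)]
  linarith

lemma norm_fourier_gaussian {ε : ℝ} (hε : 0 < ε) (w : Rd d) :
    ‖𝓕 (gaussian ε) w‖ = (Real.pi / ε) ^ ((d : ℝ) / 2) * Real.exp (-Real.pi ^ 2 * ‖w‖ ^ 2 / ε) := by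
  have hre : 0 < ((ε : ℝ) : ℂ).re := by simpa using hε
  have hfourier := fourier_gaussian_innerProductSpace hre w
  have hcast : ((d : ℂ) / 2) = (((d : ℝ) / 2 : ℝ) : ℂ) := by push_cast; rfl
  rw [show (gaussian ε : Rd d → ℂ) = fun v => Complex.exp (-(ε : ℂ) * ‖v‖ ^ 2) from rfl, hfourier,
    norm_mul, finrank_euclideanSpace_fin, hcast, ← Complex.ofReal_div,
    ← Complex.ofReal_cpow (by positivity), Complex.norm_real, Real.norm_of_nonneg (by positivity),
    Complex.norm_exp]
  norm_cast

/-- An exponential weight costs at most half of the Gaussian exponent, uniformly in `ε ≤ 1`. -/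
lemma exp_mul_norm_fourier_gaussian_le {c ε : ℝ} (hε : 0 < ε) (hε1 : ε ≤ 1) (w : Rd d) :
    Real.exp (c * ‖w‖) * ‖𝓕 (gaussian ε) w‖ ≤ Real.exp (c ^ 2) * (Real.pi / ε) ^ ((d : ℝ) / 2) *
      Real.exp (-(Real.pi ^ 2 / (2 * ε)) * ‖w‖ ^ 2) := by
  have hexponent : c * ‖w‖ + -Real.pi ^ 2 * ‖w‖ ^ 2 / ε ≤
      c ^ 2 + -(Real.pi ^ 2 / (2 * ε)) * ‖w‖ ^ 2 := by
    have hpi : 9 ≤ Real.pi ^ 2 := by nlinarith [Real.pi_gt_three]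
    have hone : 1 ≤ Real.pi ^ 2 / (2 * ε) := by
      rw [le_div_iff₀ (by positivity)]
      linarith
    have hsplit : -Real.pi ^ 2 * ‖w‖ ^ 2 / ε =
        -(Real.pi ^ 2 / (2 * ε)) * ‖w‖ ^ 2 - Real.pi ^ 2 / (2 * ε) * ‖w‖ ^ 2 := by
      field_simp
      ring
    rw [hsplit]
    nlinarith [sq_nonneg (c - ‖w‖), mul_le_mul_of_nonneg_right hone (sq_nonneg ‖w‖), sq_nonneg c,
      sq_nonneg ‖w‖]
  calc Real.exp (c * ‖w‖) * ‖𝓕 (gaussian ε) w‖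
      = (Real.pi / ε) ^ ((d : ℝ) / 2) * Real.exp (c * ‖w‖ + -Real.pi ^ 2 * ‖w‖ ^ 2 / ε) := by
        rw [norm_fourier_gaussian hε, Real.exp_add]
        ring
    _ ≤ (Real.pi / ε) ^ ((d : ℝ) / 2) *
        Real.exp (c ^ 2 + -(Real.pi ^ 2 / (2 * ε)) * ‖w‖ ^ 2) := by gcongr
    _ = _ := by
        rw [Real.exp_add]
        ring

lemma integral_gaussian_majorant {ε : ℝ} (hε : 0 < ε) : (Real.pi / ε) ^ ((d : ℝ) / 2) *
    ∫ w : Rd d, Real.exp (-(Real.pi ^ 2 / (2 * ε)) * ‖w‖ ^ 2) = 2 ^ ((d : ℝ) / 2) := by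
  rw [GaussianFourier.integral_rexp_neg_mul_sq_norm (by positivity), finrank_euclideanSpace_fin,
    ← Real.mul_rpow (by positivity) (by positivity)]
  congr 1
  field_simp

lemma absOne_le_sub_add (x y : Rd d) : absOne x ≤ absOne (x - y) + absOne y := by
  rw [absOne, absOne, absOne, ← Finset.sum_add_distrib]
  exact Finset.sum_le_sum fun i _ => by simpa using abs_add_le (x i - y i) (y i)

lemma absOne_le_mul_norm (x : Rd d) : absOne x ≤ d * ‖x‖ := by
  refine (Finset.sum_le_card_nsmul Finset.univ _ ‖x‖ fun i _ => PiLp.norm_apply_le x i).trans ?_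
  simp

/-- The product of `θ` with the Gaussian `exp (-ε ‖x‖²)`; it is a Gelfand-Shilov function as soon
as the Fourier transform of `θ` decays faster than any exponential. -/
def damped (θ : 𝓢(Rd d, ℂ)) (ε : ℝ) (x : Rd d) : ℂ := θ x * gaussian ε x

lemma contDiff_damped (θ : 𝓢(Rd d, ℂ)) (ε : ℝ) : ContDiff ℝ (⊤ : ℕ∞) (damped θ ε) :=
  (θ.smooth ⊤).mul (contDiff_gaussian ε)

lemma norm_damped_sub_le (θ : 𝓢(Rd d, ℂ)) {ε : ℝ} (hε : 0 ≤ ε) (x : Rd d) :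
    ‖damped θ ε x - θ x‖ ≤ ε * (‖x‖ ^ 2 * ‖θ x‖) := by
  have hfactor : damped θ ε x - θ x = (gaussian ε x - 1) * θ x := by
    rw [damped]
    ring
  rw [hfactor, norm_mul, ← mul_assoc]
  exact mul_le_mul_of_nonneg_right (norm_gaussian_sub_one_le hε x) (norm_nonneg _)

lemma exp_mul_norm_fourier_damped_le {l A : ℝ} (hl : 0 ≤ l) {θ : 𝓢(Rd d, ℂ)}
    (hA : ∀ ξ, Real.exp (l * absOne ξ) * ‖𝓕 θ ξ‖ ≤ A) {ε : ℝ} (hε : 0 < ε) (hε1 : ε ≤ 1)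
    (ξ : Rd d) : Real.exp (l * absOne ξ) * ‖𝓕 (damped θ ε) ξ‖ ≤
      A * (Real.exp ((l * d) ^ 2) * 2 ^ ((d : ℝ) / 2)) := by
  have hA0 : 0 ≤ A := le_trans (by positivity) (hA 0)
  have hpoint : ∀ η, Real.exp (l * absOne ξ) * ‖𝓕 θ η * 𝓕 (gaussian ε) (ξ - η)‖ ≤
      A * (Real.exp ((l * d) ^ 2) * (Real.pi / ε) ^ ((d : ℝ) / 2) *
        Real.exp (-(Real.pi ^ 2 / (2 * ε)) * ‖ξ - η‖ ^ 2)) := fun η => by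
    have hexp : Real.exp (l * absOne ξ) ≤
        Real.exp (l * absOne η) * Real.exp (l * d * ‖ξ - η‖) := by
      rw [← Real.exp_add, Real.exp_le_exp, mul_assoc, ← mul_add]
      exact mul_le_mul_of_nonneg_left
        (by linarith [absOne_le_sub_add ξ η, absOne_le_mul_norm (ξ - η)]) hl
    rw [norm_mul]
    calc _ ≤ Real.exp (l * absOne η) * Real.exp (l * d * ‖ξ - η‖) *
          (‖𝓕 θ η‖ * ‖𝓕 (gaussian ε) (ξ - η)‖) := by gcongr
      _ = Real.exp (l * absOne η) * ‖𝓕 θ η‖ *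
          (Real.exp (l * d * ‖ξ - η‖) * ‖𝓕 (gaussian ε) (ξ - η)‖) := by ring
      _ ≤ _ := mul_le_mul (hA η) (exp_mul_norm_fourier_gaussian_le hε hε1 _) (by positivity) hA0
  have hint := (integrable_exp_neg_mul_sq_norm (V := Rd d)
    (b := Real.pi ^ 2 / (2 * ε)) (by positivity)).comp_sub_left ξ
  calc Real.exp (l * absOne ξ) * ‖𝓕 (damped θ ε) ξ‖
      ≤ Real.exp (l * absOne ξ) * ∫ η, ‖𝓕 θ η * 𝓕 (gaussian ε) (ξ - η)‖ := by
        have hfourier : 𝓕 (damped θ ε) ξ = ∫ η, 𝓕 θ η * 𝓕 (gaussian ε) (ξ - η) :=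
          fourier_mul_eq_integral θ (integrable_gaussian hε) ξ
        rw [hfourier]
        gcongr
        exact norm_integral_le_integral_norm _
    _ ≤ ∫ η, A * (Real.exp ((l * d) ^ 2) * (Real.pi / ε) ^ ((d : ℝ) / 2) *
          Real.exp (-(Real.pi ^ 2 / (2 * ε)) * ‖ξ - η‖ ^ 2)) := by
        rw [← integral_const_mul]
        exact integral_mono_of_nonneg (Eventually.of_forall fun η => by positivity)
          ((hint.const_mul _).const_mul _) (Eventually.of_forall hpoint)
    _ = _ := by
        rw [integral_const_mul, integral_const_mul, integral_sub_left_eq_self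
          (fun w : Rd d => Real.exp (-(Real.pi ^ 2 / (2 * ε)) * ‖w‖ ^ 2)) volume ξ, mul_assoc,
          integral_gaussian_majorant hε]

lemma exists_freq_bound_damped {l : ℝ} (hl : 0 ≤ l) {A : ℝ} {θ : 𝓢(Rd d, ℂ)}
    (hA : ∀ ξ, Real.exp (l * absOne ξ) * ‖angFourier θ ξ‖ ≤ A) :
    ∃ B : ℝ, ∀ ε : ℝ, 0 < ε → ε ≤ 1 →
      ∀ ξ, Real.exp (l * absOne ξ) * ‖angFourier (damped θ ε) ξ‖ ≤ B := by
  have hscale (f : Rd d → ℂ) (ξ : Rd d) : Real.exp (l * (2 * Real.pi) * absOne ξ) * ‖𝓕 f ξ‖ =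
      Real.exp (l * absOne ((2 * Real.pi) • ξ)) * ‖angFourier f ((2 * Real.pi) • ξ)‖ := by
    rw [← fourier_eq_angFourier, absOne_smul Real.two_pi_pos.le, mul_assoc]
  refine ⟨A * (Real.exp ((l * (2 * Real.pi) * d) ^ 2) * 2 ^ ((d : ℝ) / 2)), fun ε hε hε1 ξ => ?_⟩
  have hbound := exp_mul_norm_fourier_damped_le (l := l * (2 * Real.pi)) (by positivity)
    (fun ξ => (hscale θ ξ).trans_le (hA _)) hε hε1 ((2 * Real.pi)⁻¹ • ξ)
  rwa [hscale, smul_inv_smul₀ Real.two_pi_pos.ne'] at hbound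

/-- The Fourier transform of `θ` decays faster than any exponential: the frequency half of
membership in the Gelfand-Shilov space. -/
def HasExpFourier (θ : 𝓢(Rd d, ℂ)) : Prop :=
  ∀ l : ℝ, 0 < l → ∃ A : ℝ, ∀ ξ, Real.exp (l * absOne ξ) * ‖angFourier θ ξ‖ ≤ A

lemma exists_one_add_norm_pow_mul_le (u : 𝓢(Rd d, ℂ)) (n : ℕ) :
    ∃ P : ℝ, 0 ≤ P ∧ ∀ x, (1 + ‖x‖) ^ n * ‖u x‖ ≤ P := by
  have h : ∀ x, (1 + ‖x‖) ^ n * ‖u x‖ ≤ 2 ^ n *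
      (Finset.Iic (n, 0)).sup (fun m => SchwartzMap.seminorm ℝ m.1 m.2) u := fun x => by
    have := SchwartzMap.one_add_le_sup_seminorm_apply (𝕜 := ℝ) (m := (n, 0)) le_rfl le_rfl u x
    rwa [norm_iteratedFDeriv_zero] at this
  exact ⟨_, le_trans (by positivity) (h 0), h⟩

lemma exists_norm_le (u : 𝓢(Rd d, ℂ)) : ∃ P : ℝ, 0 ≤ P ∧ ∀ x, ‖u x‖ ≤ P := by
  simpa only [pow_zero, one_mul] using exists_one_add_norm_pow_mul_le u 0

lemma HasExpFourier.exists_decayBound {θ : 𝓢(Rd d, ℂ)} (hθ : HasExpFourier θ) {l : ℝ}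
    (hl : 0 < l) : ∃ P Q : ℝ, DecayBound l P Q θ := by
  obtain ⟨P, -, hP⟩ := exists_one_add_norm_pow_mul_le θ (2 * (d + 1))
  obtain ⟨Q, hQ⟩ := hθ l hl
  exact ⟨P, Q, hP, hQ⟩

lemma isGelfandShilov_damped {θ : 𝓢(Rd d, ℂ)} (hθ : HasExpFourier θ) {ε : ℝ} (hε : 0 < ε)
    (hε1 : ε ≤ 1) : IsGelfandShilov (damped θ ε) where
  smooth := contDiff_damped θ ε
  decay l hl := by
    obtain ⟨P, hP0, hP⟩ := exists_norm_le θ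
    refine ⟨P * Real.exp ((l * d) ^ 2 / ε), fun x => ?_⟩
    rw [damped, norm_mul, norm_gaussian, mul_left_comm, ← Real.exp_add]
    refine mul_le_mul (hP x) (Real.exp_le_exp.2 ?_) (Real.exp_pos _).le hP0
    have hlinear := mul_le_mul_of_nonneg_left (absOne_le_mul_norm x) hl.le
    rw [le_div_iff₀ hε]
    nlinarith [sq_nonneg (l * d - ε * ‖x‖), sq_nonneg (l * d), sq_nonneg (ε * ‖x‖)]
  decayFourier l hl := by
    obtain ⟨A, hA⟩ := hθ l hl
    obtain ⟨B, hB⟩ := exists_freq_bound_damped hl.le hA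
    exact ⟨B, hB ε hε hε1⟩

lemma norm_angFourier_sub_le (u v : 𝓢(Rd d, ℂ)) (ξ : Rd d) :
    ‖angFourier (u - v : 𝓢(Rd d, ℂ)) ξ‖ ≤ ‖angFourier u ξ‖ + ‖angFourier v ξ‖ := by
  simp only [angFourier, ← SchwartzMap.fourier_coe]
  have hsub : 𝓕 (u - v) = 𝓕 u - 𝓕 v := map_sub (fourierCLM ℂ 𝓢(Rd d, ℂ)) u v
  rw [hsub, sub_apply]
  exact norm_sub_le _ _

lemma HasExpFourier.exists_decayBound_sub {θ : 𝓢(Rd d, ℂ)} (hθ : HasExpFourier θ) {l : ℝ}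
    (hl : 0 < l) : ∃ P Q : ℝ, ∀ ε : ℝ, 0 < ε → ε ≤ 1 →
      ∃ φ : GelfandShilov d, DecayBound l (ε * P) Q (φ.toSchwartz - θ) := by
  obtain ⟨P, -, hP⟩ := exists_one_add_norm_pow_mul_le θ (2 * (d + 1) + 2)
  obtain ⟨A, hA⟩ := hθ l hl
  obtain ⟨B, hB⟩ := exists_freq_bound_damped hl.le hA
  refine ⟨P, B + A, fun ε hε hε1 => ?_⟩
  let φ : GelfandShilov d := ⟨damped θ ε, isGelfandShilov_damped hθ hε hε1⟩
  have hφ : (φ.toSchwartz : Rd d → ℂ) = damped θ ε := φ.coe_toSchwartz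
  refine ⟨φ, fun x => ?_, fun ξ => ?_⟩
  · rw [sub_apply, hφ]
    calc (1 + ‖x‖) ^ (2 * (d + 1)) * ‖damped θ ε x - θ x‖
        ≤ (1 + ‖x‖) ^ (2 * (d + 1)) * (ε * ((1 + ‖x‖) ^ 2 * ‖θ x‖)) := by
          refine mul_le_mul_of_nonneg_left ((norm_damped_sub_le θ hε.le x).trans ?_) (by positivity)
          gcongr
          linarith
      _ = ε * ((1 + ‖x‖) ^ (2 * (d + 1) + 2) * ‖θ x‖) := by
          rw [pow_add]
          ring
      _ ≤ ε * P := mul_le_mul_of_nonneg_left (hP x) hε.le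
  · refine (mul_le_mul_of_nonneg_left (norm_angFourier_sub_le _ _ ξ) (Real.exp_pos _).le).trans ?_
    rw [mul_add, hφ]
    exact add_le_add (hB ε hε hε1 ξ) (hA ξ)

/-- Damping approximates `θ` by Gelfand-Shilov functions, the error being measured by `√(P Q)`. -/
lemma HasExpFourier.eq_zero_of_forall_norm_le {θ : 𝓢(Rd d, ℂ)} (hθ : HasExpFourier θ) {l C : ℝ}
    (hl : 0 < l) {z : ℂ} (h : ∀ (φ : GelfandShilov d) (P Q : ℝ),
      DecayBound l P Q (φ.toSchwartz - θ) → ‖z‖ ≤ C * √(P * Q)) : z = 0 := by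
  obtain ⟨P, Q, hPQ⟩ := hθ.exists_decayBound_sub hl
  have hlim : Tendsto (fun ε : ℝ => C * √(ε * P * Q)) (𝓝[>] 0) (𝓝 0) := by
    have hcont : Continuous fun ε : ℝ => C * √(ε * P * Q) := by fun_prop
    simpa using (hcont.tendsto 0).mono_left nhdsWithin_le_nhds
  refine norm_le_zero_iff.1 (ge_of_tendsto hlim ?_)
  filter_upwards [Ioc_mem_nhdsGT one_pos] with ε hε
  obtain ⟨φ, hφ⟩ := hPQ ε hε.1 hε.2
  exact h φ _ _ hφ

lemma hasExpFourier_band (τ : Cutoff) (k : Fin d → ℤ) (ψ : 𝓢(Rd d, ℂ)) :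
    HasExpFourier (band τ k ψ) := by
  intro l hl
  obtain ⟨P, hP0, hP⟩ := exists_norm_le (𝓕 ψ)
  refine ⟨Real.exp (l * (absOneInt k + 3 * d)) * P, fun ξ => ?_⟩
  set ζ := (2 * Real.pi)⁻¹ • ξ with hζ
  have hfourier : angFourier (band τ k ψ) ξ = (τ.tensor k ζ : ℂ) * 𝓕 ψ ζ := by
    rw [← fourier_band]
    rfl
  rw [hfourier]
  by_cases hsupp : τ.tensor k ζ = 0
  · rw [hsupp, Complex.ofReal_zero, zero_mul, norm_zero, mul_zero]
    positivity
  have hcoord : ∀ i, |ξ i| ≤ |(k i : ℝ)| + 3 := fun i => by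
    have hlt : |2 * Real.pi * ζ i - k i| < 3 :=
      not_le.1 fun hle => hsupp (Cutoff.tensor_eq_zero hle)
    rw [hζ, PiLp.smul_apply, smul_eq_mul, mul_inv_cancel_left₀ Real.two_pi_pos.ne'] at hlt
    linarith [abs_sub_abs_le_abs_sub (ξ i) (k i)]
  have habs : absOne ξ ≤ absOneInt k + 3 * d :=
    (Finset.sum_le_sum fun i _ => hcoord i).trans_eq (by
      simp [absOneInt, Finset.sum_add_distrib, mul_comm])
  rw [norm_mul, Complex.norm_real, Real.norm_eq_abs]
  have hle := mul_le_mul (τ.abs_tensor_le_one k ζ) (hP ζ) (norm_nonneg _) zero_le_one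
  rw [one_mul] at hle
  gcongr

end Damping

/-! ### Overlapping frequency cubes -/

section Overlap

variable {d : ℕ} {j k : Fin d → ℤ}

/-- The indices of the frequency cubes that may interact with the one of index `j`. -/
def near (j : Fin d → ℤ) : Finset (Fin d → ℤ) :=
  Fintype.piFinset fun i => Finset.Icc (j i - 4) (j i + 4)

lemma mem_near : k ∈ near j ↔ ∀ i, |k i - j i| ≤ 4 := by
  simp only [near, Fintype.mem_piFinset, Finset.mem_Icc, abs_le]
  exact forall_congr' fun i => by constructor <;> rintro ⟨hl, hu⟩ <;> constructor <;> linarith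

lemma exists_le_abs_sub_of_notMem_near (h : k ∉ near j) : ∃ i, 5 ≤ |k i - j i| := by
  rw [mem_near] at h
  push Not at h
  exact h

lemma sum_narrow_tensor_near {ξ : Rd d} (hξ : ∀ i, |2 * Real.pi * ξ i - j i| < 3) :
    ∑ k ∈ near j, Cutoff.narrow.tensor k ξ = 1 := by
  refine Cutoff.sum_narrow_tensor_of_subset fun k hk => mem_near.2 fun i => ?_
  have htri := abs_sub_le (k i : ℝ) (2 * Real.pi * ξ i) (j i)
  rw [abs_sub_comm (k i : ℝ) (2 * Real.pi * ξ i)] at htri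
  have hlt : |(k i : ℝ) - j i| < 5 := by linarith [hk i, hξ i]
  have hlt' : |k i - j i| < 5 := by exact_mod_cast hlt
  omega

lemma fourier_sum_band (τ : Cutoff) (S : Finset (Fin d → ℤ)) (ψ : 𝓢(Rd d, ℂ)) (ξ : Rd d) :
    𝓕 (∑ k ∈ S, band τ k ψ) ξ = ((∑ k ∈ S, τ.tensor k ξ : ℝ) : ℂ) * 𝓕 ψ ξ := by
  have hsum : 𝓕 (∑ k ∈ S, band τ k ψ) = ∑ k ∈ S, 𝓕 (band τ k ψ) :=
    map_sum (fourierCLM ℂ 𝓢(Rd d, ℂ)) _ _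
  rw [hsum, sum_apply, Complex.ofReal_sum, Finset.sum_mul]
  exact Finset.sum_congr rfl fun k _ => fourier_band τ k ψ ξ

lemma sum_band_narrow_wide (j : Fin d → ℤ) (ψ : 𝓢(Rd d, ℂ)) :
    ∑ k ∈ near j, band .narrow k (band .wide j ψ) = band .wide j ψ := by
  refine fourier_injective (SchwartzMap.ext fun ξ => ?_)
  rw [fourier_sum_band, fourier_band]
  by_cases hsupp : Cutoff.wide.tensor j ξ = 0
  · rw [hsupp, Complex.ofReal_zero, zero_mul, mul_zero]
  · rw [sum_narrow_tensor_near fun i => not_le.1 fun hi => hsupp (Cutoff.tensor_eq_zero hi),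
      Complex.ofReal_one, one_mul]

variable {p : ℝ≥0∞} [Fact (1 ≤ p)] {f : Lp ℂ p (volume : Measure (Rd d))}

lemma HasSpectrumIn.sum_bandLp_narrow (hp : p ≠ ∞) (hf : HasSpectrumIn f j) :
    ∑ k ∈ near j, bandLp hp .narrow k f = f := by
  refine ext_schwartzPairing fun η => ?_
  have hreindex : ∑ k ∈ near j, band .narrow (-k) η = ∑ k ∈ near (-j), band .narrow k η :=
    Finset.sum_equiv (Equiv.neg _)
      (fun k => by simp only [mem_near, Equiv.neg_apply, Pi.neg_apply, neg_sub_neg, abs_sub_comm])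
      fun k _ => rfl
  simp only [map_sum, schwartzPairing_bandLp]
  rw [← sum_apply, ← map_sum, hreindex, ← sub_eq_zero, ← sub_apply, ← map_sub]
  refine hf.schwartzPairing_eq_zero fun ξ hξ => ?_
  have hsub : 𝓕 (∑ k ∈ near (-j), band .narrow k η - η) =
      𝓕 (∑ k ∈ near (-j), band .narrow k η) - 𝓕 η := map_sub (fourierCLM ℂ 𝓢(Rd d, ℂ)) _ _
  rw [hsub, sub_apply, fourier_sum_band, sum_narrow_tensor_near fun i => ?_, Complex.ofReal_one,
    one_mul, sub_self]
  rw [Pi.neg_apply, Int.cast_neg, sub_neg_eq_add]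
  exact (hξ i).trans (by norm_num)

end Overlap

/-! ### Density of the test functions in `E^s_{p,q}` -/

section Density

variable {d : ℕ} {s : ℝ} {p q : ℝ≥0∞} [Fact (1 ≤ p)]

variable (q) in
/-- The sequence with the single non-zero entry `f` at `j`. -/
abbrev SeqLp.single (j : Fin d → ℤ) (f : Lp ℂ p (volume : Measure (Rd d))) : SeqLp d p q :=
  lp.single q j f

lemma single_mem_spectralSeq {j : Fin d → ℤ} {f : Lp ℂ p (volume : Measure (Rd d))}
    (hf : HasSpectrumIn f j) : SeqLp.single q j f ∈ spectralSeq d p q := by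
  refine mem_spectralSeq.2 fun m => mem_spectral.1 ?_
  rcases eq_or_ne m j with rfl | hm
  · rw [lp.single_apply_self]
    exact mem_spectral.2 hf
  · rw [lp.single_apply_ne _ _ _ hm]
    exact Submodule.zero_mem _

variable [Fact (1 ≤ q)]

variable (s q) in
/-- The inclusion of `L^p` functions with spectrum in the cube of index `j` into `E^s_{p,q}`. -/
def atom (j : Fin d → ℤ) : spectral (d := d) p j →L[ℂ] ExpMod d s p q :=
  ExpMod.quot s ∘L ((weight s j : ℂ) • lp.singleContinuousLinearMap ℂ
    (fun _ : Fin d → ℤ => Lp ℂ p (volume : Measure (Rd d))) q j ∘L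
      (spectral p j).subtypeL).codRestrict (spectralSeq d p q) fun f =>
        Submodule.smul_mem _ _ (single_mem_spectralSeq (mem_spectral.1 f.2))

lemma toUltra_atom {j : Fin d → ℤ} (f : spectral (d := d) p j) (φ : GelfandShilov d) :
    (atom s q j f).toUltra φ = schwartzPairing p φ.toSchwartz f.1 := by
  have hself : ((weight s j : ℂ) • SeqLp.single q j f.1) j = weight s j • f.1 := by
    rw [lp.coeFn_smul, Pi.smul_apply, lp.single_apply_self]
    exact Complex.coe_smul _ _
  have hne : ∀ m ≠ j, ((weight s j : ℂ) • SeqLp.single q j f.1) m = 0 := fun m hm => by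
    rw [lp.coeFn_smul, Pi.smul_apply, lp.single_apply_ne _ _ _ hm, smul_zero]
  change seqPairing s ((weight s j : ℂ) • SeqLp.single q j f.1) φ.toSchwartz = _
  rw [seqPairing, tsum_eq_single j fun m hm => ?_]
  · rw [hself, weight_mul_schwartzPairing_weight_smul]
  · rw [hne m hm, map_zero, mul_zero]

variable (p) in
/-- The band of index `j` as a map into the functions with spectrum in the cube of index `j`. -/
def bandSpectral (hp : p ≠ ∞) (j : Fin d → ℤ) :
    Lp ℂ p (volume : Measure (Rd d)) →L[ℂ] spectral (d := d) p j :=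
  (bandLp hp .narrow j).codRestrict (spectral p j) fun f =>
    mem_spectral.2 (hasSpectrumIn_bandLp hp j f)

lemma sum_atom_bandSpectral (hp : p ≠ ∞) {j : Fin d → ℤ} (f : spectral (d := d) p j) :
    ∑ k ∈ near j, atom s q k (bandSpectral p hp k f.1) = atom s q j f := by
  refine ExpMod.ext_apply fun φ => ?_
  rw [map_sum, sum_apply, toUltra_atom]
  simp only [toUltra_atom]
  rw [← map_sum]
  exact congrArg _ ((mem_spectral.1 f.2).sum_bandLp_narrow hp)

lemma hasSum_atom (hq : q ≠ ∞) (w : spectralSeq d p q) :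
    HasSum (fun k => atom s q k ⟨weight (-s) k • w.1 k,
      mem_spectral.2 ((mem_spectralSeq.1 w.2 k).real_smul _)⟩) (ExpMod.quot s w) := by
  have hsum : HasSum (fun k => (⟨SeqLp.single q k (w.1 k),
      single_mem_spectralSeq (mem_spectralSeq.1 w.2 k)⟩ : spectralSeq d p q)) w := by
    rw [← Topology.IsInducing.subtypeVal.hasSum_iff (g := (spectralSeq d p q).subtype)]
    exact lp.hasSum_single hq w.1
  convert (ExpMod.quot s).hasSum hsum using 2 with k
  refine congrArg (ExpMod.quot s) (Subtype.ext ?_)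
  have hinv (f : Lp ℂ p (volume : Measure (Rd d))) :
      weight s k • weight (-s) k • f = f := by
    rw [smul_smul, weight_mul_neg, one_smul]
  change (weight s k : ℂ) • SeqLp.single q k (weight (-s) k • w.1 k) = SeqLp.single q k (w.1 k)
  rw [SeqLp.single, ← lp.single_smul]
  exact congrArg _ ((Complex.coe_smul _ _).trans (hinv _))

variable {L : ExpMod d s p q →L[ℂ] ℂ} (hL : ∀ φ : GelfandShilov d, L (φ.toExpMod s p q) = 0)

include hL

lemma apply_quot_eq_zero_of_hasExpFourier {θ : 𝓢(Rd d, ℂ)} (hθ : HasExpFourier θ)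
    {w : spectralSeq d p q} (hw : IsBandSeq s θ w) : L (ExpMod.quot s w) = 0 := by
  obtain ⟨C, -, hC⟩ := exists_isBandSeq d s p q
  refine hθ.eq_zero_of_forall_norm_le (rate s).2 (C := ‖L‖ * C) fun φ P Q hPQ => ?_
  obtain ⟨v, hv, hv_norm⟩ := hC _ _ _ hPQ
  have hneg : L (ExpMod.quot s w) = -L (ExpMod.quot s v) := by
    rw [hv.unique (φ.isBandSeq_bandSeq.sub hw), map_sub, map_sub, neg_sub]
    exact (sub_eq_self.2 (hL φ)).symm
  rw [hneg, norm_neg, mul_assoc]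
  exact L.le_opNorm_of_le ((ExpMod.norm_quot_le v).trans hv_norm)

lemma apply_atom_bandSpectral_eq_zero (hp : p ≠ ∞) (j : Fin d → ℤ)
    (g : Lp ℂ p (volume : Measure (Rd d))) : L (atom s q j (bandSpectral p hp j g)) = 0 := by
  have hdense : DenseRange fun ψ : 𝓢(Rd d, ℂ) => ψ.toLp p volume :=
    SchwartzMap.denseRange_toLpCLM hp
  refine congrFun (hdense.equalizer (g := fun g => L (atom s q j (bandSpectral p hp j g)))
    (h := fun _ => 0) (by fun_prop) continuous_const (funext fun ψ => ?_)) g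
  obtain ⟨P, Q, hPQ⟩ := (hasExpFourier_band .narrow j ψ).exists_decayBound (rate s).2
  obtain ⟨C, -, hC⟩ := exists_isBandSeq d s p q
  obtain ⟨w, hw, -⟩ := hC _ _ _ hPQ
  have hquot : atom s q j (bandSpectral p hp j (ψ.toLp p)) = ExpMod.quot s w := by
    refine ExpMod.ext_apply fun φ => ?_
    rw [toUltra_atom, hw.toUltra_quot_apply, ← GelfandShilov.coe_toSchwartz,
      ← schwartzPairing_toLp (p := p), ← bandLp_toLp hp]
    rfl
  simp only [Function.comp_apply, hquot]
  exact apply_quot_eq_zero_of_hasExpFourier hL (hasExpFourier_band _ _ _) hw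

lemma eq_zero_of_forall_apply_toExpMod (hp : p ≠ ∞) (hq : q ≠ ∞) : L = 0 := by
  ext u
  obtain ⟨w, rfl⟩ := ExpMod.quot_surjective u
  rw [zero_apply]
  refine (L.hasSum (hasSum_atom hq w)).unique ?_
  convert hasSum_zero (α := ℂ) with k
  rw [← sum_atom_bandSpectral hp, map_sum]
  exact Finset.sum_eq_zero fun m _ => apply_atom_bandSpectral_eq_zero hL hp m _

end Density

/-! ### From elements of `E^{-s}_{p',q'}` to functionals on `E^s_{p,q}` -/

section LocalPart

variable {d : ℕ}

lemma sum_near_neg {M : Type*} [AddCommMonoid M] (j : Fin d → ℤ) (f : (Fin d → ℤ) → M) :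
    ∑ k ∈ near (-j), f k = ∑ n ∈ near (0 : Fin d → ℤ), f (n - j) :=
  Finset.sum_equiv (Equiv.addRight j)
    (fun k => by
      simp only [mem_near, Equiv.coe_addRight, Pi.add_apply, Pi.neg_apply, Pi.zero_apply, sub_zero,
        sub_neg_eq_add])
    fun k _ => by rw [Equiv.coe_addRight, add_sub_cancel_right]

lemma band_comm (τ τ' : Cutoff) (k j : Fin d → ℤ) (ψ : 𝓢(Rd d, ℂ)) :
    band τ k (band τ' j ψ) = band τ' j (band τ k ψ) :=
  fourier_injective (SchwartzMap.ext fun ξ => by simp only [fourier_band, mul_left_comm])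

lemma abs_absOneInt_sub_le (m n : Fin d → ℤ) :
    |absOneInt m - absOneInt n| ≤ absOneInt (m - n) := by
  rw [absOneInt, absOneInt, ← Finset.sum_sub_distrib]
  refine (Finset.abs_sum_le_sum_abs _ _).trans (Finset.sum_le_sum fun i _ => ?_)
  rw [Pi.sub_apply, Int.cast_sub]
  exact abs_abs_sub_abs_le _ _

lemma weight_mul_weight_neg_le (s : ℝ) (m n : Fin d → ℤ) :
    weight s m * weight (-s) (n - m) ≤ weight |s| n := by
  rw [weight, weight, weight, ← Real.rpow_add two_pos]
  refine Real.rpow_le_rpow_of_exponent_le one_le_two ?_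
  have hsub : |absOneInt m - absOneInt (n - m)| ≤ absOneInt n := by
    rw [← absOneInt_neg (n - m), neg_sub]
    exact (abs_absOneInt_sub_le m (m - n)).trans_eq (by rw [sub_sub_cancel])
  calc s * absOneInt m + -s * absOneInt (n - m) = s * (absOneInt m - absOneInt (n - m)) := by ring
    _ ≤ |s| * |absOneInt m - absOneInt (n - m)| := (le_abs_self _).trans_eq (abs_mul _ _)
    _ ≤ |s| * absOneInt n := by gcongr

variable {s : ℝ} {p q : ℝ≥0∞} [Fact (1 ≤ p)]

/-- The entries of `w` whose frequency cubes may meet the one of index `m`, summed and cut off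
around that cube. Unlike `w`, this is determined by `∑ₖ 2^{-s|k|} wₖ`. -/
def localPart (hp : p ≠ ∞) (s : ℝ) (w : SeqLp d p q) (m : Fin d → ℤ) :
    Lp ℂ p (volume : Measure (Rd d)) :=
  ∑ k ∈ near m, (weight (-s) k : ℂ) • bandLp hp .wide m (w k)

lemma schwartzPairing_localPart (hp : p ≠ ∞) (w : spectralSeq d p q) (m : Fin d → ℤ)
    (η : 𝓢(Rd d, ℂ)) :
    schwartzPairing p η (localPart hp s w.1 m) = seqPairing s w.1 (band .wide (-m) η) := by
  rw [localPart, map_sum, seqPairing, tsum_eq_sum (s := near m) fun k hk => ?_]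
  · simp only [map_smul, schwartzPairing_bandLp, smul_eq_mul]
  · obtain ⟨i, hi⟩ := exists_le_abs_sub_of_notMem_near hk
    rw [(mem_spectralSeq.1 w.2 k).schwartzPairing_band_eq_zero .wide (i := i), mul_zero]
    rwa [Pi.neg_apply, neg_add_eq_sub]

lemma IsBandSeq.localPart_eq (hp : p ≠ ∞) {φ : 𝓢(Rd d, ℂ)} {w : spectralSeq d p q}
    (hw : IsBandSeq s φ w) (m : Fin d → ℤ) :
    localPart hp s w.1 m = (band .wide m φ).toLp p := by
  have hterm : ∀ k, (weight (-s) k : ℂ) • bandLp hp .wide m (w.1 k) =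
      (band .narrow k (band .wide m φ)).toLp p := fun k => by
    have hcoe : w.1 k = (weight s k : ℂ) • (band .narrow k φ).toLp p volume :=
      (hw k).trans (Complex.coe_smul _ _).symm
    rw [hcoe, map_smul, smul_smul, ← Complex.ofReal_mul, weight_neg_mul, Complex.ofReal_one,
      one_smul, bandLp_toLp, band_comm]
  rw [localPart, Finset.sum_congr rfl fun k _ => hterm k]
  exact (map_sum (SchwartzMap.toLpCLM ℂ ℂ p (volume : Measure (Rd d))) _ _).symm.trans
    (congrArg (fun ψ : 𝓢(Rd d, ℂ) => ψ.toLp p volume) (sum_band_narrow_wide m φ))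

variable [Fact (1 ≤ q)]

lemma seqPairing_sub {w : spectralSeq d p q} {φ ψ : 𝓢(Rd d, ℂ)} {P Q P' Q' : ℝ}
    (hφ : DecayBound (rate s) P Q φ) (hψ : DecayBound (rate s) P' Q' ψ) :
    seqPairing s w.1 (φ - ψ) = seqPairing s w.1 φ - seqPairing s w.1 ψ := by
  rw [seqPairing, seqPairing, seqPairing,
    ← (summable_seqPairing w.2 hφ).tsum_sub (summable_seqPairing w.2 hψ)]
  simp only [map_sub, sub_apply, mul_sub]

lemma seqPairing_eq_zero_of_hasExpFourier {w : spectralSeq d p q} (hw : ExpMod.quot s w = 0)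
    {θ : 𝓢(Rd d, ℂ)} (hθ : HasExpFourier θ) : seqPairing s w.1 θ = 0 := by
  obtain ⟨C, -, hC⟩ := exists_norm_seqPairing_le d p q s
  obtain ⟨P', Q', hPQ'⟩ := hθ.exists_decayBound (rate s).2
  refine hθ.eq_zero_of_forall_norm_le (rate s).2 (C := C * ‖w.1‖) fun φ P Q hPQ => ?_
  have hφ : seqPairing s w.1 φ.toSchwartz = 0 := by
    rw [← synthesis_apply, ← ExpMod.toUltra_quot, hw, map_zero, zero_apply]
  have hneg : seqPairing s w.1 (φ.toSchwartz - θ) = -seqPairing s w.1 θ := by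
    rw [seqPairing_sub (φ.decayBound (rate s)) hPQ', hφ, zero_sub]
  rw [← norm_neg, ← hneg, mul_assoc]
  exact hC w.1 w.2 _ _ _ hPQ

lemma localPart_eq_zero (hp : p ≠ ∞) {w : spectralSeq d p q} (hw : ExpMod.quot s w = 0)
    (m : Fin d → ℤ) : localPart hp s w.1 m = 0 :=
  ext_schwartzPairing fun η => by
    rw [schwartzPairing_localPart,
      seqPairing_eq_zero_of_hasExpFourier hw (hasExpFourier_band _ _ _), map_zero]

/-- The map `w ↦ w ∘ σ` on `ℓ^q`, for a permutation `σ` of the indices. -/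
def reindex {ι E : Type*} [NormedAddCommGroup E] [NormedSpace ℂ E] (hq : q ≠ ∞) (σ : ι ≃ ι) :
    lp (fun _ : ι => E) q →L[ℂ] lp (fun _ : ι => E) q :=
  have hq0 : 0 < q.toReal :=
    ENNReal.toReal_pos (zero_lt_one.trans_le (Fact.out : 1 ≤ q)).ne' hq
  LinearMap.mkContinuous
    { toFun := fun w => ⟨fun i => w (σ i), memℓp_gen
        (σ.summable_iff.2 ((lp.memℓp w).summable hq0))⟩
      map_add' := fun _ _ => rfl
      map_smul' := fun _ _ => rfl } 1 fun w => by
        rw [one_mul, lp.norm_eq_tsum_rpow hq0, lp.norm_eq_tsum_rpow hq0]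
        exact le_of_eq (congrArg (· ^ (1 / q.toReal)) (σ.tsum_eq fun i => ‖w i‖ ^ q.toReal))

/-- The contribution of the entries at `n - m` to the weighted local parts at `-m`. -/
def shiftBand (hp : p ≠ ∞) (hq : q ≠ ∞) (s : ℝ) (n : Fin d → ℤ) :
    SeqLp d p q →L[ℂ] SeqLp d p q :=
  lp.mapCLM q
    (fun m => ((weight s m * weight (-s) (n - m) : ℝ) : ℂ) • bandLp (p := p) hp .wide (-m))
    (K := weight |s| n * ∫ t, ‖(𝓕⁻ (Cutoff.wide.symbol (0 : Fin d → ℤ))) t‖)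
    (mul_nonneg (weight_pos _ _).le (by positivity))
    (fun m => by
      have hpos := mul_pos (weight_pos s m) (weight_pos (-s) (n - m))
      rw [norm_smul, Complex.norm_real, Real.norm_of_nonneg hpos.le]
      exact mul_le_mul (weight_mul_weight_neg_le s m n) (norm_bandLp_le hp _ _) (norm_nonneg _)
        (weight_pos _ _).le) ∘L
  reindex hq (Equiv.subLeft n)

/-- The weighted local parts with reflected index, `m ↦ 2^{s|m|} · localPart w (-m)`. -/
def localSeq (hp : p ≠ ∞) (hq : q ≠ ∞) (s : ℝ) : SeqLp d p q →L[ℂ] SeqLp d p q :=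
  ∑ n ∈ near (0 : Fin d → ℤ), shiftBand hp hq s n

lemma localSeq_apply (hp : p ≠ ∞) (hq : q ≠ ∞) (w : SeqLp d p q) (m : Fin d → ℤ) :
    localSeq hp hq s w m = (weight s m : ℂ) • localPart hp s w (-m) := by
  rw [localSeq, localPart, sum_near_neg, sum_apply, lp.coeFn_sum, Finset.sum_apply,
    Finset.smul_sum]
  refine Finset.sum_congr rfl fun n _ => ?_
  rw [smul_smul, ← Complex.ofReal_mul]
  rfl

end LocalPart

/-! ### The duality theorem -/

section Duality

lemma exists_factor_of_surjective {E F : Type*} [NormedAddCommGroup E] [NormedSpace ℂ E]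
    [CompleteSpace E] [NormedAddCommGroup F] [NormedSpace ℂ F] [CompleteSpace F] {π : E →L[ℂ] F}
    (hπ : Function.Surjective π) (T : E →L[ℂ] ℂ) (hT : ∀ w, π w = 0 → T w = 0) :
    ∃ L : F →L[ℂ] ℂ, ∀ w, L (π w) = T w := by
  let L : F →ₗ[ℂ] ℂ := (π.ker.liftQ T.toLinearMap hT) ∘ₗ
    (π.toLinearMap.quotKerEquivOfSurjective hπ).symm.toLinearMap
  have hL : ∀ w, L (π w) = T w := fun w => by
    have hmk : (π.toLinearMap.quotKerEquivOfSurjective hπ).symm (π w) = Submodule.Quotient.mk w :=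
      (LinearEquiv.symm_apply_eq _).2 rfl
    exact (congrArg _ hmk).trans rfl
  exact ⟨⟨L, (π.isQuotientMap hπ).continuous_iff.2 (T.continuous.congr fun w => (hL w).symm)⟩, hL⟩

variable {d : ℕ} {s : ℝ} {p q p' q' : ℝ≥0∞} [Fact (1 ≤ p)] [Fact (1 ≤ q)] [Fact (1 ≤ p')]
  [Fact (1 ≤ q')] [ENNReal.HolderConjugate p p'] [ENNReal.HolderConjugate q q']

variable (d p q p' q') in
/-- The pairing `(w, g) ↦ ∑ₘ ∫ wₘ gₘ` of `ℓ^q(L^p)` and `ℓ^{q'}(L^{p'})`. -/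
def seqMulPairing : SeqLp d p q →L[ℂ] SeqLp d p' q' →L[ℂ] ℂ :=
  lp.dualPairing q q' (fun _ : Fin d → ℤ => mulPairing (volume : Measure (Rd d)) p p') (K := 1)
    fun _ => ContinuousLinearMap.opNorm_le_bound₂ _ zero_le_one fun f h => by
      rw [NNReal.coe_one, one_mul]
      exact norm_mulPairing_le f h

lemma seqMulPairing_localSeq (hp : p ≠ ∞) (hq : q ≠ ∞) (w : SeqLp d p q) (g : SeqLp d p' q') :
    seqMulPairing d p q p' q' (localSeq hp hq s w) g =
      ∑' m, (weight s m : ℂ) * mulPairing volume p p' (localPart hp s w (-m)) (g m) := by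
  refine (lp.dualPairing_apply _ _ _ _).trans (tsum_congr fun m => ?_)
  rw [localSeq_apply, map_smul, smul_apply, smul_eq_mul]

lemma IsBandSeq.seqMulPairing_localSeq (hp : p ≠ ∞) (hq : q ≠ ∞) {φ : 𝓢(Rd d, ℂ)}
    {w : spectralSeq d p q} (hw : IsBandSeq s φ w) (g : spectralSeq d p' q') :
    seqMulPairing d p q p' q' (localSeq hp hq s w.1) g.1 = seqPairing (-s) g.1 φ := by
  rw [ExpModulation.seqMulPairing_localSeq, seqPairing]
  refine tsum_congr fun m => ?_
  rw [hw.localPart_eq hp, neg_neg, mulPairing_toLp_left,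
    ← (mem_spectralSeq.1 g.2 m).schwartzPairing_wide_band φ, schwartzPairing_apply]
  simp only [mul_comm]

lemma exists_dual_of_expMod (hp : p ≠ ∞) (hq : q ≠ ∞) (v : ExpMod d (-s) p' q') :
    ∃ L : ExpMod d s p q →L[ℂ] ℂ, ∀ φ : GelfandShilov d,
      L (φ.toExpMod s p q) = v.toUltra φ := by
  obtain ⟨g, rfl⟩ := ExpMod.quot_surjective v
  let T : spectralSeq d p q →L[ℂ] ℂ :=
    (seqMulPairing d p q p' q').flip g.1 ∘L localSeq hp hq s ∘L (spectralSeq d p q).subtypeL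
  have hT : ∀ w, T w = seqMulPairing d p q p' q' (localSeq hp hq s w.1) g.1 := fun _ => rfl
  have hker : ∀ w : spectralSeq d p q, ExpMod.quot s w = 0 → T w = 0 := fun w hw => by
    rw [hT, seqMulPairing_localSeq]
    simp only [localPart_eq_zero hp hw, map_zero, zero_apply, mul_zero, tsum_zero]
  obtain ⟨L, hL⟩ := exists_factor_of_surjective (E := spectralSeq d p q) (F := ExpMod d s p q)
    (π := ExpMod.quot s) ExpMod.quot_surjective T hker
  refine ⟨L, fun φ => ?_⟩
  rw [GelfandShilov.toExpMod, hL, hT, ExpMod.toUltra_quot, synthesis_apply]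
  exact φ.isBandSeq_bandSeq.seqMulPairing_localSeq hp hq g

variable (d s p q p' q') in
lemma exists_restriction_map (hp : p ≠ ∞) (hq : q ≠ ∞) :
    ∃ J : (ExpMod d s p q →L[ℂ] ℂ) →L[ℂ] ExpMod d (-s) p' q',
      ∀ L φ, (J L).toUltra φ = L (φ.toExpMod s p q) := by
  obtain ⟨C, hC⟩ := exists_expMod_of_dual d s p q p' q' hp hq
  choose v hv_norm hv using hC
  exact ⟨LinearMap.mkContinuous
    { toFun := v
      map_add' := fun L M => ExpMod.ext_apply fun φ => by
        rw [map_add, add_apply, hv, hv, hv, add_apply]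
      map_smul' := fun c L => ExpMod.ext_apply fun φ => by
        rw [map_smul, smul_apply, hv, hv, smul_apply, RingHom.id_apply] } C hv_norm, hv⟩

variable (d s p q p' q') in
theorem exists_duality (hp : p ≠ ∞) (hq : q ≠ ∞) :
    ∃ J : (ExpMod d s p q →L[ℂ] ℂ) ≃L[ℂ] ExpMod d (-s) p' q',
      ∀ L φ, (J L).toUltra φ = L (φ.toExpMod s p q) := by
  obtain ⟨J, hJ⟩ := exists_restriction_map d s p q p' q' hp hq
  have hinj : J.ker = ⊥ := LinearMap.ker_eq_bot'.2 fun L hL =>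
    eq_zero_of_forall_apply_toExpMod (fun φ => by
      rw [← hJ, show J L = 0 from hL, map_zero, zero_apply]) hp hq
  have hsurj : J.range = ⊤ := LinearMap.range_eq_top.2 fun v => by
    obtain ⟨L, hL⟩ := exists_dual_of_expMod hp hq v
    exact ⟨L, ExpMod.ext_apply fun φ => (hJ L φ).trans (hL φ)⟩
  refine ⟨ContinuousLinearEquiv.ofBijective J hinj hsurj, fun L φ => ?_⟩
  rw [ContinuousLinearEquiv.coeFn_ofBijective, hJ]

end Duality

end ExpModulation

end

open ExpModulation in
theorem proposition5p6 (d : ℕ) (s : ℝ) :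
    -- duality
    (∀ (p q p' q' : ℝ≥0∞) [Fact (1 ≤ p)] [Fact (1 ≤ q)] [Fact (1 ≤ p')] [Fact (1 ≤ q')],
      ENNReal.HolderConjugate p p' → ENNReal.HolderConjugate q q' → p ≠ ∞ → q ≠ ∞ →
      ∃ J : (ExpMod d s p q →L[ℂ] ℂ) ≃L[ℂ] ExpMod d (-s) p' q',
        ∀ φ : GelfandShilov d, ∃ h : ExpMod d s p q,
          (∀ ψ : GelfandShilov d, h.toUltra ψ = ∫ x, φ x * ψ x) ∧
          ∀ L : ExpMod d s p q →L[ℂ] ℂ, (J L).toUltra φ = L h) ∧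
    -- completeness of the norm
    (∀ (p q : ℝ≥0∞) [Fact (1 ≤ p)] [Fact (1 ≤ q)],
      (∀ u : ExpMod d s p q, ‖u‖ = 0 ↔ u = 0) ∧ CompleteSpace (ExpMod d s p q)) := by
  refine ⟨fun p q p' q' _ _ _ _ _ _ hp hq => ?_,
    fun p q => ⟨ExpMod.norm_eq_zero_iff, inferInstance⟩⟩
  obtain ⟨J, hJ⟩ := exists_duality d s p q p' q' hp hq
  exact ⟨J, fun φ => ⟨φ.toExpMod s p q, φ.toUltra_toExpMod, fun L => hJ L φ⟩⟩
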